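/- Let $K$ be an infinite field, let $n,d\ge 1$ and $m\ge 0$ be integers, and let $A=(k_1,\dots,k_{d+1})$ be a tuple of nonnegative integers. **Notation.** For an integer tuple $B=(b_1,\dots,b_r)$, a $B$-subscheme of $\mathbb P^{N-1}=\mathbb P^{N-1}_K$ is a scheme $\{p_1\}^{b_1}\cup\dots\cup\{p_r\}^{b_r}$, where for a projective subspace $X$ with ideal sheaf $\mathcal I_X$ the scheme $X^b$ is defined by $\mathcal I_X^{b}$ (and is empty for $b\le 0$). "Generic" means: for all $(p_1,\dots,p_r)$ in some nonempty Zariski open subset of $(\mathbb P^{N-1})^r$. Write $HPTS(r,B,N)_m$ for the value in degree $m$ of the Hilbert function (the codimension in $S_m$ of the space of $m$-ics through the scheme, $S=K[x_1,\dots,x_N]$) of a generic $B$-subscheme of $\mathbb P^{N-1}$. For integer tuples $J=(j_1,\dots,j_r)$ and $T\subseteq\{1,\dots,r\}$ put $$F'_T(J,N)_m=\sum_{B\subseteq T}(-1)^{\#B}\binom{N-1+m-\sum_{i\in B}j_i}{N-1},$$ where a binomial coefficient is read as $0$ if $m<\sum_{i\in B}j_i$. Put $F(r,J,N)_m=0$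 if $F'_T(J,N)_m\le 0$ for some $T$, and $F(r,J,N)_m=F'_{\{1,\dots,r\}}(J,N)_m$ otherwise. Finally $$G(r,B,N)_m=\dim S_m-F\bigl(r,(m+1-b_1,\dots,m+1-b_r),N\bigr)_m .$$ A scheme $Z=\{p_1\}^{k_1}\cup\dots\cup\{p_{d+1}\}^{k_{d+1}}\subset\mathbb P^n$ has *only the expected linear obstructions* in degree $m$ if for every $j$ and every $1\le\ell\le k_j$ the base locus of the linear system of $m$-ics through $\{p_j\}^{\ell-1}\cup\bigcup_{i\ne j}\{p_i\}^{k_i}$ meets $\{p_j\}^{\ell}$ in precisely the scheme $$\Bigl(\{p_j\}^{\ell-1}\cup\bigcup_{T\not\ni j}\operatorname{span}(p_j,\,p_i: i\in T)^{\,\ell+\sum_{i\in T}k_i-\#T\cdot m-1}\Bigr)\cap\{p_j\}^{\ell}.$$ **Statement.** Suppose that $$k_1\le\dots\le k_{d+1}\quad\text{and}\quad 2k_{d}+k_{d+1}\le 2m+2,$$ let $C=(k_1-(m+1-k_{d+1}),\dots,k_d-(m+1-k_{d+1}))$, and suppose that $$HPTS(d,C,n)_{k_{d+1}-1}=G(d,C,n)_{k_{d+1}-1}.$$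 (If $k_{d+1}=0$ this supposition is automatically true, both sides being $0$.) Then $$HPTS(d+1,A,n+1)_m\le G(d+1,A,n+1)_m .$$ Suppose moreover that $\operatorname{char}K=0$ or $\operatorname{char}K>m$. If a generic $A$-subscheme of $\mathbb P^n$ has only the expected linear obstructions in degree $m$, then equality holds. Conversely, if equality holds and $G(d+1,A,n+1)_m<\binom{n+m}{n}$, then a generic $A$-subscheme of $\mathbb P^n$ has only the expected linear obstructions in degree $m$. -/

import Mathlib

open MvPolynomial

/-! ### Closed subschemes of projective space

`S = K[x_0, …, x_{N-1}]` is the homogeneous coordinate ring of `ℙ^{N-1}`. A closed subscheme of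
`ℙ^{N-1}` is given by a homogeneous ideal of `S`: unions of subschemes are intersections of ideals,
intersections of subschemes are sums of ideals, the empty scheme is given by the unit ideal. -/

/-- The points of the projective space `ℙ^{N-1}` over `K`. -/
abbrev ProjPoint (K : Type*) [Field K] (N : ℕ) : Type _ := Projectivization K (Fin N → K)

/-- The homogeneous ideal of the projective subspace of `ℙ^{N-1}` given by the linear subspace `W`
of `K^N`: it is generated by the linear forms that vanish on `W`. -/
noncomputable def linearIdeal {K : Type*} [Field K] {N : ℕ} (W : Submodule K (Fin N → K)) :
    Ideal (MvPolynomial (Fin N) K) :=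
  Ideal.span {F | F.IsHomogeneous 1 ∧ ∀ v ∈ W, eval v F = 0}

/-- The ideal of `X^a`, for `X` the projective subspace given by `W` and `a` an integer; `X^a` is
the `(a-1)`-th infinitesimal neighbourhood of `X`, and it is empty for `a ≤ 0`. -/
noncomputable def fatLinearIdeal {K : Type*} [Field K] {N : ℕ} (W : Submodule K (Fin N → K)) (a : ℤ) :
    Ideal (MvPolynomial (Fin N) K) :=
  linearIdeal W ^ a.toNat

/-- The ideal of the `A`-subscheme `{p_1}^{a_1} ∪ … ∪ {p_d}^{a_d}` of `ℙ^{N-1}`. -/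
noncomputable def fatPointsIdeal {K : Type*} [Field K] {N d : ℕ} (p : Fin d → ProjPoint K N) (A : Fin d → ℤ) :
    Ideal (MvPolynomial (Fin N) K) :=
  ⨅ i, fatLinearIdeal (p i).submodule (A i)

/-- The forms of degree `m` in the ideal `I`. -/
noncomputable def gradedPiece {K : Type*} [Field K] {N : ℕ} (I : Ideal (MvPolynomial (Fin N) K)) (m : ℕ) :
    Submodule K (MvPolynomial (Fin N) K) :=
  I.restrictScalars K ⊓ homogeneousSubmodule (Fin N) K m

/-- The codimension of `I_m` in `S_m`. For a saturated homogeneous ideal, in particular for the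
ideal of a union of fat points, this is the Hilbert function of the subscheme in degree `m`. -/
noncomputable def hilbertFunction {K : Type*} [Field K] {N : ℕ}
    (I : Ideal (MvPolynomial (Fin N) K)) (m : ℕ) : ℕ :=
  Module.finrank K (homogeneousSubmodule (Fin N) K m) - Module.finrank K (gradedPiece I m)

/-- Two homogeneous ideals define the same closed subscheme of projective space: they agree in all
large degrees. -/
def SameSubscheme {K : Type*} [Field K] {N : ℕ} (I J : Ideal (MvPolynomial (Fin N) K)) : Prop :=
  ∃ t₀ : ℕ, ∀ t ≥ t₀, gradedPiece I t = gradedPiece J t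

/-- The ideal of the base locus of the linear system of `m`-ics through the subscheme given by
the saturated ideal `I`. -/
noncomputable def baseLocusIdeal {K : Type*} [Field K] {N : ℕ} (I : Ideal (MvPolynomial (Fin N) K)) (m : ℕ) :
    Ideal (MvPolynomial (Fin N) K) :=
  Ideal.span (gradedPiece I m : Set (MvPolynomial (Fin N) K))

/-! ### Generic configurations -/

/-- A property holds for a generic `d`-tuple of points of `ℙ^{N-1}`: it holds on a nonempty Zariski
open subset of `(ℙ^{N-1})^d`, described in homogeneous coordinates. -/
def ForGeneric {K : Type*} [Field K] {N d : ℕ} (P : (Fin d → ProjPoint K N) → Prop) : Prop :=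
  ∃ f : MvPolynomial (Fin d × Fin N) K, f ≠ 0 ∧
    ∀ (v : Fin d → Fin N → K) (hv : ∀ i, v i ≠ 0),
      eval (fun ij : Fin d × Fin N => v ij.1 ij.2) f ≠ 0 →
        P fun i => Projectivization.mk K (v i) (hv i)

/-- `HPTS(d, A, N)_m`: the value in degree `m` of the Hilbert function of a generic `A`-subscheme
of `ℙ^{N-1}`. Over an infinite field the set below has exactly one element. -/
noncomputable def HPTS (K : Type*) [Field K] (d : ℕ) (A : Fin d → ℤ) (N m : ℕ) : ℕ :=
  sSup {h | ForGeneric fun p : Fin d → ProjPoint K N => hilbertFunction (fatPointsIdeal p A) m = h}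

/-! ### The Fröberg–Iarrobino function -/

/-- The number of monomials of degree `s` in `N` variables, that is `(N - 1 + s).choose (N - 1)`
for `s ≥ 0` and `0` for `s < 0`. -/
def numForms (N : ℕ) (s : ℤ) : ℤ :=
  if 0 ≤ s then (N.multichoose s.toNat : ℤ) else 0

/-- `F'(d', A', N)_m` for the sub-tuple `A'` of `A` on the set of indices `T`, namely
`∑_{B ⊆ A'} (-1)^{ℓ(B)} (N - 1 + m - |B|).choose (N - 1)`. -/
def frobergSum {d : ℕ} (A : Fin d → ℤ) (T : Finset (Fin d)) (N m : ℕ) : ℤ :=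
  ∑ B ∈ T.powerset, (-1) ^ B.card * numForms N (m - ∑ i ∈ B, A i)

/-- `F(d, A, N)_m`: it is `0` once `F'(d', A', N)_m ≤ 0` for some sub-tuple `A' ⊆ A`, and
`F'(d, A, N)_m` otherwise. -/
def froberg (d : ℕ) (A : Fin d → ℤ) (N m : ℕ) : ℤ :=
  if ∃ T : Finset (Fin d), frobergSum A T N m ≤ 0 then 0 else frobergSum A Finset.univ N m

/-- `G(d, (k_1, …, k_d), N)_m = dim S_m - F(d, (m + 1 - k_1, …, m + 1 - k_d), N)_m`. -/
def frobergIarrobino (d : ℕ) (A : Fin d → ℤ) (N m : ℕ) : ℤ :=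
  numForms N m - froberg d (fun i => m + 1 - A i) N m

/-! ### Expected linear obstructions -/

/-- The ideal of `{p_j}^{l-1} ∪ Z'`, where `Z'` is the union of the `{p_i}^{k_i}` with `i ≠ j`. -/
noncomputable def previousIdeal {K : Type*} [Field K] {N d : ℕ} (p : Fin d → ProjPoint K N) (k : Fin d → ℕ)
    (j : Fin d) (l : ℕ) : Ideal (MvPolynomial (Fin N) K) :=
  fatPointsIdeal p (Function.update (fun i => (k i : ℤ)) j ((l : ℤ) - 1))

/-- The ideal of the expected linear obstruction scheme on `{p_j}^l` induced by `m`-ics through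
`{p_j}^{l-1} ∪ Z'`, where `Z'` is the union of the `{p_i}^{k_i}` with `i ≠ j`. It is the scheme
`({p_j}^{l-1} ∪ ⋃_T span(p_j, p_i : i ∈ T)^{l + ∑_{i ∈ T} k_i - |T| m - 1}) ∩ {p_j}^l`,
where `T` runs over the sets of indices different from `j`. -/
noncomputable def expectedObstructionIdeal {K : Type*} [Field K] {N d : ℕ} (p : Fin d → ProjPoint K N)
    (k : Fin d → ℕ) (m : ℕ) (j : Fin d) (l : ℕ) : Ideal (MvPolynomial (Fin N) K) :=
  (fatLinearIdeal (p j).submodule ((l : ℤ) - 1) ⊓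
      ⨅ T : {T : Finset (Fin d) // j ∉ T},
        fatLinearIdeal ((p j).submodule ⊔ ⨆ i ∈ T.1, (p i).submodule)
          ((l : ℤ) + ∑ i ∈ T.1, (k i : ℤ) - T.1.card * m - 1)) ⊔
    fatLinearIdeal (p j).submodule l

/-- `Z = {p_1}^{k_1} ∪ … ∪ {p_d}^{k_d}` has only the expected linear obstructions in degree `m`:
for each `j` and each `1 ≤ l ≤ k_j` the base locus of the linear system of `m`-ics through
`{p_j}^{l-1} ∪ Z'` meets `{p_j}^l` in precisely the expected linear obstruction scheme, where `Z'`
is the union of the `{p_i}^{k_i}` with `i ≠ j`. -/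
def OnlyExpectedLinearObstructions {K : Type*} [Field K] {N d : ℕ} (p : Fin d → ProjPoint K N)
    (k : Fin d → ℕ) (m : ℕ) : Prop :=
  ∀ (j : Fin d) (l : ℕ), 1 ≤ l → l ≤ k j →
    SameSubscheme
      (baseLocusIdeal (previousIdeal p k j l) m ⊔ fatLinearIdeal (p j).submodule l)
      (expectedObstructionIdeal p k m j l)

/-! Put J_i = m + 1 - k_i and let L_i be the linear form whose coefficients are the coordinates of
p_i. If m! is invertible, apolarity makes the m-ics through Z the orthogonal complement of the
degree m part of the ideal (L_1^{J_1}, L_2^{J_2}, …), so the Hilbert function is the dimension of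
that part (`hilbertFunction_eq_finrank_powerPiece`). The numerical hypothesis says that any three
J_i add up to more than m (`triple_sum_lt`). The hypothesis on C says, outside of a degenerate case,
that modulo L_{d+1}, that is after projection from p_{d+1}, the other powers satisfy no relation in
degree m - J_{d+1}. Since J_{d+1} is the smallest exponent, this carries over to the projection from
every other p_j (`generically_indepMod`).

For a set X of indices, `excess` is the actual codimension in degree m of the ideal of the powers in
X, minus the alternating sum that predicts it. Adding L_j^{J_j} lowers the prediction by the
dimension of the quotient by X in degree m - J_j, which is the true one by independence. So the
excess never drops, and it stays the same exactly if multiplication by L_j^{J_j} into degree m is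
injective modulo X (`excess_insert`). It starts at 0, whence the inequality; equality of the
untruncated values means injectivity at every step.

Geometrically, filter the m-ics through the other points by their order of vanishing at p_j. Leading
coefficients of those vanishing to order a are a-ics through the projected multiple points, and
these a-ics are exactly what the expected obstructions allow (`gradedPiece_iInf_eq_fatIdeal`).
Adding up dimensions over a, only the expected obstructions occur at p_j if and only if
multiplication by L_j^{J_j} is injective modulo all the other powers
(`sameSubscheme_obstructionIdeal_iff_injOn`). Injectivity modulo fewer powers follows by moving
points along lines (`injOn_of_injOn_insert`, `generically_injOn`).

Two points remain. If F vanishes for the projected data, then it vanishes for the original data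
(`exists_subset_koszulEuler_le`), and in good characteristic no m-ics pass through Z
(`forms_le_powerPiece_of_centralProj`), so that every claim is immediate. In arbitrary
characteristic the inequality is proved over ℚ: Hilbert functions of generic points are ranks of
specialised integer matrices and can only grow on passing from K to ℚ (`hpts_le_hpts_rat`). -/

/-! ### Alternating sums of binomial coefficients as coefficients of a power series. -/

lemma numForms_of_neg (N : ℕ) {s : ℤ} (h : s < 0) : numForms N s = 0 := by
  simp [numForms, not_le.mpr h]

lemma numForms_nonneg (N : ℕ) (s : ℤ) : 0 ≤ numForms N s := by
  unfold numForms; split_ifs <;> simp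

lemma numForms_zero_left (s : ℤ) : numForms 0 s = if s = 0 then 1 else 0 := by
  unfold numForms
  rcases lt_trichotomy s 0 with h | h | h
  · rw [if_neg (by omega), if_neg (by omega)]
  · simp [h]
  · obtain ⟨t, rfl⟩ : ∃ t : ℕ, s = t + 1 := ⟨(s - 1).toNat, by omega⟩
    rw [if_pos (by omega), if_neg (by omega)]
    have : ((t : ℤ) + 1).toNat = t + 1 := by omega
    simp [this]

lemma numForms_succ (N : ℕ) (s : ℤ) :
    numForms (N + 1) s = numForms (N + 1) (s - 1) + numForms N s := by
  unfold numForms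
  rcases lt_trichotomy s 0 with h | h | h
  · rw [if_neg (by omega), if_neg (by omega), if_neg (by omega)]; simp
  · simp [h]
  · obtain ⟨t, rfl⟩ : ∃ t : ℕ, s = t + 1 := ⟨(s - 1).toNat, by omega⟩
    rw [if_pos (by omega), if_pos (by omega), if_pos (by omega)]
    have h1 : ((t : ℤ) + 1).toNat = t + 1 := by omega
    have h2 : ((t : ℤ) + 1 - 1).toNat = t := by omega
    rw [h1, h2, Nat.multichoose_succ_succ]; push_cast; ring

/-- The coefficient of `z^s` in `∏_{i ∈ T} (1 - z^{u_i}) / (1 - z)^N`. -/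
def koszulEuler {ι : Type*} (u : ι → ℤ) (T : Finset ι) (N : ℕ) (s : ℤ) : ℤ :=
  ∑ B ∈ T.powerset, (-1) ^ B.card * numForms N (s - ∑ i ∈ B, u i)

lemma frobergSum_eq_koszulEuler {d : ℕ} (A : Fin d → ℤ) (T : Finset (Fin d)) (N m : ℕ) :
    frobergSum A T N m = koszulEuler A T N m := rfl

section
variable {ι : Type*} (u : ι → ℤ)

lemma koszulEuler_empty (N : ℕ) (s : ℤ) : koszulEuler u ∅ N s = numForms N s := by
  simp [koszulEuler]

/-- A factor 1 - z^{u_i} splits off the generating function. -/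
lemma koszulEuler_insert [DecidableEq ι] {T : Finset ι} {i : ι} (hi : i ∉ T) (N : ℕ) (s : ℤ) :
    koszulEuler u (insert i T) N s = koszulEuler u T N s - koszulEuler u T N (s - u i) := by
  unfold koszulEuler
  rw [Finset.sum_powerset_insert hi, sub_eq_add_neg, ← Finset.sum_neg_distrib]
  congr 1
  refine Finset.sum_congr rfl fun B hB => ?_
  have hiB : i ∉ B := fun h => hi (Finset.mem_powerset.mp hB h)
  rw [Finset.card_insert_of_notMem hiB, Finset.sum_insert hiB, pow_succ]
  rw [show s - (u i + ∑ x ∈ B, u x) = s - u i - ∑ x ∈ B, u x by ring]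
  ring

lemma koszulEuler_succ (T : Finset ι) (N : ℕ) (s : ℤ) :
    koszulEuler u T (N + 1) s = koszulEuler u T (N + 1) (s - 1) + koszulEuler u T N s := by
  unfold koszulEuler
  rw [← Finset.sum_add_distrib]
  refine Finset.sum_congr rfl fun B _ => ?_
  rw [numForms_succ, show s - ∑ i ∈ B, u i - 1 = s - 1 - ∑ i ∈ B, u i by ring]
  ring

lemma koszulEuler_of_neg {T : Finset ι} (hu : ∀ i ∈ T, 0 ≤ u i) (N : ℕ) {s : ℤ} (hs : s < 0) :
    koszulEuler u T N s = 0 := by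
  unfold koszulEuler
  refine Finset.sum_eq_zero fun B hB => ?_
  rw [numForms_of_neg, mul_zero]
  have : 0 ≤ ∑ i ∈ B, u i :=
    Finset.sum_nonneg fun i hi => hu i (Finset.mem_powerset.mp hB hi)
  omega

/-- In degrees below all the sums of two exponents only the linear terms remain. -/
lemma koszulEuler_of_lt [DecidableEq ι] {T : Finset ι} (hu : ∀ i ∈ T, 0 ≤ u i) (N : ℕ) {s : ℤ}
    (hs : ∀ i ∈ T, ∀ j ∈ T, i ≠ j → s < u i + u j) :
    koszulEuler u T N s = numForms N s - ∑ i ∈ T, numForms N (s - u i) := by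
  induction T using Finset.induction_on with
  | empty => simp [koszulEuler_empty]
  | insert a T ha ih =>
    rw [koszulEuler_insert u ha, ih (fun i hi => hu i (Finset.mem_insert_of_mem hi))
      (fun i hi j hj => hs i (Finset.mem_insert_of_mem hi) j (Finset.mem_insert_of_mem hj)),
      Finset.sum_insert ha]
    have : koszulEuler u T N (s - u a) = numForms N (s - u a) := by
      unfold koszulEuler
      rw [Finset.sum_eq_single ∅]
      · simp
      · intro B hB hne
        obtain ⟨b, hb⟩ := Finset.nonempty_iff_ne_empty.mpr hne
        have hbT := Finset.mem_powerset.mp hB hb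
        rw [numForms_of_neg, mul_zero]
        have h1 : u b ≤ ∑ i ∈ B, u i := Finset.single_le_sum
          (fun i hi => hu i (Finset.mem_insert_of_mem (Finset.mem_powerset.mp hB hi))) hb
        have := hs a (Finset.mem_insert_self _ _) b (Finset.mem_insert_of_mem hbT)
          (fun h => ha (h ▸ hbT))
        omega
      · simp
    rw [this]; ring

/-- Dividing by 1 - z sums up coefficients, so the values in N variables are the increments of those
in N + 1 variables. All sign arguments below pass between N and N + 1 in this way. -/
lemma koszulEuler_sub_eq_sum (T : Finset ι) (N : ℕ) (s : ℤ) (w : ℕ) :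
    koszulEuler u T (N + 1) (s + w) - koszulEuler u T (N + 1) s =
      ∑ t ∈ Finset.range w, koszulEuler u T N (s + t + 1) := by
  induction w with
  | zero => simp
  | succ w ih =>
    rw [Finset.sum_range_succ, ← ih, koszulEuler_succ u T N (s + (w + 1 : ℕ))]
    push_cast
    rw [show s + (w + 1 : ℤ) - 1 = s + w by ring, show s + (w : ℤ) + 1 = s + (w + 1) by ring]
    ring

end

/-! ### Signs of the alternating sums: vanishing of F passes up from a projection. -/

section
variable {ι : Type*} [DecidableEq ι] {u : ι → ℤ}

lemma koszulEuler_eq_sum (hu : ∀ i, 0 ≤ u i) (T : Finset ι) (N w : ℕ) :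
    koszulEuler u T (N + 1) ((w : ℤ) - 1) = ∑ t ∈ Finset.range w, koszulEuler u T N t := by
  have h := koszulEuler_sub_eq_sum u T N (-1) w
  rw [koszulEuler_of_neg u (fun i _ => hu i) (N + 1) (show (-1 : ℤ) < 0 by norm_num), sub_zero] at h
  rw [sub_eq_neg_add, h]
  refine Finset.sum_congr rfl fun t _ => ?_
  congr 1; ring

/-- In the linear range, a positive value is preceded by nonnegative values only. -/
lemma koszulEuler_nonneg_of_pos (hu : ∀ i, 1 ≤ u i) (T : Finset ι) (N : ℕ) :
    ∀ s t : ℤ, (∀ i ∈ T, ∀ j ∈ T, i ≠ j → s < u i + u j) → t ≤ s →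
      0 < koszulEuler u T N s → 0 ≤ koszulEuler u T N t := by
  have hu0 : ∀ i, 0 ≤ u i := fun i => zero_le_one.trans (hu i)
  induction N with
  | zero =>
    intro s t hs hts hpos
    rcases lt_or_ge t 0 with ht | ht
    · rw [koszulEuler_of_neg u (fun i _ => hu0 i) _ ht]
    · rw [koszulEuler_of_lt u (fun i _ => hu0 i) 0 hs] at hpos
      have hsum : 0 ≤ ∑ i ∈ T, numForms 0 (s - u i) :=
        Finset.sum_nonneg fun i _ => numForms_nonneg _ _
      have hs0 : s = 0 := by
        by_contra h
        rw [numForms_zero_left, if_neg h] at hpos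
        omega
      have ht0 : t = s := by omega
      rw [ht0, koszulEuler_of_lt u (fun i _ => hu0 i) 0 hs]
      exact hpos.le
  | succ N ih =>
    intro s t hs hts hpos
    rcases lt_or_ge t 0 with ht | ht
    · rw [koszulEuler_of_neg u (fun i _ => hu0 i) _ ht]
    obtain ⟨w, rfl⟩ : ∃ w : ℕ, t = (w : ℤ) - 1 := ⟨(t + 1).toNat, by omega⟩
    by_cases hall : ∀ x ∈ Finset.range w, 0 ≤ koszulEuler u T N x
    · rw [koszulEuler_eq_sum hu0]
      exact Finset.sum_nonneg hall
    -- By induction, a negative value at x < w excludes positive values in N variables from w to s.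
    -- So the values in N + 1 variables do not increase from w - 1 to s, and the one at w - 1 is at
    -- least the positive one at s.
    · push Not at hall
      obtain ⟨x, hx, hneg⟩ := hall
      rw [Finset.mem_range] at hx
      obtain ⟨r, hr⟩ : ∃ r : ℕ, s = (w : ℤ) - 1 + r := ⟨(s - (w - 1)).toNat, by omega⟩
      have h := koszulEuler_sub_eq_sum u T N ((w : ℤ) - 1) r
      rw [← hr] at h
      have hle : ∑ y ∈ Finset.range r, koszulEuler u T N ((w : ℤ) - 1 + y + 1) ≤ 0 := by
        refine Finset.sum_nonpos fun y hy => ?_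
        rw [Finset.mem_range] at hy
        by_contra hy'
        have := ih ((w : ℤ) - 1 + y + 1) x (fun i hi j hj hij => by
          have := hs i hi j hj hij; omega) (by omega) (not_le.mp hy')
        omega
      omega

/-- Without variables the series is the polynomial ∏ (1 - z^{u_i}). Single exponents are too small
and sums of three too large to reach t, so only subsets of even size, with sign +1, contribute. -/
lemma koszulEuler_zero_nonneg {T : Finset ι} {s t : ℤ} (hu : ∀ i ∈ T, 0 ≤ u i)
    (h1 : ∀ i ∈ T, u i ≤ s) (hst : s < t)
    (h3 : ∀ i ∈ T, ∀ j ∈ T, ∀ l ∈ T, i ≠ j → i ≠ l → j ≠ l → t < u i + u j + u l) :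
    0 ≤ koszulEuler u T 0 t := by
  unfold koszulEuler
  refine Finset.sum_nonneg fun B hB => ?_
  have hBT := Finset.mem_powerset.mp hB
  rw [numForms_zero_left]
  split_ifs with h0
  · have hlt : B.card < 3 := by
      by_contra h
      obtain ⟨D, hDB, hD⟩ := Finset.exists_subset_card_eq (not_lt.mp h)
      obtain ⟨a, b, c, hab, hac, hbc, rfl⟩ := Finset.card_eq_three.mp hD
      have hle := Finset.sum_le_sum_of_subset_of_nonneg (f := u) hDB
        (fun i hi _ => hu i (hBT hi))
      rw [Finset.sum_insert (by simp [hab, hac]), Finset.sum_pair hbc] at hle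
      have := h3 a (hBT (hDB (by simp))) b (hBT (hDB (by simp))) c (hBT (hDB (by simp))) hab hac hbc
      omega
    have h2 : B.card ≠ 1 := by
      intro h
      obtain ⟨a, rfl⟩ := Finset.card_eq_one.mp h
      rw [Finset.sum_singleton] at h0
      have := h1 a (hBT (by simp))
      omega
    have : B.card = 0 ∨ B.card = 2 := by omega
    rcases this with h | h <;> rw [h] <;> norm_num
  · simp

/-- If the value at s is nonpositive in N + 1 variables, then it is so in N variables: otherwise all
values up to s in N variables would be nonnegative with the last one positive, and their sum
positive. A positive value at x then needs a positive increment between s and x, and by induction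
the increments after that one are nonnegative up to m. -/
lemma koszulEuler_le_of_pos (hu : ∀ i, 1 ≤ u i) {T : Finset ι} {s m : ℤ}
    (hs0 : 0 ≤ s) (hs : ∀ i ∈ T, ∀ j ∈ T, i ≠ j → s < u i + u j)
    (hm : ∀ t, s < t → t ≤ m → 0 ≤ koszulEuler u T 0 t) (N : ℕ) :
    koszulEuler u T (N + 1) s ≤ 0 → ∀ x y, s ≤ x → x ≤ y → y ≤ m →
      0 < koszulEuler u T (N + 1) x → koszulEuler u T (N + 1) x ≤ koszulEuler u T (N + 1) y := by
  have hu0 : ∀ i, 0 ≤ u i := fun i => zero_le_one.trans (hu i)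
  have key : ∀ N, (koszulEuler u T N s ≤ 0 → ∀ x y, s ≤ x → x ≤ y → y ≤ m →
      0 < koszulEuler u T N x → 0 ≤ koszulEuler u T N y) →
      (koszulEuler u T (N + 1) s ≤ 0 → ∀ x y, s ≤ x → x ≤ y → y ≤ m →
      0 < koszulEuler u T (N + 1) x →
        koszulEuler u T (N + 1) x ≤ koszulEuler u T (N + 1) y) := by
    intro N ih hneg x y hsx hxy hym hpos
    have hN : koszulEuler u T N s ≤ 0 := by
      by_contra h
      rw [not_le] at h
      obtain ⟨w, hw⟩ : ∃ w : ℕ, s = w := ⟨s.toNat, by omega⟩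
      have h2 := koszulEuler_eq_sum hu0 T N (w + 1)
      rw [show ((w + 1 : ℕ) : ℤ) - 1 = s by rw [hw]; push_cast; ring] at h2
      have h3 : koszulEuler u T N (w : ℤ) ≤ ∑ t ∈ Finset.range (w + 1), koszulEuler u T N t :=
        Finset.single_le_sum (f := fun t : ℕ => koszulEuler u T N t) (fun t ht => by
          rw [Finset.mem_range] at ht
          exact koszulEuler_nonneg_of_pos hu T N s t hs (by omega) h) (by simp)
      rw [← hw] at h3
      omega
    obtain ⟨r, hr⟩ : ∃ r : ℕ, x = s + r := ⟨(x - s).toNat, by omega⟩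
    have h := koszulEuler_sub_eq_sum u T N s r
    rw [← hr] at h
    obtain ⟨z, hz, hzpos⟩ := Finset.exists_lt_of_sum_lt (s := Finset.range r)
      (f := fun _ => (0 : ℤ)) (g := fun t : ℕ => koszulEuler u T N (s + t + 1)) (by
        rw [Finset.sum_const_zero, ← h]; omega)
    rw [Finset.mem_range] at hz
    obtain ⟨q, hq⟩ : ∃ q : ℕ, y = x + q := ⟨(y - x).toNat, by omega⟩
    have h' := koszulEuler_sub_eq_sum u T N x q
    rw [← hq] at h'
    have : 0 ≤ ∑ t ∈ Finset.range q, koszulEuler u T N (x + t + 1) :=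
      Finset.sum_nonneg fun t ht => by
        rw [Finset.mem_range] at ht
        exact ih hN (s + z + 1) _ (by omega) (by omega) (by omega) hzpos
    omega
  induction N with
  | zero =>
    refine key 0 fun h x y hsx hxy hym hpos => ?_
    rcases eq_or_lt_of_le hsx with rfl | hlt
    · omega
    · exact hm y (by omega) hym
  | succ N ih =>
    exact key (N + 1) fun h x y hsx hxy hym hpos => hpos.le.trans (ih h x y hsx hxy hym hpos)

/-- If the coefficient in degree `s` is not positive, then some sub-tuple has a nonpositive
alternating sum in one more variable over the `w` degrees after `s`. -/
theorem exists_subset_koszulEuler_le (hu : ∀ i, 1 ≤ u i) {s : ℤ} (hs0 : 0 ≤ s) (N : ℕ) :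
    ∀ (T : Finset ι) (w : ℕ), (∀ i ∈ T, ∀ j ∈ T, i ≠ j → s < u i + u j) → (∀ i ∈ T, (w : ℤ) ≤ u i) →
      koszulEuler u T N s ≤ 0 →
      ∃ T' ⊆ T, koszulEuler u T' (N + 1) (s + w) ≤ koszulEuler u T' (N + 1) s := by
  have hu0 : ∀ i, 0 ≤ u i := fun i => zero_le_one.trans (hu i)
  induction N with
  | zero =>
    intro T w _ _ _
    -- In one variable there is exactly one monomial in each degree s ≥ 0.
    refine ⟨∅, by simp, ?_⟩
    rw [koszulEuler_empty, koszulEuler_empty]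
    simp [numForms, hs0, show 0 ≤ s + w by omega]
  | succ N ihN =>
    intro T
    induction T using Finset.strongInduction with
    | H T ihT =>
    intro w hs hw hneg
    -- It suffices to treat a minimal T. Then all proper subsets have nonnegative values up to s,
    -- and no exponent exceeds s, since removing it would not change the value at s.
    by_cases hmin : ∀ X ⊂ T, 0 < koszulEuler u X (N + 1) s
    swap
    · push Not at hmin
      obtain ⟨X, hX, hXneg⟩ := hmin
      obtain ⟨T', hT', h⟩ := ihT X hX w (fun i hi j hj => hs i (hX.1 hi) j (hX.1 hj))
        (fun i hi => hw i (hX.1 hi)) hXneg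
      exact ⟨T', hT'.trans hX.1, h⟩
    have hne : T.Nonempty := by
      rw [Finset.nonempty_iff_ne_empty]
      rintro rfl
      rw [koszulEuler_empty, numForms, if_pos hs0] at hneg
      have : 0 < (N + 1).multichoose s.toNat := by
        rw [Nat.multichoose_eq]; exact Nat.choose_pos (by omega)
      omega
    have hpre : ∀ X ⊂ T, ∀ t ≤ s, 0 ≤ koszulEuler u X (N + 1) t := fun X hX t ht =>
      koszulEuler_nonneg_of_pos hu X (N + 1) s t
        (fun i hi j hj => hs i (hX.1 hi) j (hX.1 hj)) ht (hmin X hX)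
    have hule : ∀ i ∈ T, u i ≤ s := by
      intro i hi
      by_contra h
      have h1 := koszulEuler_insert u (Finset.notMem_erase i T) (N + 1) s
      rw [Finset.insert_erase hi, koszulEuler_of_neg u (fun i _ => hu0 i) (N + 1)
        (show s - u i < 0 by omega)] at h1
      have := hmin _ (Finset.erase_ssubset hi)
      omega
    obtain ⟨a, haT, hamin⟩ := Finset.exists_min_image T u hne
    obtain ⟨v, hv⟩ : ∃ v : ℕ, u a = v := ⟨(u a).toNat, by have := hu0 a; omega⟩
    have hv1 : 1 ≤ v := by have := hu a; omega
    set T1 := T.erase a with hT1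
    have haT1 : a ∉ T1 := Finset.notMem_erase a T
    have hins : insert a T1 = T := Finset.insert_erase haT
    -- The value of T at s in N + 1 variables is the sum of the last v values of T1 in N variables.
    -- If the one at s were positive, then all would be nonnegative and the sum positive.
    have hT1neg : koszulEuler u T1 N s ≤ 0 := by
      by_contra h
      rw [not_le] at h
      have h1 := koszulEuler_insert u haT1 (N + 1) s
      have h2 := koszulEuler_sub_eq_sum u T1 N (s - u a) v
      rw [hv, sub_add_cancel] at h2
      rw [hins, hv, h2] at h1
      have h3 : koszulEuler u T1 N (s - v + (v - 1 : ℕ) + 1) ≤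
          ∑ t ∈ Finset.range v, koszulEuler u T1 N (s - v + t + 1) :=
        Finset.single_le_sum (f := fun t : ℕ => koszulEuler u T1 N (s - v + t + 1)) (fun t ht => by
          rw [Finset.mem_range] at ht
          exact koszulEuler_nonneg_of_pos hu T1 N s _
            (fun i hi j hj => hs i (Finset.mem_of_mem_erase hi) j (Finset.mem_of_mem_erase hj))
            (by omega) h) (by simp; omega)
      rw [show s - (v : ℤ) + (v - 1 : ℕ) + 1 = s by omega] at h3
      omega
    obtain ⟨T', hT'1, hT'⟩ := ihN T1 v
      (fun i hi j hj => hs i (Finset.mem_of_mem_erase hi) j (Finset.mem_of_mem_erase hj))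
      (fun i hi => by rw [← hv]; exact hamin i (Finset.mem_of_mem_erase hi)) hT1neg
    -- The induction hypothesis, applied with w = u a, says that inserting a into T' gives a
    -- nonpositive value at s + u a. Each further index i subtracts a value at s + u a - u i ≤ s,
    -- which is nonnegative because u a is the smallest exponent.
    have hgrow : ∀ Y : Finset ι, T' ∪ Y ⊆ T1 →
        koszulEuler u (insert a (T' ∪ Y)) (N + 1) (s + v) ≤ 0 := by
      intro Y
      induction Y using Finset.induction_on with
      | empty =>
        intro hsub
        rw [Finset.union_empty] at hsub ⊢
        rw [koszulEuler_insert u (fun h => haT1 (hsub h)), hv, add_sub_cancel_right]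
        omega
      | insert i Y hi ih =>
        intro hsub
        rw [Finset.union_insert] at hsub ⊢
        have hsub' : T' ∪ Y ⊆ T1 := (Finset.subset_insert _ _).trans hsub
        have h1 := ih hsub'
        by_cases hmem : i ∈ T' ∪ Y
        · rwa [Finset.insert_eq_of_mem hmem]
        have hiT1 : i ∈ T1 := hsub (Finset.mem_insert_self _ _)
        have hia : i ≠ a := fun h => haT1 (h ▸ hiT1)
        have hi' : i ∉ insert a (T' ∪ Y) := by
          simp only [Finset.mem_insert, not_or]; exact ⟨hia, hmem⟩
        rw [Finset.insert_comm, koszulEuler_insert u hi']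
        have hss : insert a (T' ∪ Y) ⊂ T := by
          refine ⟨?_, fun h => hi' (h (Finset.mem_of_mem_erase hiT1))⟩
          rw [← hins]
          exact Finset.insert_subset_insert _ hsub'
        have h2 := hpre _ hss (s + v - u i) (by
          have := hamin i (Finset.mem_of_mem_erase hiT1); omega)
        omega
    have hend : koszulEuler u T (N + 1) (s + v) ≤ 0 := by
      have := hgrow T1 (by rw [Finset.union_eq_right.mpr hT'1])
      rwa [Finset.union_eq_right.mpr hT'1, hins] at this
    -- A positive value in between could not come down again before s + v. As w ≤ v, these values
    -- contain all increments from s to s + w in one more variable.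
    have hbetween : ∀ t, s ≤ t → t ≤ s + v → koszulEuler u T (N + 1) t ≤ 0 := by
      intro t hst htv
      by_contra h
      have := koszulEuler_le_of_pos (m := s + v) hu hs0 hs (fun t h1 h2 =>
        koszulEuler_zero_nonneg (fun i _ => hu0 i) hule h1
          (fun i hi j hj l hl hij _ _ => by
            have := hs i hi j hj hij
            have := hamin l hl
            omega)) N hneg t (s + v) hst htv le_rfl (not_le.mp h)
      omega
    refine ⟨T, subset_rfl, ?_⟩
    have h := koszulEuler_sub_eq_sum u T (N + 1) s w
    have : ∑ t ∈ Finset.range w, koszulEuler u T (N + 1) (s + t + 1) ≤ 0 :=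
      Finset.sum_nonpos fun t ht => hbetween _ (by omega) (by
        rw [Finset.mem_range] at ht
        have := hw a haT
        omega)
    omega

end

/-! ### Forms of integer degree and linear forms. -/

section Forms
variable {K : Type*} [Field K] {N : ℕ}

/-- The forms of integer degree `a`; there are none for `a < 0`. -/
noncomputable def forms (K : Type*) [Field K] (N : ℕ) (a : ℤ) : Submodule K (MvPolynomial (Fin N) K) :=
  if 0 ≤ a then homogeneousSubmodule (Fin N) K a.toNat else ⊥

lemma forms_natCast (a : ℕ) : forms K N a = homogeneousSubmodule (Fin N) K a := by
  simp [forms]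

lemma mem_forms_natCast {a : ℕ} {f : MvPolynomial (Fin N) K} :
    f ∈ forms K N a ↔ f.IsHomogeneous a := by
  rw [forms_natCast, mem_homogeneousSubmodule]

lemma forms_of_neg {a : ℤ} (h : a < 0) : forms K N a = ⊥ := by
  simp [forms, not_le.mpr h]

lemma eq_zero_of_mem_forms {a : ℤ} (h : a < 0) {f : MvPolynomial (Fin N) K}
    (hf : f ∈ forms K N a) : f = 0 := by
  simpa [forms_of_neg h] using hf

lemma mul_mem_forms {a b : ℤ} {f g : MvPolynomial (Fin N) K} (hf : f ∈ forms K N a)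
    (hg : g ∈ forms K N b) : f * g ∈ forms K N (a + b) := by
  rcases lt_or_ge a 0 with ha | ha
  · rw [eq_zero_of_mem_forms ha hf, zero_mul]; exact zero_mem _
  rcases lt_or_ge b 0 with hb | hb
  · rw [eq_zero_of_mem_forms hb hg, mul_zero]; exact zero_mem _
  obtain ⟨a, rfl⟩ := Int.eq_ofNat_of_zero_le ha
  obtain ⟨b, rfl⟩ := Int.eq_ofNat_of_zero_le hb
  rw [mem_forms_natCast] at hf hg
  rw [← Nat.cast_add, mem_forms_natCast]
  exact hf.mul hg

lemma pow_mem_forms {f : MvPolynomial (Fin N) K} (hf : f ∈ forms K N 1) (b : ℕ) :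
    f ^ b ∈ forms K N b := by
  rw [← Nat.cast_one, mem_forms_natCast] at hf
  rw [mem_forms_natCast]
  simpa using hf.pow b

lemma mem_finsuppAntidiag_univ {m : ℕ} {α : Fin N →₀ ℕ} :
    α ∈ (Finset.univ.finsuppAntidiag m : Finset (Fin N →₀ ℕ)) ↔ α.degree = m := by
  simp [Finset.mem_finsuppAntidiag, Finsupp.degree_eq_sum]

/-- The exponents of the monomials of degree `m`. -/
abbrev MonExp (N m : ℕ) := {α : Fin N →₀ ℕ // α ∈ Finset.univ.finsuppAntidiag m}

lemma sum_coeff_monomial {m : ℕ} {f : MvPolynomial (Fin N) K} (hf : f.IsHomogeneous m) :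
    f = ∑ α : MonExp N m, coeff α.1 f • monomial α.1 1 := by
  classical
  ext β
  simp only [coeff_sum, coeff_smul, coeff_monomial, smul_eq_mul, mul_ite, mul_one, mul_zero]
  by_cases hβ : β.degree = m
  · rw [Finset.sum_eq_single ⟨β, mem_finsuppAntidiag_univ.2 hβ⟩]
    · simp
    · rintro α _ hα
      rw [if_neg fun h => hα (Subtype.ext h)]
    · simp
  · rw [hf.coeff_eq_zero hβ, Finset.sum_eq_zero]
    rintro α _
    rw [if_neg]
    rintro rfl
    exact hβ (mem_finsuppAntidiag_univ.1 α.2)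

/-- The basis of monomials of the space of forms of degree `m`. -/
noncomputable def formsBasis (K : Type*) [Field K] (N m : ℕ) :
    Module.Basis (MonExp N m) K (homogeneousSubmodule (Fin N) K m) :=
  Module.Basis.mk (v := fun α => ⟨monomial α.1 1,
      isHomogeneous_monomial _ (mem_finsuppAntidiag_univ.1 α.2)⟩)
    (by
      refine LinearIndependent.of_comp (homogeneousSubmodule (Fin N) K m).subtype ?_
      have h := (basisMonomials (Fin N) K).linearIndependent.comp
        (Subtype.val : MonExp N m → _) Subtype.val_injective
      simpa [Function.comp_def] using h)
    (by
      rintro ⟨f, hf⟩ -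
      have h := sum_coeff_monomial hf
      have h' : (⟨f, hf⟩ : homogeneousSubmodule (Fin N) K m) = ∑ α : MonExp N m, coeff α.1 f •
          ⟨monomial α.1 1, isHomogeneous_monomial _ (mem_finsuppAntidiag_univ.1 α.2)⟩ := by
        apply Subtype.ext
        rw [AddSubmonoidClass.coe_finsetSum]
        exact h
      rw [h']
      exact Submodule.sum_mem _ fun α _ => Submodule.smul_mem _ _ (Submodule.subset_span ⟨α, rfl⟩))

lemma formsBasis_apply (m : ℕ) (α : MonExp N m) :
    (formsBasis K N m α : MvPolynomial (Fin N) K) = monomial α.1 1 := by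
  simp [formsBasis]

instance (m : ℕ) : Module.Finite K (homogeneousSubmodule (Fin N) K m) :=
  Module.Finite.of_basis (formsBasis K N m)

instance (a : ℤ) : Module.Finite K (forms K N a) := by
  rcases lt_or_ge a 0 with ha | ha
  · rw [forms_of_neg ha]; infer_instance
  · obtain ⟨a, rfl⟩ := Int.eq_ofNat_of_zero_le ha
    rw [forms_natCast]; infer_instance

lemma finrank_homogeneousSubmodule (m : ℕ) :
    Module.finrank K (homogeneousSubmodule (Fin N) K m) = N.multichoose m := by
  rw [Module.finrank_eq_card_basis (formsBasis K N m), Fintype.card_coe,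
    Finset.card_finsuppAntidiag_nat_eq_multichoose]
  simp

lemma finrank_forms (a : ℤ) : (Module.finrank K (forms K N a) : ℤ) = numForms N a := by
  rcases lt_or_ge a 0 with ha | ha
  · rw [numForms_of_neg _ ha, forms_of_neg ha]; simp
  · obtain ⟨a, rfl⟩ := Int.eq_ofNat_of_zero_le ha
    rw [forms_natCast, finrank_homogeneousSubmodule]
    simp [numForms]

lemma homogeneousComponent_mul_of_isHomogeneous {p q : MvPolynomial (Fin N) K} {b : ℕ}
    (hp : p.IsHomogeneous b) (i : ℕ) :
    homogeneousComponent (b + i) (p * q) = p * homogeneousComponent i q := by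
  conv_lhs => rw [← sum_homogeneousComponent q, Finset.mul_sum, map_sum]
  rw [Finset.sum_congr rfl fun j _ => homogeneousComponent_of_mem (m := b + i) (n := b + j)
    (hp.mul (homogeneousComponent_isHomogeneous j q))]
  simp only [add_right_inj, Finset.sum_ite_eq, Finset.mem_range]
  split_ifs with h
  · rfl
  · rw [homogeneousComponent_eq_zero _ _ (by omega), mul_zero]

/-- The cofactor may be replaced by its component of degree a - b. If a - b is negative, then f
vanishes and the cofactor 0 serves. -/
lemma exists_forms_of_dvd {p f : MvPolynomial (Fin N) K} {b : ℕ} {a : ℤ} (hp : p.IsHomogeneous b)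
    (hf : f ∈ forms K N a) (h : p ∣ f) : ∃ q ∈ forms K N (a - b), f = p * q := by
  obtain ⟨q, rfl⟩ := h
  rcases lt_or_ge a 0 with ha | ha
  · exact ⟨0, zero_mem _, by rw [mul_zero]; exact eq_zero_of_mem_forms ha hf⟩
  obtain ⟨a, rfl⟩ := Int.eq_ofNat_of_zero_le ha
  rw [mem_forms_natCast] at hf
  rcases lt_or_ge a b with hab | hab
  · refine ⟨0, zero_mem _, ?_⟩
    rw [mul_zero]
    by_contra h0
    have hp0 : p ≠ 0 := left_ne_zero_of_mul h0
    have hq0 : q ≠ 0 := right_ne_zero_of_mul h0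
    have h1 := hf.totalDegree h0
    rw [totalDegree_mul_of_isDomain hp0 hq0, hp.totalDegree hp0] at h1
    omega
  · obtain ⟨c, rfl⟩ := Nat.exists_eq_add_of_le hab
    refine ⟨homogeneousComponent c q, ?_, ?_⟩
    · rw [show ((b + c : ℕ) : ℤ) - b = (c : ℕ) by push_cast; ring, mem_forms_natCast]
      exact homogeneousComponent_isHomogeneous c q
    · rw [← homogeneousComponent_mul_of_isHomogeneous hp]
      exact (homogeneousComponent_eq_self hf).symm

/-- The linear form with coefficients `v`. -/
noncomputable def linForm {A : Type*} [CommRing A] {N : ℕ} (v : Fin N → A) : MvPolynomial (Fin N) A :=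
  ∑ i, C (v i) * X i

lemma linForm_isHomogeneous (v : Fin N → K) : (linForm v).IsHomogeneous 1 :=
  IsHomogeneous.sum _ _ _ fun _ _ => isHomogeneous_C_mul_X _ _

lemma linForm_mem_forms (v : Fin N → K) : linForm v ∈ forms K N 1 := by
  rw [← Nat.cast_one, mem_forms_natCast]; exact linForm_isHomogeneous v

lemma linForm_pow_mem_forms (v : Fin N → K) (b : ℕ) : linForm v ^ b ∈ forms K N b :=
  pow_mem_forms (linForm_mem_forms v) b

lemma eval_linForm (v w : Fin N → K) : eval w (linForm v) = ∑ i, v i * w i := by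
  simp [linForm]

lemma linForm_add (v w : Fin N → K) : linForm (v + w) = linForm v + linForm w := by
  simp [linForm, add_mul, Finset.sum_add_distrib]

lemma linForm_smul (c : K) (v : Fin N → K) : linForm (c • v) = C c * linForm v := by
  simp [linForm, Finset.mul_sum, mul_assoc]

lemma coeff_linForm (v : Fin N → K) (i : Fin N) :
    coeff (Finsupp.single i 1) (linForm v) = v i := by
  classical
  simp [linForm, coeff_sum, coeff_C_mul, coeff_X, Finsupp.single_left_inj one_ne_zero]

lemma linForm_injective : Function.Injective (linForm : (Fin N → K) → MvPolynomial (Fin N) K) :=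
  fun v w h => funext fun i => by rw [← coeff_linForm v, ← coeff_linForm w, h]

lemma linForm_ne_zero {v : Fin N → K} (hv : v ≠ 0) : linForm v ≠ 0 := fun h =>
  hv (linForm_injective (by rw [h]; simp [linForm]))

lemma exists_linForm_eq {f : MvPolynomial (Fin N) K} (hf : f.IsHomogeneous 1) :
    ∃ v, f = linForm v := by
  have h : f ∈ homogeneousSubmodule (Fin N) K 1 := hf
  rw [homogeneousSubmodule_one_eq_span_X, Submodule.mem_span_range_iff_exists_fun] at h
  obtain ⟨c, rfl⟩ := h
  exact ⟨c, by simp [linForm, smul_eq_C_mul]⟩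

lemma linForm_prime {v : Fin N → K} (hv : v ≠ 0) : Prime (linForm v) := by
  refine Irreducible.prime (irreducible_of_totalDegree_eq_one ?_ ?_)
  · exact (linForm_isHomogeneous v).totalDegree (linForm_ne_zero hv)
  · intro x hx
    obtain ⟨i, hi⟩ := Function.ne_iff.mp hv
    have h := hx (Finsupp.single i 1)
    rw [coeff_linForm] at h
    exact (isUnit_iff_ne_zero.2 fun h0 => hi (by simpa [h0] using h))

end Forms

/-! ### Ideals of cones with vertex the first coordinate point. -/

section Cones
variable {K : Type*} [Field K] {n : ℕ}

/-- The projection of `K^(n+1)` that forgets the first coordinate. -/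
def tailMap (K : Type*) [Field K] (n : ℕ) : (Fin (n + 1) → K) →ₗ[K] (Fin n → K) :=
  LinearMap.funLeft K K Fin.succ

lemma tailMap_apply (v : Fin (n + 1) → K) (i : Fin n) : tailMap K n v i = v i.succ := rfl

/-- The first coordinate point. -/
def coordPoint (K : Type*) [Field K] (n : ℕ) : Fin (n + 1) → K := Pi.single 0 1

lemma tailMap_coordPoint : tailMap K n (coordPoint K n) = 0 := by
  ext i; simp [tailMap_apply, coordPoint]

lemma tailMap_cons (a : K) (w : Fin n → K) :
    tailMap K n (Fin.cons a w : Fin (n + 1) → K) = w := by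
  ext i; simp [tailMap_apply]

lemma comap_tailMap_bot :
    (⊥ : Submodule K (Fin n → K)).comap (tailMap K n) = Submodule.span K {coordPoint K n} := by
  ext v
  rw [Submodule.mem_comap, Submodule.mem_bot, Submodule.mem_span_singleton]
  constructor
  · intro h
    refine ⟨v 0, funext fun i => ?_⟩
    refine Fin.cases ?_ (fun i => ?_) i
    · simp [coordPoint]
    · have := congrFun h i
      rw [tailMap_apply] at this
      simp [coordPoint, this]
  · rintro ⟨c, rfl⟩
    rw [map_smul, tailMap_coordPoint, smul_zero]

lemma linearIdeal_eq_span_linForm {N : ℕ} (W : Submodule K (Fin N → K)) :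
    linearIdeal W = Ideal.span {F | ∃ c : Fin N → K, (∀ v ∈ W, ∑ i, c i * v i = 0) ∧ F = linForm c} := by
  unfold linearIdeal
  congr 1
  ext F
  constructor
  · rintro ⟨h1, h2⟩
    obtain ⟨c, rfl⟩ := exists_linForm_eq h1
    exact ⟨c, fun v hv => by rw [← eval_linForm]; exact h2 v hv, rfl⟩
  · rintro ⟨c, hc, rfl⟩
    exact ⟨linForm_isHomogeneous c, fun v hv => by rw [eval_linForm]; exact hc v hv⟩

lemma finSuccEquiv_linForm (c : Fin (n + 1) → K) :
    finSuccEquiv K n (linForm c) =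
      Polynomial.C (C (c 0)) * Polynomial.X + Polynomial.C (linForm (tailMap K n c)) := by
  have hC : ∀ a : K, finSuccEquiv K n (C a) = Polynomial.C (C a) := fun a => by
    simp [finSuccEquiv_apply]
  simp only [linForm, Fin.sum_univ_succ, map_add, map_sum, map_mul, finSuccEquiv_X_zero,
    finSuccEquiv_X_succ, hC, tailMap_apply]

/-- A linear form that vanishes on a cone vanishes at its vertex, so it does not involve the first
variable. -/
lemma map_finSuccEquiv_linearIdeal (W : Submodule K (Fin n → K)) :
    (linearIdeal (W.comap (tailMap K n))).map (finSuccEquiv K n) =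
      (linearIdeal W).map (Polynomial.C : _ →+* Polynomial (MvPolynomial (Fin n) K)) := by
  rw [linearIdeal_eq_span_linForm, linearIdeal_eq_span_linForm, Ideal.map_span, Ideal.map_span]
  congr 1
  ext G
  constructor
  · rintro ⟨_, ⟨c, hc, rfl⟩, rfl⟩
    have hc0 : c 0 = 0 := by
      have := hc (coordPoint K n) (by
        rw [Submodule.mem_comap, tailMap_coordPoint]; exact zero_mem _)
      simpa [coordPoint, Pi.single_apply] using this
    refine ⟨_, ⟨tailMap K n c, fun w hw => ?_, rfl⟩, ?_⟩
    · have := hc (Fin.cons 0 w) (by rw [Submodule.mem_comap, tailMap_cons]; exact hw)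
      simpa [Fin.sum_univ_succ, tailMap_apply] using this
    · have := finSuccEquiv_linForm c
      rw [hc0] at this
      simpa using this.symm
  · rintro ⟨_, ⟨c, hc, rfl⟩, rfl⟩
    refine ⟨_, ⟨Fin.cons 0 c, fun w hw => ?_, rfl⟩, ?_⟩
    · have := hc _ hw
      simpa [Fin.sum_univ_succ, tailMap_apply] using this
    · have := finSuccEquiv_linForm (Fin.cons 0 c : Fin (n + 1) → K)
      rw [tailMap_cons] at this
      simpa using this

/-- The ideal of a thickened cone is extended from the ideal of its base. -/
lemma mem_linearIdeal_comap_tailMap_pow {W : Submodule K (Fin n → K)} {a : ℕ}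
    {F : MvPolynomial (Fin (n + 1)) K} :
    F ∈ linearIdeal (W.comap (tailMap K n)) ^ a ↔
      ∀ b, (finSuccEquiv K n F).coeff b ∈ linearIdeal W ^ a := by
  rw [← Ideal.mem_map_C_iff, Ideal.map_pow, ← map_finSuccEquiv_linearIdeal, ← Ideal.map_pow]
  constructor
  · exact Ideal.mem_map_of_mem _
  · intro h
    rw [Ideal.mem_map_of_equiv] at h
    obtain ⟨G, hG, h⟩ := h
    rwa [← (finSuccEquiv K n).injective h]

lemma linearIdeal_bot {N : ℕ} : linearIdeal (⊥ : Submodule K (Fin N → K)) = idealOfVars (Fin N) K := by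
  rw [linearIdeal_eq_span_linForm, idealOfVars]
  apply le_antisymm
  · rw [Ideal.span_le]
    rintro _ ⟨c, -, rfl⟩
    exact Ideal.sum_mem _ fun i _ => Ideal.mul_mem_left _ _ (Ideal.subset_span ⟨i, rfl⟩)
  · rw [Ideal.span_le]
    rintro _ ⟨i, rfl⟩
    refine Ideal.subset_span ⟨Pi.single i 1, by simp, ?_⟩
    classical
    simp [linForm, Pi.single_apply, apply_ite C, ite_mul]

lemma mem_idealOfVars_pow_iff_of_isHomogeneous {N e k : ℕ} {G : MvPolynomial (Fin N) K}
    (hG : G.IsHomogeneous e) : G ∈ idealOfVars (Fin N) K ^ k ↔ (e < k → G = 0) := by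
  rw [mem_pow_idealOfVars_iff']
  constructor
  · intro h hek
    ext β
    by_cases hβ : β.degree = e
    · rw [h β (by omega), coeff_zero]
    · rw [hG.coeff_eq_zero hβ, coeff_zero]
  · intro h β hβ
    by_cases hβe : β.degree = e
    · rw [h (by omega), coeff_zero]
    · exact hG.coeff_eq_zero hβe

lemma coeff_finSuccEquiv_eq_zero {m b : ℕ} {F : MvPolynomial (Fin (n + 1)) K}
    (hF : F.IsHomogeneous m) (hb : m < b) : (finSuccEquiv K n F).coeff b = 0 := by
  ext β
  rw [finSuccEquiv_coeff_coeff, coeff_zero]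
  refine hF.coeff_eq_zero ?_
  rw [Finsupp.degree_eq_sum, Fin.sum_univ_succ, Finsupp.cons_zero]
  omega

/-- Membership in the ideal of a multiple coordinate point, for forms. -/
lemma mem_linearIdeal_coordPoint_pow {m k : ℕ} {F : MvPolynomial (Fin (n + 1)) K}
    (hF : F.IsHomogeneous m) :
    F ∈ linearIdeal (Submodule.span K {coordPoint K n}) ^ k ↔
      ∀ b, m < b + k → (finSuccEquiv K n F).coeff b = 0 := by
  rw [← comap_tailMap_bot, mem_linearIdeal_comap_tailMap_pow, linearIdeal_bot]
  refine forall_congr' fun b => ?_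
  rcases lt_or_ge m b with hb | hb
  · simp [coeff_finSuccEquiv_eq_zero hF hb]
  · rw [mem_idealOfVars_pow_iff_of_isHomogeneous
      (hF.finSuccEquiv_coeff_isHomogeneous b (m - b) (by omega))]
    exact imp_congr_left (by omega)

end Cones

/-! ### Invariance of all constructions under linear changes of coordinates. -/

section Coordinates
variable {K : Type*} [Field K] {N : ℕ}

/-- A linear change of coordinates of the projective space. -/
structure CoordChange (K : Type*) [Field K] (N : ℕ) where
  σ : MvPolynomial (Fin N) K ≃ₐ[K] MvPolynomial (Fin N) K
  g : (Fin N → K) ≃ₗ[K] (Fin N → K)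
  eval_σ : ∀ w F, eval w (σ F) = eval (g w) F
  isHomogeneous_iff : ∀ F m, (σ F).IsHomogeneous m ↔ F.IsHomogeneous m

namespace CoordChange
variable (c : CoordChange K N)

lemma map_linearIdeal (W : Submodule K (Fin N → K)) :
    (linearIdeal W).map c.σ = linearIdeal (W.map c.g.symm.toLinearMap) := by
  unfold linearIdeal
  rw [Ideal.map_span]
  congr 1
  ext F
  constructor
  · rintro ⟨G, ⟨h1, h2⟩, rfl⟩
    refine ⟨(c.isHomogeneous_iff G 1).2 h1, ?_⟩
    rintro _ ⟨v, hv, rfl⟩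
    have := h2 v hv
    simpa [c.eval_σ] using this
  · rintro ⟨h1, h2⟩
    refine ⟨c.σ.symm F, ⟨(c.isHomogeneous_iff _ 1).1 (by simpa using h1), fun v hv => ?_⟩, by simp⟩
    have := h2 (c.g.symm v) ⟨v, hv, rfl⟩
    have h3 := c.eval_σ (c.g.symm v) (c.σ.symm F)
    simp only [AlgEquiv.apply_symm_apply, LinearEquiv.apply_symm_apply] at h3
    rw [← h3, this]

lemma map_fatLinearIdeal (W : Submodule K (Fin N → K)) (a : ℤ) :
    (fatLinearIdeal W a).map c.σ = fatLinearIdeal (W.map c.g.symm.toLinearMap) a := by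
  unfold fatLinearIdeal
  rw [Ideal.map_pow, map_linearIdeal]

lemma map_inf (I J : Ideal (MvPolynomial (Fin N) K)) :
    (I ⊓ J).map c.σ = I.map c.σ ⊓ J.map c.σ :=
  OrderIso.map_inf (c.σ.toRingEquiv.idealComapOrderIso.symm) I J

lemma map_iInf {ι : Sort*} (I : ι → Ideal (MvPolynomial (Fin N) K)) :
    (⨅ i, I i).map c.σ = ⨅ i, (I i).map c.σ :=
  OrderIso.map_iInf (c.σ.toRingEquiv.idealComapOrderIso.symm) I

lemma mem_map_iff {I : Ideal (MvPolynomial (Fin N) K)} {F : MvPolynomial (Fin N) K} :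
    c.σ F ∈ I.map c.σ ↔ F ∈ I := by
  rw [Ideal.mem_map_of_equiv]
  constructor
  · rintro ⟨G, hG, h⟩
    rwa [← c.σ.injective h]
  · intro h
    exact ⟨F, h, rfl⟩

lemma mem_gradedPiece_map_iff {I : Ideal (MvPolynomial (Fin N) K)} {m : ℕ}
    {F : MvPolynomial (Fin N) K} : c.σ F ∈ gradedPiece (I.map c.σ) m ↔ F ∈ gradedPiece I m := by
  unfold gradedPiece
  simp only [Submodule.mem_inf, Submodule.restrictScalars_mem, mem_homogeneousSubmodule,
    c.mem_map_iff, c.isHomogeneous_iff]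

lemma gradedPiece_map (I : Ideal (MvPolynomial (Fin N) K)) (m : ℕ) :
    gradedPiece (I.map c.σ) m = (gradedPiece I m).map c.σ.toLinearMap := by
  ext F
  obtain ⟨F, rfl⟩ := c.σ.surjective F
  rw [c.mem_gradedPiece_map_iff]
  constructor
  · intro h; exact ⟨F, h, rfl⟩
  · rintro ⟨G, hG, h⟩
    rwa [← c.σ.injective h]

lemma finrank_gradedPiece_map (I : Ideal (MvPolynomial (Fin N) K)) (m : ℕ) :
    Module.finrank K (gradedPiece (I.map c.σ) m) = Module.finrank K (gradedPiece I m) := by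
  rw [gradedPiece_map]
  exact (LinearEquiv.finrank_eq (Submodule.equivMapOfInjective c.σ.toLinearMap c.σ.injective _)).symm

lemma baseLocusIdeal_map (I : Ideal (MvPolynomial (Fin N) K)) (m : ℕ) :
    baseLocusIdeal (I.map c.σ) m = (baseLocusIdeal I m).map c.σ := by
  unfold baseLocusIdeal
  rw [Ideal.map_span, gradedPiece_map]
  rfl

lemma sameSubscheme_map (I J : Ideal (MvPolynomial (Fin N) K)) :
    SameSubscheme (I.map c.σ) (J.map c.σ) ↔ SameSubscheme I J := by
  unfold SameSubscheme
  simp only [gradedPiece_map, (Submodule.map_injective_of_injective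
    (f := c.σ.toLinearMap) c.σ.injective).eq_iff]

end CoordChange
end Coordinates

/-! ### A change of coordinates that is polynomial in the point it moves. -/

section Shear
variable {n : ℕ}

/-- The substitution that moves the first coordinate point to the point `v`. -/
noncomputable def shear {A : Type*} [CommRing A] (v : Fin (n + 1) → A) :
    MvPolynomial (Fin (n + 1)) A →ₐ[A] MvPolynomial (Fin (n + 1)) A :=
  aeval (Fin.cons (C (v 0) * X 0) fun a => X a.succ + C (v a.succ) * X 0 :
    Fin (n + 1) → MvPolynomial (Fin (n + 1)) A)

section
variable {A : Type*} [CommRing A]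

lemma shear_X_zero (v : Fin (n + 1) → A) : shear v (X 0) = C (v 0) * X 0 := by
  simp [shear]

lemma shear_X_succ (v : Fin (n + 1) → A) (a : Fin n) :
    shear v (X a.succ) = X a.succ + C (v a.succ) * X 0 := by
  simp [shear]

lemma shear_C (v : Fin (n + 1) → A) (a : A) : shear v (C a) = C a := by
  simp [shear]

lemma map_shear {B : Type*} [CommRing B] (f : A →+* B) (v : Fin (n + 1) → A)
    (F : MvPolynomial (Fin (n + 1)) A) :
    map f (shear v F) = shear (fun i => f (v i)) (map f F) := by
  induction F using MvPolynomial.induction_on with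
  | C a => simp
  | add p q hp hq => simp [hp, hq]
  | mul_X p i hp =>
    rw [map_mul, map_mul, hp, map_mul, map_mul, map_X]
    congr 1
    refine Fin.cases ?_ (fun i => ?_) i
    · simp [shear_X_zero]
    · simp [shear_X_succ]

lemma shear_isHomogeneous (v : Fin (n + 1) → A) {F : MvPolynomial (Fin (n + 1)) A} {m : ℕ}
    (hF : F.IsHomogeneous m) : (shear v F).IsHomogeneous m := by
  have h := hF.aeval (n := 1) (Fin.cons (C (v 0) * X 0) fun a => X a.succ + C (v a.succ) * X 0 :
    Fin (n + 1) → MvPolynomial (Fin (n + 1)) A) (fun i => by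
      refine Fin.cases ?_ (fun i => ?_) i
      · simpa using isHomogeneous_C_mul_X _ _
      · simpa using (isHomogeneous_X _ _).add (isHomogeneous_C_mul_X _ _))
  simpa [shear] using h

lemma shear_shear (v w : Fin (n + 1) → A) (h0 : v 0 * w 0 = 1)
    (h : ∀ a : Fin n, v a.succ + w a.succ * v 0 = 0) (F : MvPolynomial (Fin (n + 1)) A) :
    shear v (shear w F) = F := by
  have : (shear v).comp (shear w) = AlgHom.id A _ := by
    ext1 i
    rw [AlgHom.comp_apply, AlgHom.id_apply]
    refine Fin.cases ?_ (fun a => ?_) i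
    · rw [shear_X_zero, map_mul, shear_C, shear_X_zero, ← mul_assoc, ← C_mul, mul_comm (w 0), h0,
        C_1, one_mul]
    · rw [shear_X_succ, map_add, map_mul, shear_C, shear_X_zero, shear_X_succ, ← mul_assoc,
        add_assoc, ← C_mul, ← add_mul, ← C_add, h, C_0, zero_mul, add_zero]
  exact DFunLike.congr_fun this F

end

variable {K : Type*} [Field K]

/-- The inverse of the linear map behind `shear v`. -/
noncomputable def shearInv (v : Fin (n + 1) → K) : Fin (n + 1) → K :=
  Fin.cons (v 0)⁻¹ fun a => -(v a.succ * (v 0)⁻¹)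

/-- The linear map that moves the first coordinate point to `v`. -/
def shearFun (v : Fin (n + 1) → K) : (Fin (n + 1) → K) →ₗ[K] (Fin (n + 1) → K) where
  toFun w := Fin.cons (v 0 * w 0) fun a => w a.succ + v a.succ * w 0
  map_add' x y := by
    ext i
    refine Fin.cases ?_ (fun i => ?_) i
    · simp [mul_add]
    · simp; ring
  map_smul' c x := by
    ext i
    refine Fin.cases ?_ (fun i => ?_) i
    · simp; ring
    · simp; ring

lemma shearFun_zero (v w : Fin (n + 1) → K) : shearFun v w 0 = v 0 * w 0 := rfl

lemma shearFun_succ (v w : Fin (n + 1) → K) (a : Fin n) :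
    shearFun v w a.succ = w a.succ + v a.succ * w 0 := rfl

lemma shearFun_coordPoint (v : Fin (n + 1) → K) : shearFun v (coordPoint K n) = v := by
  ext i
  refine Fin.cases ?_ (fun i => ?_) i
  · simp [shearFun_zero, coordPoint]
  · simp [shearFun_succ, coordPoint]

lemma shearFun_shearFun {v w : Fin (n + 1) → K} (h0 : v 0 * w 0 = 1)
    (h : ∀ a : Fin n, v a.succ + w a.succ * v 0 = 0) (x : Fin (n + 1) → K) :
    shearFun w (shearFun v x) = x := by
  ext i
  refine Fin.cases ?_ (fun a => ?_) i
  · rw [shearFun_zero, shearFun_zero]; linear_combination x 0 * h0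
  · rw [shearFun_succ, shearFun_succ, shearFun_zero]; linear_combination x 0 * h a

lemma eval_shear (v w : Fin (n + 1) → K) (F : MvPolynomial (Fin (n + 1)) K) :
    eval w (shear v F) = eval (shearFun v w) F := by
  induction F using MvPolynomial.induction_on with
  | C a => simp
  | add p q hp hq => simp [hp, hq]
  | mul_X p i hp =>
    rw [map_mul, map_mul, hp, map_mul, eval_X]
    congr 1
    refine Fin.cases ?_ (fun i => ?_) i
    · simp [shear_X_zero, shearFun_zero]
    · simp [shear_X_succ, shearFun_succ]

/-- The change of coordinates that moves the first coordinate point to `v`. -/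
noncomputable def shearChange (v : Fin (n + 1) → K) (hv : v 0 ≠ 0) : CoordChange K (n + 1) where
  σ := AlgEquiv.ofAlgHom (shear v) (shear (shearInv v))
    (AlgHom.ext fun F => shear_shear v (shearInv v) (by simp [shearInv, hv])
      (fun a => by simp [shearInv, hv]) F)
    (AlgHom.ext fun F => shear_shear (shearInv v) v (by simp [shearInv, hv])
      (fun a => by simp [shearInv]) F)
  g := LinearEquiv.ofLinearMap (shearFun v) (shearFun (shearInv v))
    (LinearMap.ext fun x => shearFun_shearFun (v := shearInv v) (w := v) (by simp [shearInv, hv])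
      (fun a => by simp [shearInv]) x)
    (LinearMap.ext fun x => shearFun_shearFun (by simp [shearInv, hv])
      (fun a => by simp [shearInv, hv]) x)
  eval_σ w F := eval_shear v w F
  isHomogeneous_iff F m := by
    constructor
    · intro h
      have := shear_isHomogeneous (shearInv v) h
      have h2 := shear_shear (shearInv v) v (by simp [shearInv, hv])
        (fun a => by simp [shearInv]) F
      change (shear (shearInv v) (shear v F)).IsHomogeneous m at this
      rwa [h2] at this
    · exact fun h => shear_isHomogeneous v h

lemma shearChange_σ (v : Fin (n + 1) → K) (hv : v 0 ≠ 0) (F : MvPolynomial (Fin (n + 1)) K) :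
    (shearChange v hv).σ F = shear v F := rfl

lemma shearChange_g_symm (v : Fin (n + 1) → K) (hv : v 0 ≠ 0) (w : Fin (n + 1) → K) :
    (shearChange v hv).g.symm w = shearFun (shearInv v) w := rfl

lemma shearChange_map_span_self (v : Fin (n + 1) → K) (hv : v 0 ≠ 0) :
    (Submodule.span K {v}).map (shearChange v hv).g.symm.toLinearMap =
      Submodule.span K {coordPoint K n} := by
  rw [Submodule.map_span, Set.image_singleton]
  congr 2
  have : (shearChange v hv).g (coordPoint K n) = v := shearFun_coordPoint v
  change (shearChange v hv).g.symm v = _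
  rw [LinearEquiv.symm_apply_eq, this]

end Shear

/-! ### The apolarity pairing. -/

section Apolarity
variable {K : Type*} [Field K] {N : ℕ}

/-- The derivative in the direction `v`. -/
noncomputable def dirDeriv (v : Fin N → K) :
    Derivation K (MvPolynomial (Fin N) K) (MvPolynomial (Fin N) K) :=
  mkDerivation K fun i => C (v i)

lemma dirDeriv_X (v : Fin N → K) (i : Fin N) : dirDeriv v (X i) = C (v i) := by
  simp [dirDeriv]

lemma dirDeriv_eq_sum (v : Fin N → K) (F : MvPolynomial (Fin N) K) :
    dirDeriv v F = ∑ i, C (v i) * pderiv i F := by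
  have : dirDeriv v = ∑ i : Fin N, (C (v i) : MvPolynomial (Fin N) K) •
      (pderiv i : Derivation K (MvPolynomial (Fin N) K) (MvPolynomial (Fin N) K)) := by
    apply MvPolynomial.derivation_ext
    intro i
    classical
    have h : (∑ j : Fin N, (C (v j) : MvPolynomial (Fin N) K) • (pderiv j : Derivation K
        (MvPolynomial (Fin N) K) (MvPolynomial (Fin N) K))) (X i) = ∑ j, C (v j) * pderiv j (X i) := by
      rw [← Derivation.coeFnAddMonoidHom_apply, map_sum, Finset.sum_apply]
      rfl
    rw [dirDeriv_X, h]
    simp [pderiv_X, Pi.single_apply]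
  rw [this, ← Derivation.coeFnAddMonoidHom_apply, map_sum, Finset.sum_apply]
  rfl

lemma dirDeriv_mem_forms (v : Fin N → K) {F : MvPolynomial (Fin N) K} {m : ℕ}
    (hF : F.IsHomogeneous m) : (dirDeriv v F).IsHomogeneous (m - 1) := by
  rw [dirDeriv_eq_sum]
  exact IsHomogeneous.sum _ _ _ fun i _ => hF.pderiv.C_mul _

lemma dirDeriv_iterate_isHomogeneous (v : Fin N → K) {F : MvPolynomial (Fin N) K} {m : ℕ}
    (hF : F.IsHomogeneous m) (b : ℕ) : ((dirDeriv v)^[b] F).IsHomogeneous (m - b) := by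
  induction b with
  | zero => simpa using hF
  | succ b ih =>
    rw [Function.iterate_succ_apply', ← Nat.sub_sub]
    exact dirDeriv_mem_forms v ih

/-- The apolarity pairing, under which multiplication by `linForm v` is adjoint to the derivative
in the direction `v`. -/
noncomputable def apolar (K : Type*) [Field K] (N : ℕ) :
    MvPolynomial (Fin N) K →ₗ[K] MvPolynomial (Fin N) K →ₗ[K] K :=
  (basisMonomials (Fin N) K).constr K fun α => ((∏ i, (α i).factorial : ℕ) : K) • lcoeff K α

lemma apolar_monomial (α : Fin N →₀ ℕ) (a : K) (G : MvPolynomial (Fin N) K) :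
    apolar K N (monomial α a) G = a * (((∏ i, (α i).factorial : ℕ) : K) * coeff α G) := by
  have h : monomial α a = a • basisMonomials (Fin N) K α := by simp [smul_monomial]
  rw [h, map_smul, apolar, Module.Basis.constr_basis]
  simp [lcoeff]

lemma apolar_comm (F G : MvPolynomial (Fin N) K) : apolar K N F G = apolar K N G F := by
  classical
  induction F using MvPolynomial.induction_on' with
  | monomial α a =>
    induction G using MvPolynomial.induction_on' with
    | monomial β b =>
      rw [apolar_monomial, apolar_monomial, coeff_monomial, coeff_monomial]
      by_cases h : α = β
      · subst h; simp; ring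
      · rw [if_neg h, if_neg (Ne.symm h)]; simp
    | add p q hp hq => rw [map_add, map_add, LinearMap.add_apply, hp, hq]
  | add p q hp hq => rw [map_add, map_add, LinearMap.add_apply, hp, hq]

/-- The weights α! in the pairing are chosen for this: α! is α_i times the weight of the exponent
lowered at i. -/
lemma apolar_X_mul (i : Fin N) (F G : MvPolynomial (Fin N) K) :
    apolar K N F (X i * G) = apolar K N (pderiv i F) G := by
  classical
  induction F using MvPolynomial.induction_on' with
  | monomial α a =>
    rw [pderiv_monomial, apolar_monomial, apolar_monomial, coeff_X_mul']
    by_cases h : α i = 0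
    · rw [if_neg (by simpa using h), h]; simp
    · rw [if_pos (by simpa using h)]
      have hf : ∏ j, (α j).factorial =
          α i * ∏ j, ((α - Finsupp.single i 1 : Fin N →₀ ℕ) j).factorial := by
        rw [← Finset.mul_prod_erase _ _ (Finset.mem_univ i),
          ← Finset.mul_prod_erase Finset.univ (fun j => ((α - Finsupp.single i 1 : Fin N →₀ ℕ) j).factorial)
            (Finset.mem_univ i), ← mul_assoc]
        congr 1
        · rw [Finsupp.tsub_apply, Finsupp.single_eq_same, Nat.mul_factorial_pred h]
        · refine Finset.prod_congr rfl fun j hj => ?_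
          rw [Finsupp.tsub_apply, Finsupp.single_eq_of_ne (Finset.ne_of_mem_erase hj), tsub_zero]
      rw [hf]; push_cast; ring
  | add p q hp hq => simp only [map_add, LinearMap.add_apply, hp, hq]

lemma apolar_linForm_mul (v : Fin N → K) (F G : MvPolynomial (Fin N) K) :
    apolar K N F (linForm v * G) = apolar K N (dirDeriv v F) G := by
  rw [dirDeriv_eq_sum, linForm, Finset.sum_mul, map_sum, map_sum, LinearMap.sum_apply]
  refine Finset.sum_congr rfl fun i _ => ?_
  rw [mul_assoc, ← smul_eq_C_mul, ← smul_eq_C_mul, map_smul, map_smul, LinearMap.smul_apply,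
    apolar_X_mul]

lemma apolar_linForm_pow_mul (v : Fin N → K) (b : ℕ) (F G : MvPolynomial (Fin N) K) :
    apolar K N F (linForm v ^ b * G) = apolar K N ((dirDeriv v)^[b] F) G := by
  induction b generalizing F with
  | zero => simp
  | succ b ih =>
    rw [pow_succ', mul_assoc, apolar_linForm_mul, ih, Function.iterate_succ_apply]

/-- Monomials are orthogonal, and the weight α! of a monomial of degree m divides m!. -/
lemma eq_zero_of_apolar_eq_zero {m : ℕ} (hm : (m.factorial : K) ≠ 0) {F : MvPolynomial (Fin N) K}
    (hF : F.IsHomogeneous m) (h : ∀ G : MvPolynomial (Fin N) K, G.IsHomogeneous m →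
      apolar K N F G = 0) : F = 0 := by
  ext α
  by_cases hα : α.degree = m
  · have h1 := h (monomial α 1) (isHomogeneous_monomial _ hα)
    rw [apolar_comm, apolar_monomial, one_mul] at h1
    rcases mul_eq_zero.1 h1 with h2 | h2
    · exfalso
      apply hm
      rw [Finsupp.degree_eq_sum] at hα
      obtain ⟨c, hc⟩ := Nat.prod_factorial_dvd_factorial_sum Finset.univ (fun i => α i)
      rw [← hα, hc, Nat.cast_mul, h2, zero_mul]
    · simpa using h2
  · rw [hF.coeff_eq_zero hα, coeff_zero]

/-- Pairing with a power of a linear form is evaluation. -/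
lemma apolar_linForm_pow (v : Fin N → K) (m : ℕ) :
    ∀ {F : MvPolynomial (Fin N) K}, F.IsHomogeneous m →
      apolar K N F (linForm v ^ m) = (m.factorial : K) * eval v F := by
  induction m with
  | zero =>
    intro F hF
    rw [← homogeneousComponent_eq_self hF, homogeneousComponent_zero]
    rw [show (C (coeff 0 F) : MvPolynomial (Fin N) K) = monomial 0 (coeff 0 F) from rfl,
      apolar_monomial]
    simp
  | succ m ih =>
    intro F hF
    have h1 : (dirDeriv v F).IsHomogeneous m := dirDeriv_mem_forms v hF
    rw [pow_succ', apolar_linForm_mul, ih h1]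
    have h2 : eval v (dirDeriv v F) = ((m + 1 : ℕ) : K) * eval v F := by
      have h3 := congrArg (eval v) hF.sum_X_mul_pderiv
      rw [dirDeriv_eq_sum]
      simpa using h3
    rw [h2, Nat.factorial_succ]; push_cast; ring

end Apolarity

/-! ### Multiple points are dual to powers of linear forms. -/

section Duality
variable {K : Type*} [Field K] {n : ℕ}

lemma finSuccEquiv_pderiv_zero (F : MvPolynomial (Fin (n + 1)) K) :
    finSuccEquiv K n (dirDeriv (coordPoint K n) F) = Polynomial.derivative (finSuccEquiv K n F) := by
  induction F using MvPolynomial.induction_on with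
  | C a => simp [finSuccEquiv_apply]
  | add p q hp hq => simp [hp, hq]
  | mul_X p i hp =>
    rw [Derivation.leibniz, map_add, smul_eq_mul, smul_eq_mul, map_mul, map_mul, hp, map_mul,
      Polynomial.derivative_mul, dirDeriv_X]
    refine Fin.cases ?_ (fun i => ?_) i
    · simp [coordPoint, finSuccEquiv_X_zero]; ring
    · simp [coordPoint, finSuccEquiv_X_succ]; ring

lemma shear_dirDeriv (v : Fin (n + 1) → K) (F : MvPolynomial (Fin (n + 1)) K) :
    dirDeriv (coordPoint K n) (shear v F) = shear v (dirDeriv v F) := by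
  induction F using MvPolynomial.induction_on with
  | C a => simp
  | add p q hp hq => simp [hp, hq]
  | mul_X p i hp =>
    rw [Derivation.leibniz, map_mul, Derivation.leibniz, map_add, smul_eq_mul, smul_eq_mul,
      smul_eq_mul, smul_eq_mul, map_mul, map_mul, hp, dirDeriv_X]
    congr 2
    refine Fin.cases ?_ (fun i => ?_) i
    · simp [shear_X_zero, dirDeriv_X, coordPoint]
    · simp [shear_X_succ, dirDeriv_X, coordPoint]

/-- With v moved to the first coordinate point, vanishing to order m + 1 - J says that the degree in
the first variable is less than J, and the derivative becomes the one in that variable. The factors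
produced by J derivatives divide m!. -/
lemma mem_linearIdeal_pow_iff_dirDeriv {m J : ℕ} (hm : (m.factorial : K) ≠ 0) (hJ : J ≤ m + 1)
    {v : Fin (n + 1) → K} (hv : v 0 ≠ 0) {F : MvPolynomial (Fin (n + 1)) K}
    (hF : F.IsHomogeneous m) :
    F ∈ linearIdeal (Submodule.span K {v}) ^ (m + 1 - J) ↔ (dirDeriv v)^[J] F = 0 := by
  have h1 : F ∈ linearIdeal (Submodule.span K {v}) ^ (m + 1 - J) ↔
      shear v F ∈ linearIdeal (Submodule.span K {coordPoint K n}) ^ (m + 1 - J) := by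
    rw [← shearChange_map_span_self v hv, ← (shearChange v hv).map_linearIdeal, ← Ideal.map_pow,
      ← shearChange_σ v hv, (shearChange v hv).mem_map_iff]
  have h2 : ∀ (b : ℕ) (F : MvPolynomial (Fin (n + 1)) K),
      shear v ((dirDeriv v)^[b] F) = (dirDeriv (coordPoint K n))^[b] (shear v F) := by
    intro b
    induction b with
    | zero => simp
    | succ b ih => intro F; rw [Function.iterate_succ_apply, ih, ← shear_dirDeriv,
        Function.iterate_succ_apply]
  have h3 : ∀ (b : ℕ) (F : MvPolynomial (Fin (n + 1)) K),
      finSuccEquiv K n ((dirDeriv (coordPoint K n))^[b] F) =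
        Polynomial.derivative^[b] (finSuccEquiv K n F) := by
    intro b
    induction b with
    | zero => simp
    | succ b ih => intro F; rw [Function.iterate_succ_apply, ih, finSuccEquiv_pderiv_zero,
        Function.iterate_succ_apply]
  have hF' := shear_isHomogeneous v hF
  rw [h1, mem_linearIdeal_coordPoint_pow hF',
    ← (map_eq_zero_iff (shear v) (shearChange v hv).σ.injective), h2,
    ← (map_eq_zero_iff (finSuccEquiv K n) (finSuccEquiv K n).injective), h3, Polynomial.ext_iff]
  constructor
  · intro h b
    rw [Polynomial.coeff_iterate_derivative, h (b + J) (by omega), smul_zero, Polynomial.coeff_zero]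
  · intro h b hb
    rcases lt_or_ge m b with hmb | hmb
    · exact coeff_finSuccEquiv_eq_zero hF' hmb
    · have := h (b - J)
      rw [Polynomial.coeff_iterate_derivative, Polynomial.coeff_zero,
        show b - J + J = b by omega, ← Nat.cast_smul_eq_nsmul K] at this
      refine (smul_eq_zero.1 this).resolve_left fun h0 => hm ?_
      have hd : b.descFactorial J ∣ m.factorial := by
        refine Dvd.dvd.trans ?_ (Nat.factorial_dvd_factorial hmb)
        exact ⟨_, by rw [mul_comm]; exact (Nat.factorial_mul_descFactorial (by omega)).symm⟩
      obtain ⟨c, hc⟩ := hd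
      rw [hc, Nat.cast_mul, h0, zero_mul]

variable {ι : Type*}

/-- The products of degree `s` with the `J i`-th power of the `i`-th linear form. -/
noncomputable def powerMultiples {N : ℕ} (v : ι → Fin N → K) (J : ι → ℕ) (s : ℤ) (i : ι) :
    Submodule K (MvPolynomial (Fin N) K) :=
  (forms K N (s - J i)).map (LinearMap.mulLeft K (linForm (v i) ^ J i))

/-- The forms of degree `s` in the ideal of the powers `(linForm (v i)) ^ (J i)` for `i ∈ X`. -/
noncomputable def powerPiece {N : ℕ} (v : ι → Fin N → K) (J : ι → ℕ) (X : Finset ι) (s : ℤ) :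
    Submodule K (MvPolynomial (Fin N) K) :=
  ⨆ i ∈ X, powerMultiples v J s i

section
variable {N : ℕ} {v : ι → Fin N → K} {J : ι → ℕ} {s : ℤ}

lemma mem_powerMultiples {i : ι} {f : MvPolynomial (Fin N) K} :
    f ∈ powerMultiples v J s i ↔ ∃ g ∈ forms K N (s - J i), f = linForm (v i) ^ J i * g := by
  simp [powerMultiples, eq_comm]

lemma powerMultiples_le_forms (i : ι) : powerMultiples v J s i ≤ forms K N s := by
  intro f hf
  obtain ⟨g, hg, rfl⟩ := mem_powerMultiples.1 hf
  have := mul_mem_forms (linForm_pow_mem_forms (v i) (J i)) hg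
  rwa [add_sub_cancel] at this

lemma powerPiece_le_forms (X : Finset ι) : powerPiece v J X s ≤ forms K N s :=
  iSup₂_le fun i _ => powerMultiples_le_forms i

lemma powerPiece_insert [DecidableEq ι] (X : Finset ι) (i : ι) :
    powerPiece v J (insert i X) s = powerMultiples v J s i ⊔ powerPiece v J X s := by
  unfold powerPiece
  rw [Finset.iSup_insert]

lemma powerPiece_mono {X Y : Finset ι} (h : X ⊆ Y) : powerPiece v J X s ≤ powerPiece v J Y s :=
  biSup_mono fun _ hi => h hi

lemma mem_powerPiece {X : Finset ι} {f : MvPolynomial (Fin N) K} :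
    f ∈ powerPiece v J X s ↔
      ∃ g : ι → MvPolynomial (Fin N) K, (∀ i, g i ∈ forms K N (s - J i)) ∧
        f = ∑ i ∈ X, linForm (v i) ^ J i * g i := by
  classical
  constructor
  · intro h
    induction X using Finset.induction_on generalizing f with
    | empty =>
      refine ⟨fun _ => 0, fun _ => zero_mem _, ?_⟩
      simpa [powerPiece] using h
    | insert i X hi ih =>
      rw [powerPiece_insert, Submodule.mem_sup] at h
      obtain ⟨a, ha, b, hb, rfl⟩ := h
      obtain ⟨g, hg, rfl⟩ := ih hb
      obtain ⟨q, hq, rfl⟩ := mem_powerMultiples.1 ha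
      refine ⟨Function.update g i q, fun l => ?_, ?_⟩
      · by_cases hl : l = i
        · subst hl; simpa using hq
        · rw [Function.update_of_ne hl]; exact hg l
      · rw [Finset.sum_insert hi, Function.update_self]
        congr 1
        refine Finset.sum_congr rfl fun l hl => ?_
        rw [Function.update_of_ne (by rintro rfl; exact hi hl)]
  · rintro ⟨g, hg, rfl⟩
    exact Submodule.sum_mem _ fun i hi =>
      (le_iSup₂_of_le (f := fun i (_ : i ∈ X) => powerMultiples v J s i) i hi le_rfl)
        (mem_powerMultiples.2 ⟨g i, hg i, rfl⟩)

end

/-- The intersection of the ideals of the thickened subspaces. -/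
noncomputable def fatIdeal {N : ℕ} (P : ι → Submodule K (Fin N → K)) (B : ι → ℤ) :
    Ideal (MvPolynomial (Fin N) K) :=
  ⨅ i, fatLinearIdeal (P i) (B i)

lemma mem_gradedPiece_fatIdeal {N : ℕ} {P : ι → Submodule K (Fin N → K)} {B : ι → ℤ} {m : ℕ}
    {F : MvPolynomial (Fin N) K} :
    F ∈ gradedPiece (fatIdeal P B) m ↔
      F.IsHomogeneous m ∧ ∀ i, F ∈ linearIdeal (P i) ^ (B i).toNat := by
  simp [gradedPiece, fatIdeal, fatLinearIdeal, and_comm]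

lemma gradedPiece_le {N : ℕ} (I : Ideal (MvPolynomial (Fin N) K)) (m : ℕ) :
    gradedPiece I m ≤ homogeneousSubmodule (Fin N) K m := inf_le_right

instance {N : ℕ} (I : Ideal (MvPolynomial (Fin N) K)) (m : ℕ) : Module.Finite K (gradedPiece I m) :=
  Submodule.finiteDimensional_of_le (gradedPiece_le I m)

instance {N : ℕ} (v : ι → Fin N → K) (J : ι → ℕ) (X : Finset ι) (s : ℤ) :
    Module.Finite K (powerPiece v J X s) :=
  Submodule.finiteDimensional_of_le (powerPiece_le_forms X)

/-- Multiplication by the linear form is adjoint to the directional derivative. For J > m both sides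
are void: the multiplicity is truncated to 0 and there are no forms g; then nothing is asked of v.
-/
lemma mem_linearIdeal_pow_iff_apolar {m : ℕ} (hm : (m.factorial : K) ≠ 0) {J : ℕ}
    {v : Fin (n + 1) → K} (hv : J ≤ m → v 0 ≠ 0) {F : MvPolynomial (Fin (n + 1)) K}
    (hF : F.IsHomogeneous m) :
    F ∈ linearIdeal (Submodule.span K {v}) ^ ((m : ℤ) + 1 - J).toNat ↔
      ∀ g ∈ forms K (n + 1) (m - J), apolar K (n + 1) F (linForm v ^ J * g) = 0 := by
  rcases lt_or_ge m J with h | h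
  · rw [show ((m : ℤ) + 1 - J).toNat = 0 by omega, pow_zero, Ideal.one_eq_top]
    refine iff_of_true trivial fun g hg => ?_
    rw [eq_zero_of_mem_forms (by omega) hg, mul_zero, map_zero]
  · rw [show ((m : ℤ) + 1 - J).toNat = m + 1 - J by omega,
      mem_linearIdeal_pow_iff_dirDeriv hm (by omega) (hv h) hF,
      show (m : ℤ) - J = (m - J : ℕ) by omega]
    simp only [apolar_linForm_pow_mul, mem_forms_natCast]
    constructor
    · intro h0 g _
      rw [h0, map_zero, LinearMap.zero_apply]
    · intro h0
      refine eq_zero_of_apolar_eq_zero ?_ (dirDeriv_iterate_isHomogeneous v hF J) h0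
      intro h1
      obtain ⟨c, hc⟩ := Nat.factorial_dvd_factorial (Nat.sub_le m J)
      rw [hc, Nat.cast_mul, h1, zero_mul] at hm
      exact hm rfl

lemma mem_gradedPiece_iff_apolar {m : ℕ} (hm : (m.factorial : K) ≠ 0)
    {v : ι → Fin (n + 1) → K} {J : ι → ℕ} {B : ι → ℤ} {X : Finset ι}
    (hB : ∀ i ∈ X, B i = m + 1 - J i) (hB' : ∀ i ∉ X, B i ≤ 0)
    (hv : ∀ i ∈ X, J i ≤ m → v i 0 ≠ 0) {F : MvPolynomial (Fin (n + 1)) K} :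
    F ∈ gradedPiece (fatIdeal (fun i => Submodule.span K {v i}) B) m ↔
      F.IsHomogeneous m ∧ ∀ G ∈ powerPiece v J X m, apolar K (n + 1) F G = 0 := by
  rw [mem_gradedPiece_fatIdeal]
  refine and_congr_right fun hF => ?_
  constructor
  · intro h G hG
    obtain ⟨g, hg, rfl⟩ := mem_powerPiece.1 hG
    rw [map_sum]
    refine Finset.sum_eq_zero fun i hi => ?_
    have := h i
    rw [hB i hi, mem_linearIdeal_pow_iff_apolar hm (hv i hi) hF] at this
    exact this _ (hg i)
  · intro h i
    by_cases hi : i ∈ X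
    · rw [hB i hi, mem_linearIdeal_pow_iff_apolar hm (hv i hi) hF]
      intro g hg
      refine h _ ((le_iSup₂_of_le (f := fun i (_ : i ∈ X) => powerMultiples v J (m : ℤ) i) i hi
        le_rfl) (mem_powerMultiples.2 ⟨g, hg, rfl⟩))
    · rw [Int.toNat_of_nonpos (hB' i hi), pow_zero, Ideal.one_eq_top]
      trivial

/-- The forms of degree `m` through a scheme of multiple points are dual to the quotient of the
space of forms of degree `m` by the multiples of powers of linear forms. -/
theorem finrank_gradedPiece_add_finrank_powerPiece {m : ℕ} (hm : (m.factorial : K) ≠ 0)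
    {v : ι → Fin (n + 1) → K} {J : ι → ℕ} {B : ι → ℤ} {X : Finset ι}
    (hB : ∀ i ∈ X, B i = m + 1 - J i) (hB' : ∀ i ∉ X, B i ≤ 0)
    (hv : ∀ i ∈ X, J i ≤ m → v i 0 ≠ 0) :
    Module.finrank K (gradedPiece (fatIdeal (fun i => Submodule.span K {v i}) B) m) +
      Module.finrank K (powerPiece v J X m) = (n + 1).multichoose m := by
  set V := homogeneousSubmodule (Fin (n + 1)) K m with hV
  let β : LinearMap.BilinForm K V := (apolar K (n + 1)).compl₁₂ V.subtype V.subtype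
  have hβ : ∀ x y : V, β x y = apolar K (n + 1) x y := fun x y => rfl
  have hsymm : β.IsSymm := ⟨fun x y => by rw [hβ, hβ]; exact apolar_comm _ _⟩
  have hnd : β.Nondegenerate := by
    rw [LinearMap.BilinForm.Nondegenerate, LinearMap.IsRefl.nondegenerate_iff_separatingLeft hsymm.isRefl]
    intro x hx
    exact Subtype.ext (eq_zero_of_apolar_eq_zero hm x.2 fun G hG => hx ⟨G, hG⟩)
  have hWV : powerPiece v J X m ≤ V := by
    have := powerPiece_le_forms (v := v) (J := J) (s := m) X
    rwa [forms_natCast] at this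
  have h1 := LinearMap.BilinForm.finrank_orthogonal hnd ((powerPiece v J X m).comap V.subtype)
  have h2 : Module.finrank K ((powerPiece v J X m).comap V.subtype) =
      Module.finrank K (powerPiece v J X m) :=
    (Submodule.comapSubtypeEquivOfLe hWV).finrank_eq
  have h3 : β.orthogonal ((powerPiece v J X m).comap V.subtype) =
      (gradedPiece (fatIdeal (fun i => Submodule.span K {v i}) B) m).comap V.subtype := by
    ext x
    rw [LinearMap.BilinForm.mem_orthogonal_iff, Submodule.mem_comap]
    rw [Submodule.subtype_apply, mem_gradedPiece_iff_apolar hm hB hB' hv]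
    constructor
    · intro h
      refine ⟨x.2, fun G hG => ?_⟩
      have := h ⟨G, hWV hG⟩ hG
      rw [apolar_comm]
      exact this
    · rintro ⟨-, h⟩ y hy
      have := h y hy
      rw [apolar_comm] at this
      exact this
  have h4 : Module.finrank K (powerPiece v J X m) ≤ Module.finrank K V :=
    Submodule.finrank_mono hWV
  have h5 : Module.finrank K V = (n + 1).multichoose m := finrank_homogeneousSubmodule m
  rw [h3, h2, (Submodule.comapSubtypeEquivOfLe (gradedPiece_le _ m)).finrank_eq] at h1
  omega

end Duality

/-! ### Absence of relations among powers of linear forms. -/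

section Independence
variable {K : Type*} [Field K] {N : ℕ} {ι : Type*}

lemma exists_smul_of_linForm_dvd {y w : Fin N → K} (h : linForm y ∣ linForm w) :
    ∃ c : K, w = c • y := by
  obtain ⟨q, hq, h⟩ := exists_forms_of_dvd (linForm_isHomogeneous y) (linForm_mem_forms w) h
  rw [show (1 : ℤ) - (1 : ℕ) = (0 : ℕ) by norm_num, mem_forms_natCast] at hq
  rw [← homogeneousComponent_eq_self hq, homogeneousComponent_zero] at h
  exact ⟨coeff 0 q, linForm_injective (by rw [linForm_smul, h, mul_comm])⟩

/-- A polynomial that is divisible by infinitely many linear forms of a pencil vanishes. -/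
lemma eq_zero_of_forall_linForm_dvd {a b : Fin N → K} (hab : LinearIndependent K ![a, b])
    {T : Set K} (hT : T.Infinite) {Q : MvPolynomial (Fin N) K}
    (h : ∀ t ∈ T, linForm (a + t • b) ∣ Q) : Q = 0 := by
  by_contra hQ
  obtain ⟨S, hST, hS⟩ := hT.exists_subset_card_eq (Q.totalDegree + 1)
  have hne : ∀ t : K, a + t • b ≠ 0 := fun t h0 => by
    have := LinearIndependent.pair_iff.1 hab 1 t (by simpa using h0)
    exact one_ne_zero this.1
  have hprime : ∀ t : K, Prime (linForm (a + t • b)) := fun t => linForm_prime (hne t)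
  -- Distinct members of the pencil are nonassociated primes, so the product of deg Q + 1 of them
  -- divides Q.
  have hdvd : ∏ t ∈ S, linForm (a + t • b) ∣ Q := by
    refine Finset.prod_dvd_of_isRelPrime ?_ fun t ht => h t (hST ht)
    intro t _ t' _ htt'
    refine ((hprime t).irreducible.isRelPrime_iff_not_dvd).2 fun hd => htt' ?_
    obtain ⟨c, hc⟩ := exists_smul_of_linForm_dvd hd
    have := LinearIndependent.pair_iff.1 hab (1 - c) (t' - c * t) (by
      have h1 : a + t' • b - c • (a + t • b) = 0 := sub_eq_zero.2 hc
      rw [← h1]; module)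
    have hc1 : c = 1 := (sub_eq_zero.1 this.1).symm
    rw [hc1, one_mul] at this
    exact (sub_eq_zero.1 this.2).symm
  obtain ⟨q, rfl⟩ := hdvd
  have hq : q ≠ 0 := right_ne_zero_of_mul hQ
  have hp : ∏ t ∈ S, linForm (a + t • b) ≠ 0 := left_ne_zero_of_mul hQ
  have hhom : (∏ t ∈ S, linForm (a + t • b)).IsHomogeneous S.card := by
    have := IsHomogeneous.prod S (fun t => linForm (a + t • b)) (fun _ => 1)
      (fun t _ => linForm_isHomogeneous _)
    simpa using this
  have := totalDegree_mul_of_isDomain hp hq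
  rw [hhom.totalDegree hp] at this
  omega

/-- In degree `s` there is no relation among the powers of the linear forms modulo `linForm y`. -/
def IndepMod (v : ι → Fin N → K) (J : ι → ℕ) (y : Fin N → K) (X : Finset ι) (s : ℤ) : Prop :=
  ∀ g : ι → MvPolynomial (Fin N) K, (∀ i, g i ∈ forms K N (s - J i)) →
    linForm y ∣ ∑ i ∈ X, linForm (v i) ^ J i * g i → ∀ i ∈ X, linForm y ∣ g i

/-- In degree `s` there is no relation among the powers of the linear forms. -/
def Indep (v : ι → Fin N → K) (J : ι → ℕ) (X : Finset ι) (s : ℤ) : Prop :=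
  ∀ g : ι → MvPolynomial (Fin N) K, (∀ i, g i ∈ forms K N (s - J i)) →
    ∑ i ∈ X, linForm (v i) ^ J i * g i = 0 → ∀ i ∈ X, g i = 0

variable {v : ι → Fin N → K} {J : ι → ℕ} {y : Fin N → K} {s : ℤ}

lemma IndepMod.subset {X Y : Finset ι} (h : IndepMod v J y Y s) (hXY : X ⊆ Y) :
    IndepMod v J y X s := by
  classical
  intro g hg hd i hi
  have := h (fun i => if i ∈ X then g i else 0) (fun i => by
    split_ifs
    · exact hg i
    · exact zero_mem _) (by
    convert hd using 1
    refine (Finset.sum_subset hXY fun i _ hi => ?_).symm.trans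
      (Finset.sum_congr rfl fun i hi => ?_)
    · rw [if_neg hi, mul_zero]
    · rw [if_pos hi]) i (hXY hi)
  simpa [hi] using this

/-- A relation in lower degree is multiplied up by a power of `linForm w`, which is prime to
`linForm y`. -/
lemma IndepMod.of_le {X : Finset ι} (h : IndepMod v J y X s) (hy : y ≠ 0) {w : Fin N → K}
    (hw : ¬ linForm y ∣ linForm w) {s' : ℤ} (hs : s' ≤ s) : IndepMod v J y X s' := by
  obtain ⟨k, rfl⟩ : ∃ k : ℕ, s = s' + k := ⟨(s - s').toNat, by omega⟩
  intro g hg hd i hi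
  have := h (fun i => linForm w ^ k * g i) (fun i => by
    have := mul_mem_forms (linForm_pow_mem_forms w k) (hg i)
    rwa [show (k : ℤ) + (s' - J i) = s' + k - J i by ring] at this) (by
    have h2 := hd.mul_left (linForm w ^ k)
    rw [Finset.mul_sum] at h2
    convert h2 using 1
    exact Finset.sum_congr rfl fun i _ => by ring) i hi
  rcases (linForm_prime hy).dvd_or_dvd this with h1 | h1
  · exact absurd ((linForm_prime hy).dvd_of_dvd_pow h1) hw
  · exact h1

/-- Descent on the degree: the coefficients of a relation are all divisible by `linForm y`, and
dividing it out gives a relation of lower degree. -/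
lemma IndepMod.indep {X : Finset ι} (h : IndepMod v J y X s) (hy : y ≠ 0) {w : Fin N → K}
    (hw : ¬ linForm y ∣ linForm w) : Indep v J X s := by
  suffices H : ∀ k : ℕ, ∀ s' : ℤ, s' < k → s' ≤ s → Indep v J X s' from
    H (s + 1).toNat s (by omega) le_rfl
  intro k
  induction k with
  | zero =>
    intro s' hs' _ g hg _ i _
    exact eq_zero_of_mem_forms (by omega) (hg i)
  | succ k ih =>
    intro s' hs' hle g hg hsum
    have hd : ∀ i ∈ X, linForm y ∣ g i :=
      h.of_le hy hw hle g hg (by rw [hsum]; exact dvd_zero _)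
    have hex : ∀ i, ∃ q ∈ forms K N (s' - 1 - J i), i ∈ X → g i = linForm y * q := by
      intro i
      by_cases hi : i ∈ X
      · obtain ⟨q, hq, h⟩ := exists_forms_of_dvd (linForm_isHomogeneous y) (hg i) (hd i hi)
        exact ⟨q, by convert hq using 1; push_cast; ring_nf, fun _ => h⟩
      · exact ⟨0, zero_mem _, fun h => absurd h hi⟩
    choose q hq hgq using hex
    have hq0 := ih (s' - 1) (by omega) (by omega) q hq (by
      have : linForm y * ∑ i ∈ X, linForm (v i) ^ J i * q i = 0 := by
        rw [← hsum, Finset.mul_sum]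
        exact Finset.sum_congr rfl fun i hi => by rw [hgq i hi]; ring
      exact (mul_eq_zero.1 this).resolve_left (linForm_ne_zero hy))
    intro i hi
    rw [hgq i hi, hq0 i hi, mul_zero]

lemma Indep.subset {X Y : Finset ι} (h : Indep v J Y s) (hXY : X ⊆ Y) : Indep v J X s := by
  classical
  intro g hg hd i hi
  have := h (fun i => if i ∈ X then g i else 0) (fun i => by
    split_ifs
    · exact hg i
    · exact zero_mem _) (by
    refine (Finset.sum_subset hXY fun i _ hi => ?_).symm.trans
      ((Finset.sum_congr rfl fun i hi => ?_).trans hd)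
    · rw [if_neg hi, mul_zero]
    · rw [if_pos hi]) i (hXY hi)
  simpa [hi] using this

instance (i : ι) : Module.Finite K (powerMultiples v J s i) :=
  Submodule.finiteDimensional_of_le (powerMultiples_le_forms i)

lemma finrank_powerMultiples {i : ι} (hv : v i ≠ 0) :
    (Module.finrank K (powerMultiples v J s i) : ℤ) = numForms N (s - J i) := by
  rw [← finrank_forms (K := K), powerMultiples]
  congr 1
  exact ((Submodule.equivMapOfInjective _ (fun a b h => by
    simpa [pow_ne_zero _ (linForm_ne_zero hv)] using h) _).finrank_eq).symm

section

lemma powerPiece_empty : powerPiece v J ∅ s = ⊥ := by simp [powerPiece]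

variable [DecidableEq ι]

lemma finrank_powerPiece_insert {X : Finset ι} {j : ι} :
    (Module.finrank K (powerPiece v J (insert j X) s) : ℤ) =
      Module.finrank K (powerMultiples v J s j) + Module.finrank K (powerPiece v J X s) -
        Module.finrank K (powerMultiples v J s j ⊓ powerPiece v J X s : Submodule K _) := by
  have := Submodule.finrank_sup_add_finrank_inf_eq (powerMultiples v J s j) (powerPiece v J X s)
  rw [powerPiece_insert]
  omega

lemma finrank_powerPiece_le {X : Finset ι} (hv : ∀ i ∈ X, v i ≠ 0) :
    (Module.finrank K (powerPiece v J X s) : ℤ) ≤ ∑ i ∈ X, numForms N (s - J i) := by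
  induction X using Finset.induction_on with
  | empty => rw [powerPiece_empty]; simp
  | insert j X hj ih =>
    have := ih fun i hi => hv i (Finset.mem_insert_of_mem hi)
    rw [finrank_powerPiece_insert, Finset.sum_insert hj,
      finrank_powerMultiples (hv j (Finset.mem_insert_self _ _))]
    omega

lemma Indep.finrank_powerPiece {X : Finset ι} (hv : ∀ i ∈ X, v i ≠ 0) (h : Indep v J X s) :
    (Module.finrank K (powerPiece v J X s) : ℤ) = ∑ i ∈ X, numForms N (s - J i) := by
  induction X using Finset.induction_on with
  | empty => rw [powerPiece_empty]; simp
  | insert j X hj ih =>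
    have h1 := ih (fun i hi => hv i (Finset.mem_insert_of_mem hi))
      (h.subset (Finset.subset_insert _ _))
    have h2 : powerMultiples v J s j ⊓ powerPiece v J X s = ⊥ := by
      rw [eq_bot_iff]
      rintro f ⟨hf1, hf2⟩
      obtain ⟨q, hq, rfl⟩ := mem_powerMultiples.1 hf1
      obtain ⟨g, hg, hgq⟩ := mem_powerPiece.1 hf2
      have h3 := h (Function.update (fun i => -g i) j q) (fun l => by
        by_cases hl : l = j
        · subst hl; simpa using hq
        · rw [Function.update_of_ne hl]; exact neg_mem (hg l)) (by
        rw [Finset.sum_insert hj, Function.update_self, hgq, ← Finset.sum_add_distrib]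
        refine Finset.sum_eq_zero fun i hi => ?_
        rw [Function.update_of_ne (by rintro rfl; exact hj hi)]
        ring) j (Finset.mem_insert_self _ _)
      rw [Function.update_self] at h3
      rw [h3, mul_zero]
      exact zero_mem _
    rw [finrank_powerPiece_insert, Finset.sum_insert hj, h1, h2,
      finrank_powerMultiples (hv j (Finset.mem_insert_self _ _))]
    simp

/-- The sum is an upper bound for the dimension. Reaching it forces each new space of multiples to
meet the span of the earlier ones in zero. -/
lemma indep_of_finrank_powerPiece {X : Finset ι} (hv : ∀ i ∈ X, v i ≠ 0)
    (h : (Module.finrank K (powerPiece v J X s) : ℤ) = ∑ i ∈ X, numForms N (s - J i)) :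
    Indep v J X s := by
  induction X using Finset.induction_on with
  | empty => intro g _ _ i hi; simp at hi
  | insert j X hj ih =>
    have hvX : ∀ i ∈ X, v i ≠ 0 := fun i hi => hv i (Finset.mem_insert_of_mem hi)
    have hvj := hv j (Finset.mem_insert_self _ _)
    have hle := finrank_powerPiece_le (J := J) (s := s) hvX
    rw [finrank_powerPiece_insert, Finset.sum_insert hj, finrank_powerMultiples hvj] at h
    have h0 : Module.finrank K (powerMultiples v J s j ⊓ powerPiece v J X s : Submodule K _) = 0 := by
      omega
    rw [Submodule.finrank_eq_zero] at h0
    have hX := ih hvX (by omega)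
    intro g hg hsum
    rw [Finset.sum_insert hj] at hsum
    have hmem : linForm (v j) ^ J j * g j ∈ powerMultiples v J s j ⊓ powerPiece v J X s := by
      refine ⟨mem_powerMultiples.2 ⟨_, hg j, rfl⟩, ?_⟩
      rw [eq_neg_of_add_eq_zero_left hsum]
      exact neg_mem (mem_powerPiece.2 ⟨g, hg, rfl⟩)
    rw [h0, Submodule.mem_bot] at hmem
    have hgj : g j = 0 := by simpa [pow_ne_zero _ (linForm_ne_zero hvj)] using hmem
    rw [hmem, zero_add] at hsum
    intro i hi
    rcases Finset.mem_insert.1 hi with rfl | hi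
    · exact hgj
    · exact hX g hg hsum i hi

end

end Independence

/-! ### Excess over the expected codimension, and injectivity of multiplication. -/

section Excess
variable {K : Type*} [Field K] {N : ℕ} {ι : Type*} [DecidableEq ι]

/-- Multiplication by the power of the `j`-th linear form is injective, into degree `m`, modulo the
powers of the linear forms in `X`. -/
def InjOn (v : ι → Fin N → K) (J : ι → ℕ) (m : ℤ) (X : Finset ι) (j : ι) : Prop :=
  ∀ u ∈ forms K N (m - J j), linForm (v j) ^ J j * u ∈ powerPiece v J X m →
    u ∈ powerPiece v J X (m - J j)

/-- The difference between the actual and the expected codimension in degree `m`. -/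
noncomputable def excess (v : ι → Fin N → K) (J : ι → ℕ) (m : ℤ) (X : Finset ι) : ℤ :=
  numForms N m - Module.finrank K (powerPiece v J X m) -
    koszulEuler (fun i => (J i : ℤ)) X N m

variable {v : ι → Fin N → K} {J : ι → ℕ} {m : ℤ}

lemma excess_empty : excess v J m ∅ = 0 := by
  simp [excess, powerPiece_empty, koszulEuler_empty]

lemma map_mulLeft_powerPiece_le (X : Finset ι) (j : ι) :
    (powerPiece v J X (m - J j)).map (LinearMap.mulLeft K (linForm (v j) ^ J j)) ≤
      powerMultiples v J m j ⊓ powerPiece v J X m := by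
  rintro _ ⟨u, hu, rfl⟩
  refine ⟨mem_powerMultiples.2 ⟨u, powerPiece_le_forms X hu, rfl⟩, ?_⟩
  obtain ⟨g, hg, rfl⟩ := mem_powerPiece.1 hu
  refine mem_powerPiece.2 ⟨fun i => linForm (v j) ^ J j * g i, fun i => ?_, ?_⟩
  · have := mul_mem_forms (linForm_pow_mem_forms (v j) (J j)) (hg i)
    rwa [show (J j : ℤ) + (m - J j - J i) = m - J i by ring] at this
  · simp only [LinearMap.mulLeft_apply, Finset.mul_sum]
    exact Finset.sum_congr rfl fun i _ => by ring

lemma injOn_iff_map_eq (X : Finset ι) {j : ι} (hv : v j ≠ 0) :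
    InjOn v J m X j ↔
      (powerPiece v J X (m - J j)).map (LinearMap.mulLeft K (linForm (v j) ^ J j)) =
        powerMultiples v J m j ⊓ powerPiece v J X m := by
  constructor
  · intro h
    refine le_antisymm (map_mulLeft_powerPiece_le X j) ?_
    rintro f ⟨hf1, hf2⟩
    obtain ⟨u, hu, rfl⟩ := mem_powerMultiples.1 hf1
    exact ⟨u, h u hu hf2, rfl⟩
  · intro h u hu hmem
    have : linForm (v j) ^ J j * u ∈ powerMultiples v J m j ⊓ powerPiece v J X m :=
      ⟨mem_powerMultiples.2 ⟨u, hu, rfl⟩, hmem⟩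
    rw [← h] at this
    obtain ⟨u', hu', he⟩ := this
    rw [LinearMap.mulLeft_apply] at he
    rwa [← mul_left_cancel₀ (pow_ne_zero _ (linForm_ne_zero hv)) he]

lemma finrank_map_mulLeft {v : Fin N → K} (hv : v ≠ 0) (b : ℕ)
    (W : Submodule K (MvPolynomial (Fin N) K)) :
    Module.finrank K (W.map (LinearMap.mulLeft K (linForm v ^ b))) = Module.finrank K W :=
  ((Submodule.equivMapOfInjective _ (fun a b h => by
    simpa [pow_ne_zero _ (linForm_ne_zero hv)] using h) _).finrank_eq).symm

/-- The excess grows by dim I - dim M. Here I consists of all multiples of the j-th power in the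
ideal of X, and M of the evident ones, with cofactor in that ideal. Independence in degree m - J_j
gives dim M the value that enters the expected codimension, so the growth is nonnegative and
vanishes exactly when M = I. -/
lemma excess_insert {X : Finset ι} {j : ι} (hj : j ∉ X) (hv : v j ≠ 0) (hvX : ∀ i ∈ X, v i ≠ 0)
    (hind : Indep v J X (m - J j))
    (hJ : ∀ i ∈ X, ∀ l ∈ X, i ≠ l → m - J j < (J i : ℤ) + J l) :
    excess v J m X ≤ excess v J m (insert j X) ∧
      (excess v J m (insert j X) = excess v J m X ↔ InjOn v J m X j) := by
  set M := (powerPiece v J X (m - J j)).map (LinearMap.mulLeft K (linForm (v j) ^ J j)) with hM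
  set I := powerMultiples v J m j ⊓ powerPiece v J X m with hI
  have hle : M ≤ I := map_mulLeft_powerPiece_le X j
  have hfin : (Module.finrank K M : ℤ) = ∑ i ∈ X, numForms N (m - J j - J i) := by
    rw [hM, finrank_map_mulLeft hv, hind.finrank_powerPiece hvX]
  have hMI : Module.finrank K M ≤ Module.finrank K I := Submodule.finrank_mono hle
  have hdiff : excess v J m (insert j X) = excess v J m X + Module.finrank K I -
      Module.finrank K M := by
    unfold excess
    rw [finrank_powerPiece_insert, ← hI, finrank_powerMultiples hv, koszulEuler_insert _ hj,
      koszulEuler_of_lt (fun i => (J i : ℤ)) (T := X) (fun i _ => by positivity) N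
        (s := m - J j) hJ, hfin]
    ring
  refine ⟨by omega, ?_⟩
  rw [injOn_iff_map_eq X hv, ← hM, ← hI]
  constructor
  · intro h
    exact Submodule.eq_of_le_of_finrank_le hle (by omega)
  · intro h
    rw [hdiff, h]; ring

/-- The assumptions under which the excess is monotone. -/
structure GoodPowers (v : ι → Fin N → K) (J : ι → ℕ) (m : ℤ) : Prop where
  ne_zero : ∀ i, v i ≠ 0
  indep : ∀ j X, j ∉ X → Indep v J X (m - J j)
  triple : ∀ i l j, i ≠ l → i ≠ j → l ≠ j → m < (J i : ℤ) + J l + J j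

namespace GoodPowers
variable (h : GoodPowers v J m)
include h

lemma excess_step {X : Finset ι} {j : ι} (hj : j ∉ X) :
    excess v J m X ≤ excess v J m (insert j X) ∧
      (excess v J m (insert j X) = excess v J m X ↔ InjOn v J m X j) :=
  excess_insert hj (h.ne_zero j) (fun i _ => h.ne_zero i) (h.indep j X hj) fun i hi l hl hil => by
    have := h.triple i l j hil (fun e => hj (e ▸ hi)) (fun e => hj (e ▸ hl))
    omega

lemma excess_mono {X Y : Finset ι} (hXY : X ⊆ Y) : excess v J m X ≤ excess v J m Y := by
  suffices H : ∀ Z : Finset ι, excess v J m X ≤ excess v J m (X ∪ Z) by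
    have := H Y
    rwa [Finset.union_eq_right.mpr hXY] at this
  intro Z
  induction Z using Finset.induction_on with
  | empty => simp
  | insert i Z _ ih =>
    rw [Finset.union_insert]
    by_cases hm : i ∈ X ∪ Z
    · rwa [Finset.insert_eq_of_mem hm]
    · exact ih.trans (h.excess_step hm).1

lemma excess_nonneg (X : Finset ι) : 0 ≤ excess v J m X := by
  rw [← excess_empty (v := v) (J := J) (m := m)]
  exact h.excess_mono (Finset.empty_subset _)

lemma injOn_of_excess_eq_zero {Y : Finset ι} (hY : excess v J m Y = 0) {X : Finset ι} {j : ι}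
    (hj : j ∉ X) (hXY : insert j X ⊆ Y) : InjOn v J m X j := by
  refine (h.excess_step hj).2.1 ?_
  have h1 := h.excess_mono hXY
  have h2 := h.excess_nonneg X
  have h3 := (h.excess_step hj).1
  omega

lemma excess_eq_zero (hinj : ∀ X j, j ∉ X → InjOn v J m X j) (X : Finset ι) :
    excess v J m X = 0 := by
  induction X using Finset.induction_on with
  | empty => exact excess_empty
  | insert j X hj ih => rw [(h.excess_step hj).2.2 (hinj X j hj), ih]

end GoodPowers

/-- If multiplication stays injective after a linear form of a pencil is added, for infinitely many
members of the pencil, then it was injective before. -/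
theorem injOn_of_injOn_insert {X : Finset ι} {j a : ι} (ha : a ∉ X) (hja : j ≠ a)
    (hJa : J a ≠ 0) (hlin : LinearIndependent K ![v j, v a]) {Γ T : Set K} (hC : Γ.Infinite)
    (hT : T.Infinite)
    (hinj : ∀ c ∈ Γ, InjOn (Function.update v a (v a - c • v j)) J m (insert a X) j)
    (hind : ∀ t ∈ T, IndepMod v J (v j + t • v a) (insert a X) (m - J j)) :
    InjOn v J m X j := by
  intro u hu hmem
  have hupd : ∀ c : K, ∀ i ∈ X, Function.update v a (v a - c • v j) i = v i := fun c i hi =>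
    Function.update_of_ne (by rintro rfl; exact ha hi) _ _
  -- Only the vector at a moves with c, and it does not occur in the assumption on u. So u has an
  -- expression of this kind for every c in Γ.
  have hex : ∀ c : K, ∃ g : ι → MvPolynomial (Fin N) K, c ∈ Γ →
      (∀ i, g i ∈ forms K N (m - J j - J i)) ∧
      u = linForm (v a - c • v j) ^ J a * g a + ∑ i ∈ X, linForm (v i) ^ J i * g i := by
    intro c
    by_cases hc : c ∈ Γ
    · have h1 := hinj c hc u hu (by
        rw [Function.update_of_ne hja]
        obtain ⟨g, hg, he⟩ := mem_powerPiece.1 hmem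
        rw [he]
        refine powerPiece_mono (Finset.subset_insert a X) (mem_powerPiece.2 ⟨g, hg, ?_⟩)
        exact Finset.sum_congr rfl fun i hi => by rw [hupd c i hi])
      obtain ⟨g, hg, he⟩ := mem_powerPiece.1 h1
      refine ⟨g, fun _ => ⟨hg, ?_⟩⟩
      rw [he, Finset.sum_insert ha, Function.update_self]
      congr 1
      exact Finset.sum_congr rfl fun i hi => by rw [hupd c i hi]
    · exact ⟨fun _ => 0, fun h => absurd h hc⟩
  choose g hg using hex
  set P : K → MvPolynomial (Fin N) K := fun c => linForm (v a - c • v j) ^ J a * g c a with hP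
  -- Modulo the form of v j + t • v a, the form of v a - c • v j is 1 + c * t times the form of v a.
  have hmod : ∀ c t : K, linForm (v j + t • v a) ∣
      P c - linForm (v a) ^ J a * (C ((1 + c * t) ^ J a) * g c a) := by
    intro c t
    have h1 : linForm (v a - c • v j) = C (1 + c * t) * linForm (v a) -
        C c * linForm (v j + t • v a) := by
      rw [← linForm_smul, ← linForm_smul, sub_eq_add_neg (linForm _), ← neg_one_mul (linForm _),
        show (-1 : MvPolynomial (Fin N) K) = C (-1) by simp, ← linForm_smul, ← linForm_add]
      congr 1
      module
    have h2 : linForm (v j + t • v a) ∣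
        linForm (v a - c • v j) ^ J a - (C (1 + c * t) * linForm (v a)) ^ J a := by
      refine dvd_trans ?_ (sub_dvd_pow_sub_pow _ _ _)
      rw [h1]
      exact ⟨-C c, by ring⟩
    rw [hP, C_pow]
    convert h2.mul_right (g c a) using 1
    ring
  -- The difference of the expressions of u for c and c' is a relation modulo each form of a second
  -- pencil. Independence makes P c - P c' divisible by infinitely many linear forms, so P does not
  -- depend on c.
  have hPeq : ∀ c ∈ Γ, ∀ c' ∈ Γ, P c = P c' := by
    intro c hc c' hc'
    rw [← sub_eq_zero]
    refine eq_zero_of_forall_linForm_dvd hlin hT fun t ht => ?_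
    obtain ⟨hgc, huc⟩ := hg c hc
    obtain ⟨hgc', huc'⟩ := hg c' hc'
    have h1 := (hmod c t).sub (hmod c' t) |>.neg_right
    have hupd2 : ∀ i ∈ X, Function.update (fun i => g c i - g c' i) a
        (C ((1 + c * t) ^ J a) * g c a - C ((1 + c' * t) ^ J a) * g c' a) i = g c i - g c' i :=
      fun i hi => Function.update_of_ne (by rintro rfl; exact ha hi) _ _
    have h2 := hind t ht (Function.update (fun i => g c i - g c' i) a
      (C ((1 + c * t) ^ J a) * g c a - C ((1 + c' * t) ^ J a) * g c' a)) (fun i => by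
        by_cases hi : i = a
        · subst hi
          rw [Function.update_self, ← smul_eq_C_mul, ← smul_eq_C_mul]
          exact sub_mem (Submodule.smul_mem _ _ (hgc i)) (Submodule.smul_mem _ _ (hgc' i))
        · rw [Function.update_of_ne hi]
          exact sub_mem (hgc i) (hgc' i)) (by
        rw [Finset.sum_insert ha, Function.update_self,
          Finset.sum_congr rfl fun i hi => by rw [hupd2 i hi]]
        convert h1 using 1
        have h3 : P c + ∑ i ∈ X, linForm (v i) ^ J i * g c i =
          P c' + ∑ i ∈ X, linForm (v i) ^ J i * g c' i := huc.symm.trans huc'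
        simp only [mul_sub, Finset.sum_sub_distrib]
        linear_combination h3) a (Finset.mem_insert_self _ _)
    rw [Function.update_self] at h2
    have h4 := (dvd_neg.1 h1).add (h2.mul_left (linForm (v a) ^ J a))
    convert h4 using 1
    ring
  obtain ⟨c₀, hc₀⟩ := hC.nonempty
  -- The common value is divisible by the form of v a - c • v j for every c in Γ, so it vanishes and
  -- u needs no multiple of the a-th power.
  have hP0 : P c₀ = 0 := by
    have hlin' : LinearIndependent K ![v a, v j] := by
      rw [LinearIndependent.pair_iff] at hlin ⊢
      intro x y hxy
      exact (hlin y x (by rw [add_comm]; exact hxy)).symm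
    refine eq_zero_of_forall_linForm_dvd hlin' (T := Neg.neg '' Γ)
      (hC.image neg_injective.injOn) ?_
    rintro _ ⟨c, hc, rfl⟩
    rw [hPeq c₀ hc₀ c hc, neg_smul, ← sub_eq_add_neg]
    exact (dvd_pow_self _ hJa).mul_right _
  obtain ⟨hgc, huc⟩ := hg c₀ hc₀
  refine mem_powerPiece.2 ⟨g c₀, hgc, ?_⟩
  have : P c₀ + ∑ i ∈ X, linForm (v i) ^ J i * g c₀ i = u := huc.symm
  rw [← this, hP0, zero_add]

/-- Independence transfers from one centre of projection to another one of smaller multiplicity. -/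
theorem indepMod_of_indepMod_update [Fintype ι] {y : Fin N → K} (hy : y ≠ 0) {j o : ι}
    (hjo : j ≠ o) (hJ : J o ≤ J j) (hyo : ¬ linForm y ∣ linForm (v o))
    (h : IndepMod (Function.update v j (v o)) J y (Finset.univ.erase o) (m - J o)) :
    IndepMod v J y (Finset.univ.erase j) (m - J j) := by
  obtain ⟨k, hk⟩ := Nat.exists_eq_add_of_le hJ
  intro g hg hd
  have hset : (Finset.univ.erase o).erase j = (Finset.univ.erase j).erase o :=
    Finset.erase_right_comm
  have hjmem : j ∈ Finset.univ.erase o := by simp [hjo]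
  have homem : o ∈ Finset.univ.erase j := by simp [hjo.symm]
  -- Multiply the relation by the k-th power of the form of v o, with k = J j - J o. The o-th term
  -- then carries the exponent J j and plays the part of the j-th power, whose vector has been
  -- replaced by v o.
  have key := h (Function.update (fun i => linForm (v o) ^ k * g i) j (g o)) (fun i => by
      by_cases hi : i = j
      · subst hi
        rw [Function.update_self]
        convert hg o using 1
        ring_nf
      · rw [Function.update_of_ne hi]
        have := mul_mem_forms (linForm_pow_mem_forms (v o) k) (hg i)
        convert this using 1
        rw [hk]; push_cast; ring_nf) (by
      convert hd.mul_left (linForm (v o) ^ k) using 1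
      rw [← Finset.add_sum_erase _ _ hjmem, ← Finset.add_sum_erase _ _ homem, mul_add,
        Finset.mul_sum, hset, Function.update_self, Function.update_self, hk]
      congr 1
      · ring
      · refine Finset.sum_congr rfl fun i hi => ?_
        have hij : i ≠ j := (Finset.mem_erase.1 (Finset.mem_of_mem_erase hi)).1
        rw [Function.update_of_ne hij, Function.update_of_ne hij]
        ring)
  intro i hi
  by_cases hio : i = o
  · have := key j hjmem
    rwa [Function.update_self, ← hio] at this
  · have hij : i ≠ j := (Finset.mem_erase.1 hi).1
    have := key i (by simp [hio])
    rw [Function.update_of_ne hij] at this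
    rcases (linForm_prime hy).dvd_or_dvd this with h1 | h1
    · exact absurd ((linForm_prime hy).dvd_of_dvd_pow h1) hyo
    · exact h1

end Excess

/-! ### Generic ranks of integral polynomial matrices. -/

section GenericRank

lemma exists_linearIndependent_rows {K ρ κ : Type*} [Field K] [Fintype ρ] [Fintype κ]
    (M : Matrix ρ κ K) {r : ℕ} (hr : M.rank = r) :
    ∃ a : Fin r → ρ, LinearIndependent K (M.submatrix a id).row := by
  subst hr
  rw [M.rank_eq_finrank_span_row]
  obtain ⟨f, hf, -, hli⟩ := Submodule.exists_fun_fin_finrank_span_eq K (Set.range M.row)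
  choose a ha using hf
  refine ⟨a, ?_⟩
  have : (M.submatrix a id).row = f := funext ha
  rw [this]
  exact hli

/-- A matrix over a field has a nonvanishing minor of the size of its rank. -/
lemma exists_minor_ne_zero {K ρ κ : Type*} [Field K] [Fintype ρ] [Fintype κ] (M : Matrix ρ κ K) :
    ∃ (a : Fin M.rank → ρ) (b : Fin M.rank → κ), (M.submatrix a b).det ≠ 0 := by
  obtain ⟨a, ha⟩ := exists_linearIndependent_rows M rfl
  obtain ⟨b, hb⟩ := exists_linearIndependent_rows (M.submatrix a id).transpose (r := M.rank) (by
    rw [Matrix.rank_transpose, ha.rank_matrix, Fintype.card_fin])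
  refine ⟨a, b, ?_⟩
  rw [Matrix.linearIndependent_rows_iff_isUnit, Matrix.isUnit_iff_isUnit_det, isUnit_iff_ne_zero,
    ← Matrix.det_transpose] at hb
  exact hb

lemma card_le_rank_of_aeval_det_ne_zero {L σ ρ κ : Type*} [Field L] [Fintype ρ] [Fintype κ] {r : ℕ}
    (M : Matrix ρ κ (MvPolynomial σ ℤ)) (a : Fin r → ρ) (b : Fin r → κ) (w : σ → L)
    (h : aeval w (M.submatrix a b).det ≠ 0) : r ≤ (M.map (aeval w)).rank := by
  have h1 : aeval w (M.submatrix a b).det = ((M.map (aeval w)).submatrix a b).det :=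
    AlgHom.map_det (aeval w) _
  have h2 := Matrix.rank_submatrix_le (M.map (aeval w)) a b
  rw [h1] at h
  rwa [Matrix.rank_of_det_ne_zero h, Fintype.card_fin] at h2

/-- D is a minor that is nonzero at a point over K of maximal rank. It is a polynomial over ℤ, so
where it does not vanish over ℚ the rank there is at least as large. -/
theorem exists_generic_rank (K : Type*) [Field K] [Infinite K] {σ ρ κ : Type*}
    [Fintype ρ] [Fintype κ] (M : Matrix ρ κ (MvPolynomial σ ℤ)) :
    ∃ (r : ℕ) (D : MvPolynomial σ ℤ), (∃ w : σ → K, aeval w D ≠ 0) ∧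
      (∀ w : σ → K, (M.map (aeval w)).rank ≤ r) ∧
      (∀ w : σ → K, aeval w D ≠ 0 → r ≤ (M.map (aeval w)).rank) ∧
      ∀ w : σ → ℚ, aeval w D ≠ 0 → r ≤ (M.map (aeval w)).rank := by
  classical
  have hfin : (Set.range fun w : σ → K => (M.map (aeval w)).rank).Finite :=
    (Set.finite_Iic (Fintype.card κ)).subset (by
      rintro _ ⟨w, rfl⟩
      exact Matrix.rank_le_card_width _)
  obtain ⟨_, ⟨w₀, rfl⟩, hmax⟩ := Set.exists_max_image _ id hfin (Set.range_nonempty _)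
  obtain ⟨a, b, hab⟩ := exists_minor_ne_zero (M.map (aeval w₀))
  have h1 : aeval w₀ (M.submatrix a b).det = ((M.map (aeval w₀)).submatrix a b).det :=
    AlgHom.map_det (aeval w₀) _
  exact ⟨_, (M.submatrix a b).det, ⟨w₀, by rwa [h1]⟩, fun w => hmax _ ⟨w, rfl⟩,
    fun w => card_le_rank_of_aeval_det_ne_zero M a b w,
    fun w => card_le_rank_of_aeval_det_ne_zero M a b w⟩

end GenericRank

/-! ### Generic properties of tuples of vectors. -/

section Generic
variable {K : Type*} [Field K] {ι : Type*} {N : ℕ}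

/-- A property holds for generic vectors, that is, outside of the zero set of a polynomial. -/
def Generically (P : (ι → Fin N → K) → Prop) : Prop :=
  ∃ f : MvPolynomial (ι × Fin N) K, f ≠ 0 ∧
    ∀ v : ι → Fin N → K, eval (fun ij => v ij.1 ij.2) f ≠ 0 → P v

lemma Generically.mono {P Q : (ι → Fin N → K) → Prop} (h : Generically P) (hPQ : ∀ v, P v → Q v) :
    Generically Q := by
  obtain ⟨f, hf, h⟩ := h
  exact ⟨f, hf, fun v hv => hPQ v (h v hv)⟩

lemma Generically.and {P Q : (ι → Fin N → K) → Prop} (hP : Generically P) (hQ : Generically Q) :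
    Generically fun v => P v ∧ Q v := by
  obtain ⟨f, hf, h⟩ := hP
  obtain ⟨f', hf', h'⟩ := hQ
  refine ⟨f * f', mul_ne_zero hf hf', fun v hv => ?_⟩
  rw [map_mul] at hv
  exact ⟨h v (left_ne_zero_of_mul hv), h' v (right_ne_zero_of_mul hv)⟩

lemma generically_of_forall {P : (ι → Fin N → K) → Prop} (h : ∀ v, P v) : Generically P :=
  ⟨1, one_ne_zero, fun v _ => h v⟩

lemma generically_forall {α : Type*} [Finite α] {P : α → (ι → Fin N → K) → Prop}
    (h : ∀ a, Generically (P a)) : Generically fun v => ∀ a, P a v := by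
  have := Fintype.ofFinite α
  choose f hf h using h
  refine ⟨∏ a, f a, Finset.prod_ne_zero_iff.2 fun a _ => hf a, fun v hv a => h a v ?_⟩
  rw [map_prod, Finset.prod_ne_zero_iff] at hv
  exact hv a (Finset.mem_univ a)

lemma Generically.exists [Infinite K] {P : (ι → Fin N → K) → Prop} (h : Generically P) :
    ∃ v, P v := by
  obtain ⟨f, hf, h⟩ := h
  obtain ⟨w, hw⟩ : ∃ w, eval w f ≠ 0 := by
    by_contra! h0
    exact hf (MvPolynomial.funext fun w => by rw [h0, map_zero])
  exact ⟨fun i j => w (i, j), h _ hw⟩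

lemma generically_coord_ne_zero (i : ι) (a : Fin N) :
    Generically fun v : ι → Fin N → K => v i a ≠ 0 :=
  ⟨X (i, a), X_ne_zero _, fun v hv => by simpa using hv⟩

lemma forGeneric_iff {d : ℕ} {P : (Fin d → ProjPoint K N) → Prop} :
    ForGeneric P ↔ Generically fun v : Fin d → Fin N → K =>
      ∀ hv : ∀ i, v i ≠ 0, P fun i => Projectivization.mk K (v i) (hv i) :=
  ⟨fun ⟨f, hf, h⟩ => ⟨f, hf, fun v hv hv' => h v hv' hv⟩,
    fun ⟨f, hf, h⟩ => ⟨f, hf, fun v hv hv' => h v hv' hv⟩⟩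

lemma fatPointsIdeal_mk {d : ℕ} (v : Fin d → Fin N → K) (hv : ∀ i, v i ≠ 0) (A : Fin d → ℤ) :
    fatPointsIdeal (fun i => Projectivization.mk K (v i) (hv i)) A =
      fatIdeal (fun i => Submodule.span K {v i}) A := by
  simp only [fatPointsIdeal, fatIdeal, Projectivization.submodule_mk]

end Generic

/-! ### The generic Hilbert function, and its comparison with characteristic zero. -/

section Conditions
variable {n d m : ℕ}

/-- The matrix of the linear conditions that multiple points impose on forms of degree `m`. -/
noncomputable def conditionMatrix {R : Type*} [CommRing R] (v : Fin d → Fin (n + 1) → R)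
    (A : Fin d → ℤ) (m : ℕ) : Matrix (Fin d × MonExp (n + 1) m) (MonExp (n + 1) m) R :=
  Matrix.of fun r α => if (m : ℤ) < r.2.1 0 + A r.1 then
    coeff r.2.1 (shear (v r.1) (monomial α.1 1)) else 0

lemma conditionMatrix_map {R S : Type*} [CommRing R] [CommRing S] (f : R →+* S)
    (v : Fin d → Fin (n + 1) → R) (A : Fin d → ℤ) (m : ℕ) :
    (conditionMatrix v A m).map f = conditionMatrix (fun i a => f (v i a)) A m := by
  ext r α
  simp only [conditionMatrix, Matrix.map_apply, Matrix.of_apply]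
  split_ifs
  · rw [← coeff_map, map_shear, map_monomial, map_one]
  · exact map_zero f

variable {K : Type*} [Field K]

lemma mem_linearIdeal_span_pow_iff {v : Fin (n + 1) → K} (hv : v 0 ≠ 0) {a : ℤ}
    {F : MvPolynomial (Fin (n + 1)) K} (hF : F.IsHomogeneous m) :
    F ∈ linearIdeal (Submodule.span K {v}) ^ a.toNat ↔
      ∀ β : MonExp (n + 1) m, (m : ℤ) < β.1 0 + a → coeff β.1 (shear v F) = 0 := by
  have h1 : F ∈ linearIdeal (Submodule.span K {v}) ^ a.toNat ↔
      shear v F ∈ linearIdeal (Submodule.span K {coordPoint K n}) ^ a.toNat := by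
    rw [← shearChange_map_span_self v hv, ← (shearChange v hv).map_linearIdeal, ← Ideal.map_pow,
      ← shearChange_σ v hv, (shearChange v hv).mem_map_iff]
  have hF' := shear_isHomogeneous v hF
  rw [h1, mem_linearIdeal_coordPoint_pow hF']
  constructor
  · rintro h ⟨β, hβ⟩ hlt
    rw [mem_finsuppAntidiag_univ] at hβ
    have hle : β 0 ≤ m := by
      rw [← hβ]; exact Finsupp.le_degree 0 β
    have := h (β 0) (by simp only at hlt; omega)
    change coeff β _ = 0
    rw [← Finsupp.cons_tail β, ← finSuccEquiv_coeff_coeff, this, coeff_zero]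
  · intro h b hb
    ext β
    rw [finSuccEquiv_coeff_coeff, coeff_zero]
    by_cases hβ : (β.cons b).degree = m
    · rcases le_or_gt a 0 with ha | ha
      · exact absurd (hβ ▸ Finsupp.le_degree 0 (β.cons b)) (by rw [Finsupp.cons_zero]; omega)
      · exact h ⟨_, mem_finsuppAntidiag_univ.2 hβ⟩ (by rw [Finsupp.cons_zero]; omega)
    · exact hF'.coeff_eq_zero hβ

/-- The Hilbert function of multiple points as the rank of a matrix. -/
lemma hilbertFunction_eq_rank (v : Fin d → Fin (n + 1) → K) (hv : ∀ i, v i 0 ≠ 0) (A : Fin d → ℤ)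
    (m : ℕ) : hilbertFunction (fatIdeal (fun i => Submodule.span K {v i}) A) m =
      (conditionMatrix v A m).rank := by
  classical
  set V := homogeneousSubmodule (Fin (n + 1)) K m with hV
  set I := fatIdeal (fun i => Submodule.span K {v i}) A with hI
  let Φ : V →ₗ[K] (Fin d × MonExp (n + 1) m → K) := LinearMap.pi fun r =>
    if (m : ℤ) < r.2.1 0 + A r.1 then
      (lcoeff K r.2.1) ∘ₗ (shear (v r.1)).toLinearMap ∘ₗ V.subtype else 0
  have hΦ : ∀ F r, Φ F r = if (m : ℤ) < r.2.1 0 + A r.1 then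
      coeff r.2.1 (shear (v r.1) F.1) else 0 := by
    intro F r
    simp only [Φ, LinearMap.pi_apply]
    split_ifs <;> rfl
  have hker : LinearMap.ker Φ = (gradedPiece I m).comap V.subtype := by
    ext F
    rw [LinearMap.mem_ker, Submodule.mem_comap, hI, Submodule.subtype_apply,
      mem_gradedPiece_fatIdeal, funext_iff, and_iff_right ((mem_homogeneousSubmodule _ _).1 F.2)]
    simp only [mem_linearIdeal_span_pow_iff (hv _) ((mem_homogeneousSubmodule _ _).1 F.2), hΦ, Pi.zero_apply, Prod.forall,
      ite_eq_right_iff]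
  have hmat : conditionMatrix v A m =
      LinearMap.toMatrix (formsBasis K (n + 1) m) (Pi.basisFun K _) Φ := by
    ext r α
    rw [LinearMap.toMatrix_apply, Pi.basisFun_repr, hΦ, formsBasis_apply]
    rfl
  have h1 := LinearMap.finrank_range_add_finrank_ker Φ
  rw [hmat, Matrix.rank_eq_finrank_range_toLin _ (Pi.basisFun K _) (formsBasis K (n + 1) m),
    Matrix.toLin_toMatrix, hilbertFunction]
  rw [hker, (Submodule.comapSubtypeEquivOfLe (gradedPiece_le _ m)).finrank_eq] at h1
  change Module.finrank K V - _ = _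
  omega

/-- Over an infinite field two generic sets meet, so the supremum is taken over a singleton. -/
lemma hpts_eq [Infinite K] {N r : ℕ} {A : Fin d → ℤ}
    (h : ForGeneric fun p : Fin d → ProjPoint K (N + 1) => hilbertFunction (fatPointsIdeal p A) m = r) :
    HPTS K d A (N + 1) m = r := by
  have : {h | ForGeneric fun p : Fin d → ProjPoint K (N + 1) =>
      hilbertFunction (fatPointsIdeal p A) m = h} = {r} := by
    ext r'
    rw [Set.mem_ofPred_eq, Set.mem_singleton_iff]
    refine ⟨fun h' => ?_, fun e => e ▸ h⟩
    rw [forGeneric_iff] at h h'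
    obtain ⟨v, ⟨h1, h2⟩, h3⟩ := ((h.and h').and
      (generically_forall fun i => generically_coord_ne_zero i 0)).exists
    have hv : ∀ i, v i ≠ 0 := fun i h0 => h3 i (by rw [h0]; rfl)
    rw [← h1 hv, ← h2 hv]
  rw [HPTS, this, csSup_singleton]

lemma conditionMatrix_map_aeval (v : Fin d → Fin (n + 1) → K) (A : Fin d → ℤ) (m : ℕ) :
    (conditionMatrix (fun (i : Fin d) (a : Fin (n + 1)) => (X (i, a) : MvPolynomial _ ℤ)) A m).map
      (aeval fun ij => v ij.1 ij.2) = conditionMatrix v A m := by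
  have := conditionMatrix_map (aeval fun ij => v ij.1 ij.2 :
    MvPolynomial (Fin d × Fin (n + 1)) ℤ →ₐ[ℤ] K).toRingHom (fun i a => X (i, a)) A m
  simpa using this

/-- The Hilbert function of generic multiple points over `K` is at most the one over `ℚ`. -/
lemma exists_generic_hilbertFunction (K : Type*) [Field K] [Infinite K] (A : Fin d → ℤ) (n m : ℕ) :
    ∃ r, (Generically fun v : Fin d → Fin (n + 1) → K =>
        hilbertFunction (fatIdeal (fun i => Submodule.span K {v i}) A) m = r) ∧
      Generically fun v : Fin d → Fin (n + 1) → ℚ =>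
        r ≤ hilbertFunction (fatIdeal (fun i => Submodule.span ℚ {v i}) A) m := by
  obtain ⟨r, D, ⟨w₀, hw₀⟩, hle, hge, hQ⟩ := exists_generic_rank K
    (conditionMatrix (fun (i : Fin d) (a : Fin (n + 1)) => (X (i, a) : MvPolynomial _ ℤ)) A m)
  have hmap : ∀ (w : Fin d × Fin (n + 1) → K), eval w (map (Int.castRingHom K) D) = aeval w D :=
    fun w => by rw [eval_map, aeval_def]; rfl
  have hmapQ : ∀ (w : Fin d × Fin (n + 1) → ℚ), eval w (map (Int.castRingHom ℚ) D) = aeval w D :=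
    fun w => by rw [eval_map, aeval_def]; rfl
  have hD : map (Int.castRingHom K) D ≠ 0 := fun h0 => hw₀ (by rw [← hmap, h0, map_zero])
  have hDQ : map (Int.castRingHom ℚ) D ≠ 0 := fun h0 => by
    rw [map_eq_zero_iff _ (map_injective _ Int.cast_injective)] at h0
    exact hw₀ (by rw [h0, map_zero])
  refine ⟨r, ((generically_forall fun i => generically_coord_ne_zero i 0).and
      ⟨_, hD, fun v hv => hv⟩).mono ?_, ((generically_forall fun i =>
      generically_coord_ne_zero i 0).and ⟨_, hDQ, fun v hv => hv⟩).mono ?_⟩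
  · rintro v ⟨h1, h2⟩
    rw [hilbertFunction_eq_rank v h1, ← conditionMatrix_map_aeval]
    rw [hmap] at h2
    exact le_antisymm (hle _) (hge _ h2)
  · rintro v ⟨h1, h2⟩
    rw [hilbertFunction_eq_rank v h1, ← conditionMatrix_map_aeval]
    rw [hmapQ] at h2
    exact hQ _ h2

/-- `HPTS` is the value of the Hilbert function at generic points. -/
lemma generically_hilbertFunction_eq [Infinite K] (A : Fin d → ℤ) :
    Generically fun v : Fin d → Fin (n + 1) → K =>
      hilbertFunction (fatIdeal (fun i => Submodule.span K {v i}) A) m = HPTS K d A (n + 1) m := by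
  obtain ⟨r, h, -⟩ := exists_generic_hilbertFunction K A n m
  rwa [hpts_eq (r := r) (forGeneric_iff.2 (h.mono fun v hv hv' => by rw [fatPointsIdeal_mk, hv]))]

lemma hpts_le_hpts_rat [Infinite K] (A : Fin d → ℤ) :
    HPTS K d A (n + 1) m ≤ HPTS ℚ d A (n + 1) m := by
  obtain ⟨r, h, h'⟩ := exists_generic_hilbertFunction K A n m
  rw [hpts_eq (r := r) (forGeneric_iff.2 (h.mono fun v hv hv' => by rw [fatPointsIdeal_mk, hv]))]
  obtain ⟨v, h1, h2⟩ := (h'.and (generically_hilbertFunction_eq (K := ℚ) A)).exists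
  exact h1.trans h2.le

end Conditions

/-! ### Ideals of linear subspaces. -/

section HomogeneousIdeals
variable {K : Type*} [Field K] {N : ℕ}

lemma homogeneousComponent_mem_linearIdeal_pow {W : Submodule K (Fin N → K)} {a : ℕ}
    {F : MvPolynomial (Fin N) K} (hF : F ∈ linearIdeal W ^ a) (b : ℕ) :
    homogeneousComponent b F ∈ linearIdeal W ^ a := by
  let _ : GradedAlgebra (homogeneousSubmodule (Fin N) K) := gradedAlgebra
  have h1 : (linearIdeal W).IsHomogeneous (homogeneousSubmodule (Fin N) K) :=
    Ideal.homogeneous_span _ _ fun F hF => ⟨1, hF.1⟩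
  have h2 : (linearIdeal W ^ a).IsHomogeneous (homogeneousSubmodule (Fin N) K) := by
    clear hF
    induction a with
    | zero => rw [pow_zero, Ideal.one_eq_top]; exact fun _ _ _ => trivial
    | succ a ih => rw [pow_succ]; exact ih.mul h1
  have h3 := h2 b hF
  rwa [show (DirectSum.decompose (homogeneousSubmodule (Fin N) K) F b : MvPolynomial (Fin N) K) =
    homogeneousComponent b F from decomposition.decompose'_apply F b] at h3

/-- Substituting a linear projection onto W changes F only by an element of the ideal, and turns F
into a polynomial that vanishes everywhere, hence is zero over an infinite field. -/
lemma mem_linearIdeal_of_eval_eq_zero [Infinite K] (W : Submodule K (Fin N → K))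
    {F : MvPolynomial (Fin N) K} (h : ∀ w ∈ W, eval w F = 0) : F ∈ linearIdeal W := by
  obtain ⟨π, hπ⟩ := W.subtype.exists_leftInverse_of_injective W.ker_subtype
  let e : Fin N → Fin N → K := fun i j => (π (Pi.single j 1) : Fin N → K) i
  have he : ∀ (x : Fin N → K) i, ∑ j, e i j * x j = (π x : Fin N → K) i := by
    intro x i
    conv_rhs => rw [← Finset.univ_sum_single x, map_sum, Submodule.coe_sum, Finset.sum_apply]
    refine Finset.sum_congr rfl fun j _ => ?_
    rw [show Pi.single j (x j) = x j • (Pi.single j 1 : Fin N → K) by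
      rw [← Pi.single_smul, smul_eq_mul, mul_one], map_smul]
    simp [e, mul_comm]
  let φ : MvPolynomial (Fin N) K →ₐ[K] MvPolynomial (Fin N) K := aeval fun i => linForm (e i)
  have hφ : φ F = 0 := by
    refine MvPolynomial.funext fun x => ?_
    have h1 : ∀ G, eval x (φ G) = eval (π x : Fin N → K) G := by
      intro G
      induction G using MvPolynomial.induction_on with
      | C a => simp
      | add p q hp hq => simp [hp, hq]
      | mul_X p i hp =>
        rw [map_mul, map_mul, hp, map_mul, eval_X, ← he, ← eval_linForm]
        simp [φ]
    rw [h1, map_zero]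
    exact h _ (π x).2
  have hmod : ∀ G, G - φ G ∈ linearIdeal W := by
    intro G
    induction G using MvPolynomial.induction_on with
    | C a => simp [φ]
    | add p q hp hq =>
      rw [map_add, add_sub_add_comm]
      exact add_mem hp hq
    | mul_X p i hp =>
      have hX : X i - φ (X i) ∈ linearIdeal W := by
        refine Ideal.subset_span ⟨?_, fun w hw => ?_⟩
        · rw [show φ (X i) = linForm (e i) by simp [φ]]
          exact (isHomogeneous_X _ _).sub (linForm_isHomogeneous _)
        · rw [show φ (X i) = linForm (e i) by simp [φ], map_sub, eval_X, eval_linForm, he]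
          have := LinearMap.congr_fun hπ ⟨w, hw⟩
          simp only [LinearMap.comp_apply, Submodule.subtype_apply, LinearMap.id_apply] at this
          rw [this, sub_self]
      rw [map_mul, show p * X i - φ p * φ (X i) = (p - φ p) * X i + φ p * (X i - φ (X i)) by ring]
      exact add_mem (Ideal.mul_mem_right _ _ hp) (Ideal.mul_mem_left _ _ hX)
  have := hmod F
  rwa [hφ, sub_zero] at this

end HomogeneousIdeals

/-! ### Forms that are homogeneous in the first variable. -/

section ConeForms
variable {K : Type*} [Field K] {n : ℕ}

/-- The form `x₀ ^ b * f`, where `f` is a form in the other variables. -/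
noncomputable def coneForm (b : ℕ) (f : MvPolynomial (Fin n) K) : MvPolynomial (Fin (n + 1)) K :=
  X 0 ^ b * rename Fin.succ f

lemma finSuccEquiv_coneForm (b : ℕ) (f : MvPolynomial (Fin n) K) :
    finSuccEquiv K n (coneForm b f) = Polynomial.C f * Polynomial.X ^ b := by
  have : finSuccEquiv K n (rename Fin.succ f) = Polynomial.C f := by
    induction f using MvPolynomial.induction_on with
    | C a => simp [finSuccEquiv_apply]
    | add p q hp hq => simp only [map_add, hp, hq]
    | mul_X p i hp => rw [map_mul, map_mul, hp, rename_X, finSuccEquiv_X_succ, map_mul]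
  rw [coneForm, map_mul, map_pow, finSuccEquiv_X_zero, this, mul_comm]

lemma coeff_finSuccEquiv_coneForm (b c : ℕ) (f : MvPolynomial (Fin n) K) :
    (finSuccEquiv K n (coneForm b f)).coeff c = if c = b then f else 0 := by
  rw [finSuccEquiv_coneForm, Polynomial.coeff_C_mul_X_pow]

lemma coneForm_isHomogeneous {a : ℕ} (b : ℕ) {f : MvPolynomial (Fin n) K} (hf : f.IsHomogeneous a) :
    (coneForm b f).IsHomogeneous (b + a) := by
  have := ((isHomogeneous_X K (0 : Fin (n + 1))).pow b).mul (hf.rename_isHomogeneous (f := Fin.succ))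
  rwa [one_mul] at this

/-- Pairing with a cone form only involves one coefficient. -/
lemma apolar_coneForm (b : ℕ) (F : MvPolynomial (Fin (n + 1)) K) (h : MvPolynomial (Fin n) K) :
    apolar K (n + 1) F (coneForm b h) =
      (b.factorial : K) * apolar K n ((finSuccEquiv K n F).coeff b) h := by
  rw [apolar_comm, apolar_comm _ h]
  induction h using MvPolynomial.induction_on' with
  | monomial β c =>
    have : coneForm b (monomial β c) = monomial (β.cons b) c := by
      apply (finSuccEquiv K n).injective
      rw [finSuccEquiv_coneForm]
      ext i γ
      rw [Polynomial.coeff_C_mul_X_pow, finSuccEquiv_coeff_coeff]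
      classical
      rw [coeff_monomial]
      split_ifs with h1 h2 h2
      · rw [coeff_monomial, if_pos]
        subst h1
        rw [← Finsupp.tail_cons i β, h2, Finsupp.tail_cons]
      · rw [coeff_monomial, if_neg]
        rintro rfl; exact h2 (by rw [h1])
      · exact absurd (by rw [← Finsupp.cons_zero i γ, ← h2, Finsupp.cons_zero]) h1
      · rfl
    rw [this, apolar_monomial, apolar_monomial, finSuccEquiv_coeff_coeff, Fin.prod_univ_succ]
    simp only [Finsupp.cons_zero, Finsupp.cons_succ]
    push_cast
    ring
  | add p q hp hq =>
    rw [show coneForm b (p + q) = coneForm b p + coneForm b q by simp [coneForm, mul_add],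
      map_add, LinearMap.add_apply, hp, hq, map_add, LinearMap.add_apply, mul_add]

end ConeForms

/-! ### Schemes between two successive neighbourhoods of the coordinate point. -/

section LeadingCoefficients
variable {K : Type*} [Field K] {n : ℕ}

/-- The coefficient of a power of the first variable. -/
noncomputable def coeffMap (K : Type*) [Field K] (n b : ℕ) :
    MvPolynomial (Fin (n + 1)) K →ₗ[K] MvPolynomial (Fin n) K :=
  (Polynomial.lcoeff (MvPolynomial (Fin n) K) b).restrictScalars K ∘ₗ (finSuccEquiv K n).toLinearMap

lemma coeffMap_apply (b : ℕ) (F : MvPolynomial (Fin (n + 1)) K) :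
    coeffMap K n b F = (finSuccEquiv K n F).coeff b := rfl

lemma coeffMap_coneForm (b : ℕ) (f : MvPolynomial (Fin n) K) :
    coeffMap K n b (coneForm b f) = f := by
  rw [coeffMap_apply, coeff_finSuccEquiv_coneForm, if_pos rfl]

lemma coeffMap_isHomogeneous {t a : ℕ} {F : MvPolynomial (Fin (n + 1)) K} (hF : F.IsHomogeneous t)
    (hat : a ≤ t) : (coeffMap K n (t - a) F).IsHomogeneous a :=
  hF.finSuccEquiv_coeff_isHomogeneous _ _ (by omega)

lemma homogeneousComponent_coeffMap_of_mem {a : ℕ} {F : MvPolynomial (Fin (n + 1)) K}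
    (hF : F ∈ linearIdeal (Submodule.span K {coordPoint K n}) ^ (a + 1)) (b : ℕ) :
    homogeneousComponent a (coeffMap K n b F) = 0 := by
  rw [← comap_tailMap_bot, mem_linearIdeal_comap_tailMap_pow, linearIdeal_bot] at hF
  have := hF b
  rw [mem_pow_idealOfVars_iff'] at this
  classical
  ext β
  rw [coeff_homogeneousComponent, coeff_zero]
  split_ifs with h
  · exact this β (by omega)
  · rfl

lemma coneForm_mem_coordPoint_pow {a : ℕ} (b : ℕ) {f : MvPolynomial (Fin n) K}
    (hf : f.IsHomogeneous a) :
    coneForm b f ∈ linearIdeal (Submodule.span K {coordPoint K n}) ^ a := by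
  rw [mem_linearIdeal_coordPoint_pow (coneForm_isHomogeneous b hf)]
  intro c hc
  rw [coeff_finSuccEquiv_coneForm, if_neg (by omega)]

lemma coneForm_mem_comap_pow {W : Submodule K (Fin n → K)} {e : ℕ} (b : ℕ)
    {f : MvPolynomial (Fin n) K} (hf : f ∈ linearIdeal W ^ e) :
    coneForm b f ∈ linearIdeal (W.comap (tailMap K n)) ^ e := by
  rw [mem_linearIdeal_comap_tailMap_pow]
  intro c
  rw [coeff_finSuccEquiv_coneForm]
  split_ifs
  · exact hf
  · exact zero_mem _

/-- A form of degree t vanishing to order a at the coordinate point is determined, modulo order a +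
1, by its leading coefficient, the coefficient of x₀^(t-a). This is its term in the tangent cone. -/
lemma sub_coneForm_mem {t a : ℕ} {F : MvPolynomial (Fin (n + 1)) K} (hF : F.IsHomogeneous t)
    (hFa : F ∈ linearIdeal (Submodule.span K {coordPoint K n}) ^ a) (hat : a ≤ t) :
    F - coneForm (t - a) (coeffMap K n (t - a) F) ∈
      linearIdeal (Submodule.span K {coordPoint K n}) ^ (a + 1) := by
  have h1 := coneForm_isHomogeneous (t - a) (coeffMap_isHomogeneous hF hat)
  rw [Nat.sub_add_cancel hat] at h1
  rw [mem_linearIdeal_coordPoint_pow hF] at hFa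
  rw [mem_linearIdeal_coordPoint_pow (hF.sub h1)]
  intro b hb
  rw [map_sub, Polynomial.coeff_sub, coeff_finSuccEquiv_coneForm]
  split_ifs with h
  · rw [h, coeffMap_apply, sub_self]
  · rw [hFa b (by omega), sub_zero]

lemma mem_cone_sup_iff {α : Type*} {W : α → Submodule K (Fin n → K)} {e : α → ℕ} {t a : ℕ}
    {F : MvPolynomial (Fin (n + 1)) K} (hF : F.IsHomogeneous t) (hat : a ≤ t) :
    F ∈ (linearIdeal (Submodule.span K {coordPoint K n}) ^ a ⊓
        ⨅ τ, linearIdeal ((W τ).comap (tailMap K n)) ^ e τ) ⊔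
        linearIdeal (Submodule.span K {coordPoint K n}) ^ (a + 1) ↔
      F ∈ linearIdeal (Submodule.span K {coordPoint K n}) ^ a ∧
        ∀ τ, coeffMap K n (t - a) F ∈ linearIdeal (W τ) ^ e τ := by
  have hc := coeffMap_isHomogeneous hF hat
  constructor
  · intro h
    obtain ⟨G, hG, H, hH, rfl⟩ := Submodule.mem_sup.1 h
    refine ⟨add_mem hG.1 (Ideal.pow_le_pow_right (Nat.le_succ a) hH), fun τ => ?_⟩
    rw [← homogeneousComponent_eq_self hc, map_add, map_add,
      homogeneousComponent_coeffMap_of_mem hH, add_zero]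
    refine homogeneousComponent_mem_linearIdeal_pow ?_ _
    exact mem_linearIdeal_comap_tailMap_pow.1 (Ideal.mem_iInf.1 hG.2 τ) _
  · rintro ⟨h1, h2⟩
    refine Submodule.mem_sup.2 ⟨coneForm (t - a) (coeffMap K n (t - a) F),
      ⟨coneForm_mem_coordPoint_pow _ hc, Ideal.mem_iInf.2 fun τ => coneForm_mem_comap_pow _ (h2 τ)⟩,
      _, sub_coneForm_mem hF h1 hat, by ring⟩

/-- Modulo order a + 1, multiplying an element of L up to degree t keeps only a constant times a
power of x₀, so no new leading coefficients arise beyond those of L. -/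
lemma mem_span_sup_iff {L : Submodule K (MvPolynomial (Fin (n + 1)) K)} {m a t : ℕ}
    (hL : ∀ F ∈ L, F.IsHomogeneous m ∧ F ∈ linearIdeal (Submodule.span K {coordPoint K n}) ^ a)
    {F : MvPolynomial (Fin (n + 1)) K} (hF : F.IsHomogeneous t) (ham : a ≤ m) (hmt : m ≤ t) :
    F ∈ Ideal.span (L : Set (MvPolynomial (Fin (n + 1)) K)) ⊔
        linearIdeal (Submodule.span K {coordPoint K n}) ^ (a + 1) ↔
      F ∈ linearIdeal (Submodule.span K {coordPoint K n}) ^ a ∧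
        coeffMap K n (t - a) F ∈ L.map (coeffMap K n (m - a)) := by
  have hat : a ≤ t := ham.trans hmt
  have hc := coeffMap_isHomogeneous hF hat
  constructor
  · intro h
    obtain ⟨G, hG, H, hH, rfl⟩ := Submodule.mem_sup.1 h
    have hGa : G ∈ linearIdeal (Submodule.span K {coordPoint K n}) ^ a :=
      (Ideal.span_le.2 fun F hF => (hL F hF).2) hG
    refine ⟨add_mem hGa (Ideal.pow_le_pow_right (Nat.le_succ a) hH), ?_⟩
    rw [← homogeneousComponent_eq_self hc, map_add, map_add,
      homogeneousComponent_coeffMap_of_mem hH, add_zero]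
    suffices ∀ c, homogeneousComponent a (coeffMap K n (t - a) (c * G)) ∈
        L.map (coeffMap K n (m - a)) by simpa using this 1
    refine Submodule.span_induction (p := fun G _ => ∀ c, homogeneousComponent a
      (coeffMap K n (t - a) (c * G)) ∈ L.map (coeffMap K n (m - a))) ?_ ?_ ?_ ?_ hG
    · intro G hG c
      obtain ⟨h1, h2⟩ := hL G hG
      rw [mem_linearIdeal_coordPoint_pow h1] at h2
      have h3 : homogeneousComponent a (coeffMap K n (t - a) (c * G)) =
          coeff 0 (coeffMap K n (t - m) c) • coeffMap K n (m - a) G := by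
        rw [coeffMap_apply, map_mul, Polynomial.coeff_mul, map_sum,
          Finset.sum_eq_single (t - m, m - a)]
        · have h4 : ((finSuccEquiv K n) G).coeff (m - a) ∈ homogeneousSubmodule (Fin n) K a :=
            coeffMap_isHomogeneous h1 ham
          have h5 := homogeneousComponent_mul_of_isHomogeneous h4 0
            (q := ((finSuccEquiv K n) c).coeff (t - m))
          rw [add_zero, homogeneousComponent_zero] at h5
          rw [mul_comm, h5, smul_eq_C_mul, mul_comm]
          rfl
        · rintro ⟨b, b'⟩ hb hne
          rw [Finset.HasAntidiagonal.mem_antidiagonal] at hb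
          dsimp only at hb ⊢
          rcases lt_or_ge m (b' + a) with hlt | hge
          · rw [h2 b' hlt, mul_zero, map_zero]
          · have hb' : b' < m - a := by
              rcases lt_or_eq_of_le (show b' ≤ m - a by omega) with h | h
              · exact h
              · exact absurd (Prod.ext (by dsimp only; omega) h) hne
            have h4 : (((finSuccEquiv K n) G).coeff b').IsHomogeneous (m - b') :=
              h1.finSuccEquiv_coeff_isHomogeneous _ _ (by omega)
            have h6 : (((finSuccEquiv K n) c).coeff b) * ((finSuccEquiv K n) G).coeff b' ∈
                idealOfVars (Fin n) K ^ (a + 1) := by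
              refine Ideal.mul_mem_left _ _ ?_
              rw [mem_idealOfVars_pow_iff_of_isHomogeneous h4]
              intro h; omega
            rw [mem_pow_idealOfVars_iff'] at h6
            classical
            ext β
            rw [coeff_homogeneousComponent, coeff_zero]
            split_ifs with h
            · exact h6 β (by omega)
            · rfl
        · intro h
          exact absurd (Finset.HasAntidiagonal.mem_antidiagonal.2 (by omega)) h
      rw [h3]
      exact Submodule.smul_mem _ _ ⟨G, hG, rfl⟩
    · intro c; rw [mul_zero, map_zero, map_zero]; exact zero_mem _
    · intro x y _ _ hx hy c
      rw [mul_add, map_add, map_add]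
      exact add_mem (hx c) (hy c)
    · intro r x _ hx c
      rw [smul_eq_mul, ← mul_assoc]
      exact hx _
  · rintro ⟨h1, G, hG, h2⟩
    obtain ⟨hG1, hG2⟩ := hL G hG
    -- Multiplying G by x₀^(t-m) gives degree t and the leading coefficient of F.
    have h3 : X 0 ^ (t - m) * G - coneForm (t - a) (coeffMap K n (t - a) F) ∈
        linearIdeal (Submodule.span K {coordPoint K n}) ^ (a + 1) := by
      have h4 := Ideal.mul_mem_left _ (X 0 ^ (t - m)) (sub_coneForm_mem hG1 hG2 ham)
      rwa [mul_sub, h2, coneForm, ← mul_assoc, ← pow_add, show t - m + (m - a) = t - a by omega] at h4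
    refine Submodule.mem_sup.2 ⟨X 0 ^ (t - m) * G,
      Ideal.mul_mem_left _ _ (Ideal.subset_span hG), _,
      sub_mem (sub_coneForm_mem hF h1 hat) h3, by ring⟩

/-- Two schemes supported in an infinitesimal neighbourhood of the first coordinate point agree if
they agree in the tangent cone. -/
theorem sameSubscheme_iff_map_coeffMap_eq {L : Submodule K (MvPolynomial (Fin (n + 1)) K)} {m a : ℕ}
    (hL : ∀ F ∈ L, F.IsHomogeneous m ∧ F ∈ linearIdeal (Submodule.span K {coordPoint K n}) ^ a)
    (ham : a ≤ m) {α : Type*} {W : α → Submodule K (Fin n → K)} {e : α → ℕ} :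
    SameSubscheme
      (Ideal.span (L : Set (MvPolynomial (Fin (n + 1)) K)) ⊔
        linearIdeal (Submodule.span K {coordPoint K n}) ^ (a + 1))
      ((linearIdeal (Submodule.span K {coordPoint K n}) ^ a ⊓
        ⨅ τ, linearIdeal ((W τ).comap (tailMap K n)) ^ e τ) ⊔
        linearIdeal (Submodule.span K {coordPoint K n}) ^ (a + 1)) ↔
      L.map (coeffMap K n (m - a)) = gradedPiece (⨅ τ, linearIdeal (W τ) ^ e τ) a := by
  have key : ∀ t, m ≤ t → ∀ F : MvPolynomial (Fin (n + 1)) K, _ := fun t hmt F =>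
    And.intro (fun hF : F.IsHomogeneous t => mem_span_sup_iff hL hF ham hmt)
      (fun hF : F.IsHomogeneous t => mem_cone_sup_iff (W := W) (e := e) hF (ham.trans hmt))
  have hmem : ∀ f : MvPolynomial (Fin n) K, f ∈ gradedPiece (⨅ τ, linearIdeal (W τ) ^ e τ) a ↔
      (∀ τ, f ∈ linearIdeal (W τ) ^ e τ) ∧ f.IsHomogeneous a := by
    intro f
    simp [gradedPiece]
  have hV : ∀ f ∈ L.map (coeffMap K n (m - a)), f.IsHomogeneous a := by
    rintro _ ⟨F, hF, rfl⟩
    exact coeffMap_isHomogeneous (hL F hF).1 ham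
  constructor
  · rintro ⟨t₀, h⟩
    set t := max t₀ m with ht
    have hmt : m ≤ t := le_max_right _ _
    have h := h t (le_max_left _ _)
    -- Testing the two ideals on x₀^(t-a) * f in a single large degree t already decides the
    -- question for f.
    have h2 : ∀ f : MvPolynomial (Fin n) K, f.IsHomogeneous a →
        (f ∈ L.map (coeffMap K n (m - a)) ↔ ∀ τ, f ∈ linearIdeal (W τ) ^ e τ) := by
      intro f hf
      have h3 := coneForm_isHomogeneous (t - a) hf
      rw [Nat.sub_add_cancel (ham.trans hmt)] at h3
      have h4 := coneForm_mem_coordPoint_pow (t - a) hf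
      have h5 := SetLike.ext_iff.1 h (coneForm (t - a) f)
      simp only [gradedPiece, Submodule.mem_inf, Submodule.restrictScalars_mem,
        mem_homogeneousSubmodule, and_iff_left h3, (key t hmt _).1 h3, (key t hmt _).2 h3,
        and_iff_right h4, coeffMap_coneForm] at h5
      exact h5
    ext f
    rw [hmem]
    constructor
    · intro hf
      exact ⟨(h2 f (hV f hf)).1 hf, hV f hf⟩
    · rintro ⟨hf1, hf2⟩
      exact (h2 f hf2).2 hf1
  · intro h
    refine ⟨m, fun t hmt => ?_⟩
    ext F
    simp only [gradedPiece, Submodule.mem_inf, Submodule.restrictScalars_mem,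
      mem_homogeneousSubmodule]
    refine and_congr_left fun hF => ?_
    rw [(key t hmt F).1 hF, (key t hmt F).2 hF, h, hmem,
      and_iff_left (coeffMap_isHomogeneous hF (ham.trans hmt))]

lemma finrank_map_coeffMap {L : Submodule K (MvPolynomial (Fin (n + 1)) K)} [Module.Finite K L]
    (b : ℕ) : Module.finrank K (L.map (coeffMap K n b)) +
      Module.finrank K (L ⊓ LinearMap.ker (coeffMap K n b) : Submodule K _) =
        Module.finrank K L := by
  have h := LinearMap.finrank_range_add_finrank_ker ((coeffMap K n b).domRestrict L)
  rw [LinearMap.range_domRestrict] at h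
  rw [← h]
  congr 1
  rw [LinearMap.ker_domRestrict, ← Submodule.finrank_map_subtype_eq, Submodule.map_comap_subtype]

end LeadingCoefficients

/-! ### Vanishing on linear spans, and leading coefficients under projection. -/

section Pigeonhole

/-- In every monomial of degree at least 1 + ∑ (J i - 1), some x i has exponent at least J i. -/
lemma Ideal.sum_pow_mem_of_pow_mem {R ι : Type*} [CommRing R] (I : Ideal R) (T : Finset ι)
    (x : ι → R) (J : ι → ℕ) (hJ : ∀ i ∈ T, 1 ≤ J i) (hx : ∀ i ∈ T, x i ^ J i ∈ I) {e : ℕ}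
    (he : 1 + ∑ i ∈ T, (J i - 1) ≤ e) : (∑ i ∈ T, x i) ^ e ∈ I := by
  classical
  refine I.pow_mem_of_pow_mem ?_ he
  clear he e
  induction T using Finset.induction_on with
  | empty => simp
  | insert j T hj ih =>
    rw [Finset.sum_insert hj, Finset.sum_insert hj]
    have h1 := hJ j (Finset.mem_insert_self _ _)
    refine I.add_pow_mem_of_pow_mem_of_le (hx j (Finset.mem_insert_self _ _))
      (ih (fun i hi => hJ i (Finset.mem_insert_of_mem hi))
        fun i hi => hx i (Finset.mem_insert_of_mem hi)) (by omega)

variable {K : Type*} [Field K] {n : ℕ} {ι : Type*}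

/-- The ideal of the polynomials all of whose multiples are orthogonal to `F`. -/
noncomputable def annIdeal {N : ℕ} (F : MvPolynomial (Fin N) K) : Ideal (MvPolynomial (Fin N) K) where
  carrier := {G | ∀ H, apolar K N F (G * H) = 0}
  add_mem' h h' H := by rw [add_mul, map_add, h, h', add_zero]
  zero_mem' H := by rw [zero_mul, map_zero]
  smul_mem' c G h H := by rw [smul_eq_mul, mul_comm c, mul_assoc]; exact h _

lemma linForm_pow_mem_annIdeal {m J : ℕ} (hm : (m.factorial : K) ≠ 0) (hJ : J ≤ m + 1)
    {v : Fin (n + 1) → K} (hv : v 0 ≠ 0) {F : MvPolynomial (Fin (n + 1)) K}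
    (hF : F.IsHomogeneous m) (h : F ∈ linearIdeal (Submodule.span K {v}) ^ (m + 1 - J)) :
    linForm v ^ J ∈ annIdeal F := by
  intro H
  rw [mem_linearIdeal_pow_iff_dirDeriv hm hJ hv hF] at h
  rw [apolar_linForm_pow_mul, h, map_zero, LinearMap.zero_apply]

/-- A form that vanishes to high order at points vanishes on their linear span. -/
lemma mem_linearIdeal_iSup_span [Infinite K] {a : ℕ} (ha : (a.factorial : K) ≠ 0) {T : Finset ι}
    {q : ι → Fin (n + 1) → K} (hq : ∀ i ∈ T, q i 0 ≠ 0) {J : ι → ℕ} (hJ : ∀ i ∈ T, 1 ≤ J i)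
    (hle : 1 + ∑ i ∈ T, (J i - 1) ≤ a) {f : MvPolynomial (Fin (n + 1)) K} (hf : f.IsHomogeneous a)
    (h : ∀ i ∈ T, f ∈ linearIdeal (Submodule.span K {q i}) ^ (a + 1 - J i)) :
    f ∈ linearIdeal (⨆ i ∈ T, Submodule.span K {q i}) := by
  refine mem_linearIdeal_of_eval_eq_zero _ fun w hw => ?_
  obtain ⟨c, rfl⟩ : ∃ c : ι → K, ∑ i ∈ T, c i • q i = w := by
    classical
    obtain ⟨μ, rfl⟩ := (Submodule.mem_iSup_finset_iff_exists_sum _ _).1 hw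
    choose c hc using fun i => Submodule.mem_span_singleton.1 (μ i).2
    exact ⟨c, Finset.sum_congr rfl fun i _ => hc i⟩
  have h1 : linForm (∑ i ∈ T, c i • q i) = ∑ i ∈ T, C (c i) * linForm (q i) := by
    classical
    clear hq hJ hle h hw
    induction T using Finset.induction_on with
    | empty => simp [linForm]
    | insert j T hj ih => rw [Finset.sum_insert hj, Finset.sum_insert hj, linForm_add, linForm_smul, ih]
  -- Pairing f with this power is a! times the value of f at the point of the span, while the powers
  -- that make up its expansion annihilate f.
  have h2 : linForm (∑ i ∈ T, c i • q i) ^ a ∈ annIdeal f := by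
    rw [h1]
    refine Ideal.sum_pow_mem_of_pow_mem _ T _ J hJ (fun i hi => ?_) hle
    have h3 : J i - 1 ≤ ∑ i ∈ T, (J i - 1) :=
      Finset.single_le_sum (f := fun i => J i - 1) (fun _ _ => Nat.zero_le _) hi
    rw [mul_pow]
    exact Ideal.mul_mem_left _ _ (linForm_pow_mem_annIdeal ha (by omega) (hq i hi) hf (h i hi))
  have h4 := h2 1
  rw [mul_one, apolar_linForm_pow _ _ hf] at h4
  exact (mul_eq_zero.1 h4).resolve_left ha

/-- The leading coefficient of a form with a multiple point at the first coordinate point inherits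
the multiple points from the projection from this point. -/
lemma coeffMap_mem_linearIdeal_pow {m a J : ℕ} (hm : (m.factorial : K) ≠ 0) (ham : a ≤ m)
    {v : Fin (n + 2) → K} (hv : v 0 ≠ 0) (hq : tailMap K (n + 1) v 0 ≠ 0) (hJ : J ≤ m + 1)
    {F : MvPolynomial (Fin (n + 2)) K} (hF : F.IsHomogeneous m)
    (hFa : F ∈ linearIdeal (Submodule.span K {coordPoint K (n + 1)}) ^ a)
    (hFv : F ∈ linearIdeal (Submodule.span K {v}) ^ (m + 1 - J)) :
    coeffMap K (n + 1) (m - a) F ∈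
      linearIdeal (Submodule.span K {tailMap K (n + 1) v}) ^ ((a : ℤ) + 1 - J).toNat := by
  have hfac : ∀ {b : ℕ}, b ≤ m → (b.factorial : K) ≠ 0 := by
    intro b hb h1
    obtain ⟨c, hc⟩ := Nat.factorial_dvd_factorial hb
    rw [hc, Nat.cast_mul, h1, zero_mul] at hm
    exact hm rfl
  rw [mem_linearIdeal_pow_iff_apolar (hfac ham) (fun _ => hq) (coeffMap_isHomogeneous hF ham)]
  intro g hg
  have h1 : linForm v ^ J ∈ annIdeal F := linForm_pow_mem_annIdeal hm hJ hv hF hFv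
  have h2 : linForm (coordPoint K (n + 1)) ^ (m + 1 - a) ∈ annIdeal F :=
    linForm_pow_mem_annIdeal hm (by omega) (by simp [coordPoint]) hF (by
      rwa [show m + 1 - (m + 1 - a) = a by omega])
  have hX : linForm (coordPoint K (n + 1)) = X 0 := by
    classical
    simp [linForm, coordPoint, Pi.single_apply, apply_ite C, ite_mul]
  have hr : rename Fin.succ (linForm (tailMap K (n + 1) v)) = linForm v - C (v 0) * X 0 := by
    have : linForm v = C (v 0) * X 0 + ∑ i : Fin (n + 1), C (v i.succ) * X i.succ :=
      Fin.sum_univ_succ _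
    rw [this, add_sub_cancel_left, linForm, map_sum]
    simp [tailMap_apply]
  rw [hX] at h2
  -- The linear forms of v and of its projection differ by a multiple of X 0. After multiplication
  -- by X 0 ^ (m - a) the difference is lost, since X 0 ^ (m + 1 - a) annihilates F.
  have h3 : coneForm (m - a) (linForm (tailMap K (n + 1) v) ^ J * g) ∈ annIdeal F := by
    obtain ⟨z, hz⟩ : X 0 ∣ (linForm v - C (v 0) * X 0) ^ J - linForm v ^ J :=
      dvd_trans ⟨-C (v 0), by ring⟩ (sub_dvd_pow_sub_pow _ _ _)
    rw [coneForm, map_mul, map_pow, hr, ← sub_add_cancel ((linForm v - C (v 0) * X 0) ^ J)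
      (linForm v ^ J), hz,
      show X 0 ^ (m - a) * ((X 0 * z + linForm v ^ J) * rename Fin.succ g) =
        X 0 ^ (m + 1 - a) * (z * rename Fin.succ g) +
          linForm v ^ J * (X 0 ^ (m - a) * rename Fin.succ g) by
        rw [show m + 1 - a = m - a + 1 by omega]; ring]
    exact add_mem (Ideal.mul_mem_right _ _ h2) (Ideal.mul_mem_right _ _ h1)
  have h4 := h3 1
  rw [mul_one, apolar_coneForm] at h4
  exact (mul_eq_zero.1 h4).resolve_left (hfac (Nat.sub_le m a))

end Pigeonhole

/-! ### The expected obstructions in the tangent cone. -/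

section TangentCone
variable {K : Type*} [Field K] {n : ℕ} {ι : Type*} [DecidableEq ι]

lemma sum_range_numForms (N k : ℕ) (J : ℕ) :
    ∑ a ∈ Finset.range k, numForms N ((a : ℤ) - J) = numForms (N + 1) ((k : ℤ) - 1 - J) := by
  induction k with
  | zero => rw [Finset.sum_range_zero, numForms_of_neg _ (by push_cast; omega)]
  | succ k ih =>
    rw [Finset.sum_range_succ, ih, numForms_succ N (((k + 1 : ℕ) : ℤ) - 1 - J)]
    push_cast
    ring_nf

lemma Indep.of_le {N : ℕ} {v : ι → Fin (N + 1) → K} {J : ι → ℕ} {X : Finset ι} {s s' : ℤ}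
    (h : Indep v J X s) (hs : s' ≤ s) : Indep v J X s' := by
  obtain ⟨k, rfl⟩ : ∃ k : ℕ, s = s' + k := ⟨(s - s').toNat, by omega⟩
  intro g hg hd i hi
  have hw : linForm (coordPoint K N) ≠ 0 := linForm_ne_zero fun h0 => by
    simpa [coordPoint] using congrFun h0 0
  have := h (fun i => linForm (coordPoint K N) ^ k * g i) (fun i => by
    have := mul_mem_forms (linForm_pow_mem_forms (coordPoint K N) k) (hg i)
    rwa [show (k : ℤ) + (s' - J i) = s' + k - J i by ring] at this) (by
    rw [← mul_zero (linForm (coordPoint K N) ^ k), ← hd, Finset.mul_sum]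
    exact Finset.sum_congr rfl fun i _ => by ring) i hi
  exact (mul_eq_zero.1 this).resolve_left (pow_ne_zero _ hw)

/-- The ideal of the expected linear obstructions at the `j`-th subspace. -/
noncomputable def obstructionIdeal {N : ℕ} (P : ι → Submodule K (Fin N → K)) (k : ι → ℕ) (m : ℕ)
    (j : ι) (a : ℕ) : Ideal (MvPolynomial (Fin N) K) :=
  (fatLinearIdeal (P j) a ⊓ ⨅ T : {T : Finset ι // j ∉ T},
    fatLinearIdeal (P j ⊔ ⨆ i ∈ T.1, P i) ((a : ℤ) + ∑ i ∈ T.1, (k i : ℤ) - T.1.card * m)) ⊔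
    fatLinearIdeal (P j) (a + 1 : ℕ)

variable {m a : ℕ} {v : ι → Fin (n + 2) → K} {j : ι} {k J : ι → ℕ}

/-- Raising the multiplicity at the coordinate point by one kills the leading coefficient and
nothing else. -/
lemma gradedPiece_update_succ (hvj : v j = coordPoint K (n + 1)) (ham : a ≤ m) :
    gradedPiece (fatIdeal (fun i => Submodule.span K {v i})
        (Function.update (fun i => (k i : ℤ)) j (a + 1 : ℕ))) m =
      gradedPiece (fatIdeal (fun i => Submodule.span K {v i})
        (Function.update (fun i => (k i : ℤ)) j (a : ℕ))) m ⊓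
        LinearMap.ker (coeffMap K (n + 1) (m - a)) := by
  ext F
  rw [Submodule.mem_inf, mem_gradedPiece_fatIdeal, mem_gradedPiece_fatIdeal, and_assoc,
    LinearMap.mem_ker, coeffMap_apply]
  refine and_congr_right fun hF => ?_
  have key : F ∈ linearIdeal (Submodule.span K {v j}) ^ (a + 1) ↔
      F ∈ linearIdeal (Submodule.span K {v j}) ^ a ∧ (finSuccEquiv K (n + 1) F).coeff (m - a) = 0 := by
    rw [hvj, mem_linearIdeal_coordPoint_pow hF, mem_linearIdeal_coordPoint_pow hF]
    constructor
    · exact fun h => ⟨fun b hb => h b (by omega), h _ (by omega)⟩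
    · rintro ⟨h1, h2⟩ b hb
      rcases eq_or_ne b (m - a) with rfl | hne
      · exact h2
      · exact h1 b (by omega)
  constructor
  · intro h
    have hj := h j
    rw [Function.update_self, Int.toNat_natCast, key] at hj
    refine ⟨fun i => ?_, hj.2⟩
    by_cases hi : i = j
    · subst hi
      rw [Function.update_self, Int.toNat_natCast]
      exact hj.1
    · have := h i
      rwa [Function.update_of_ne hi] at this ⊢
  · rintro ⟨h1, h2⟩ i
    by_cases hi : i = j
    · subst hi
      have := h1 i
      rw [Function.update_self, Int.toNat_natCast] at this ⊢
      exact key.2 ⟨this, h2⟩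
    · have := h1 i
      rwa [Function.update_of_ne hi] at this ⊢

/-- The expected tangent cone is cut out by multiple points. -/
lemma gradedPiece_iInf_eq_fatIdeal [Infinite K] (ha : (a.factorial : K) ≠ 0)
    {q : ι → Fin (n + 1) → K} (hq : ∀ i, i ≠ j → q i 0 ≠ 0) (hkJ : ∀ i, k i + J i = m + 1)
    (hJ : ∀ i, 1 ≤ J i) (haj : a < k j)
    (htriple : ∀ i l, i ≠ l → i ≠ j → l ≠ j → m < J i + J l + J j) :
    gradedPiece (⨅ T : {T : Finset ι // j ∉ T}, linearIdeal (⨆ i ∈ T.1, Submodule.span K {q i}) ^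
        ((a : ℤ) + ∑ i ∈ T.1, (k i : ℤ) - T.1.card * m).toNat) a =
      gradedPiece (fatIdeal (fun i => Submodule.span K {q i})
        (fun i => if i = j then 0 else (a : ℤ) + 1 - J i)) a := by
  -- Here k i - m = 1 - J i. For a single index this is the multiplicity a + 1 - J i of the
  -- projected point.
  have hexp : ∀ T : Finset ι, (a : ℤ) + ∑ i ∈ T, (k i : ℤ) - T.card * m =
      a - ∑ i ∈ T, ((J i : ℤ) - 1) := by
    intro T
    rw [Finset.cast_card, Finset.sum_mul, add_sub_assoc, ← Finset.sum_sub_distrib, sub_eq_add_neg,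
      ← Finset.sum_neg_distrib]
    congr 1
    refine Finset.sum_congr rfl fun i _ => ?_
    have := hkJ i
    rw [one_mul]
    omega
  ext f
  rw [mem_gradedPiece_fatIdeal]
  simp only [gradedPiece, Submodule.mem_inf, Submodule.restrictScalars_mem,
      mem_homogeneousSubmodule, Ideal.mem_iInf, hexp]
  rw [and_comm]
  refine and_congr_right fun hf => ?_
  constructor
  · intro h i
    split_ifs with hi
    · simp
    · have := h ⟨{i}, by simpa using Ne.symm hi⟩
      simp only [Finset.sum_singleton, Finset.mem_singleton, iSup_iSup_eq_left] at this
      rwa [show (a : ℤ) + 1 - J i = a - (J i - 1) by ring]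
  · rintro h ⟨T, hT⟩
    have hTj : ∀ i ∈ T, i ≠ j := fun i hi e => hT (e ▸ hi)
    dsimp only
    have hcast : ∑ i ∈ T, ((J i : ℤ) - 1) = ((∑ i ∈ T, (J i - 1) : ℕ) : ℤ) := by
      push_cast
      exact Finset.sum_congr rfl fun i _ => by rw [Nat.cast_sub (hJ i), Nat.cast_one]
    rw [hcast]
    have hpos : 1 + ∑ i ∈ T, (J i - 1) ≤ a →
        f ∈ linearIdeal (⨆ i ∈ T, Submodule.span K {q i}) := fun hle => by
      refine mem_linearIdeal_iSup_span ha (fun i hi => hq i (hTj i hi)) (fun i _ => hJ i) hle hf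
        fun i hi => ?_
      have := h i
      rw [if_neg (hTj i hi)] at this
      rwa [show ((a : ℤ) + 1 - J i).toNat = a + 1 - J i by omega] at this
    rcases le_or_gt (T.card) 1 with hc | hc
    · have : Nonempty ι := ⟨j⟩
      obtain ⟨i, hi⟩ := Finset.card_le_one_iff_subset_singleton.1 hc
      rcases Finset.subset_singleton_iff.1 hi with rfl | rfl
      · simp only [Finset.sum_empty, Finset.notMem_empty, iSup_false, iSup_bot]
        rw [linearIdeal_bot, mem_idealOfVars_pow_iff_of_isHomogeneous hf]
        intro h; omega
      · have := h i
        rw [if_neg (hTj i (Finset.mem_singleton_self i))] at this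
        simp only [Finset.sum_singleton, Finset.mem_singleton, iSup_iSup_eq_left]
        have h1 := hJ i
        rwa [show ((a : ℤ) - ((J i - 1 : ℕ) : ℤ)).toNat = ((a : ℤ) + 1 - J i).toNat by omega]
    -- Two indices in T, together with a + J j ≤ m, bring the exponent down to at most 1. If it is
    -- 1, then vanishing on the span already follows from the multiplicities at the points.
    · obtain ⟨i, hi, l, hl, hil⟩ := Finset.one_lt_card.1 hc
      have h1 : (J i - 1) + (J l - 1) ≤ ∑ i ∈ T, (J i - 1) := by
        rw [← Finset.add_sum_erase T (fun i => J i - 1) hi]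
        exact Nat.add_le_add_left (Finset.single_le_sum (f := fun i => J i - 1)
          (fun _ _ => Nat.zero_le _) (Finset.mem_erase.2 ⟨hil.symm, hl⟩)) _
      have h2 := htriple i l hil (hTj i hi) (hTj l hl)
      have h3 := hkJ j
      have h4 := hJ i
      have h5 := hJ l
      have h6 : ((a : ℤ) - ((∑ i ∈ T, (J i - 1) : ℕ) : ℤ)).toNat ≤ 1 := by omega
      rcases Nat.le_one_iff_eq_zero_or_eq_one.1 h6 with h7 | h7
      · rw [h7, pow_zero, Ideal.one_eq_top]; trivial
      · rw [h7, pow_one]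
        exact hpos (by omega)

end TangentCone

/-! ### Expected obstructions at the coordinate point as a dimension count. -/

section ExpectedObstructions
variable {K : Type*} [Field K] [Infinite K] {n : ℕ} {ι : Type*} [Fintype ι] [DecidableEq ι]
variable {m : ℕ} {v : ι → Fin (n + 2) → K} {j : ι} {k J : ι → ℕ}

/-- At the first coordinate point there are only the expected linear obstructions if and only if
this point imposes the expected number of conditions. -/
theorem sameSubscheme_obstructionIdeal_iff_of_coordPoint (hm : (m.factorial : K) ≠ 0)
    (hvj : v j = coordPoint K (n + 1)) (hv : ∀ i, v i 0 ≠ 0)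
    (hq : ∀ i, i ≠ j → tailMap K (n + 1) (v i) 0 ≠ 0) (hkJ : ∀ i, k i + J i = m + 1)
    (hJ : ∀ i, 1 ≤ J i) (htriple : ∀ i l, i ≠ l → i ≠ j → l ≠ j → m < J i + J l + J j)
    (hind : Indep (fun i => tailMap K (n + 1) (v i)) J (Finset.univ.erase j) ((k j : ℤ) - 1)) :
    (∀ a < k j, SameSubscheme
      (baseLocusIdeal (fatIdeal (fun i => Submodule.span K {v i})
        (Function.update (fun i => (k i : ℤ)) j (a : ℕ))) m ⊔
        fatLinearIdeal (Submodule.span K {v j}) (a + 1 : ℕ))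
      (obstructionIdeal (fun i => Submodule.span K {v i}) k m j a)) ↔
    (Module.finrank K (gradedPiece (fatIdeal (fun i => Submodule.span K {v i})
        (Function.update (fun i => (k i : ℤ)) j (0 : ℕ))) m) : ℤ) -
      Module.finrank K (gradedPiece (fatIdeal (fun i => Submodule.span K {v i})
        (fun i => (k i : ℤ))) m) =
      numForms (n + 2) ((k j : ℤ) - 1) -
        ∑ i ∈ Finset.univ.erase j, numForms (n + 2) ((k j : ℤ) - 1 - J i) := by
  set q : ι → Fin (n + 1) → K := fun i => tailMap K (n + 1) (v i) with hqdef
  set L : ℕ → Submodule K (MvPolynomial (Fin (n + 2)) K) := fun a =>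
    gradedPiece (fatIdeal (fun i => Submodule.span K {v i})
      (Function.update (fun i => (k i : ℤ)) j (a : ℕ))) m with hL
  set U : ℕ → Submodule K (MvPolynomial (Fin (n + 1)) K) := fun a =>
    gradedPiece (fatIdeal (fun i => Submodule.span K {q i})
        (fun i => if i = j then 0 else (a : ℤ) + 1 - J i)) a with hU
  have hkj : k j ≤ m := by have := hkJ j; have := hJ j; omega
  have hfac : ∀ {b : ℕ}, b ≤ m → (b.factorial : K) ≠ 0 := by
    intro b hb h1
    obtain ⟨c, hc⟩ := Nat.factorial_dvd_factorial hb
    rw [hc, Nat.cast_mul, h1, zero_mul] at hm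
    exact hm rfl
  have hLmem : ∀ a, ∀ F ∈ L a, F.IsHomogeneous m ∧
      F ∈ linearIdeal (Submodule.span K {coordPoint K (n + 1)}) ^ a := by
    intro a F hF
    obtain ⟨h1, h2⟩ := mem_gradedPiece_fatIdeal.1 hF
    have := h2 j
    rw [Function.update_self, Int.toNat_natCast, hvj] at this
    exact ⟨h1, this⟩
  have hsame : ∀ a < k j, (SameSubscheme
      (baseLocusIdeal (fatIdeal (fun i => Submodule.span K {v i})
        (Function.update (fun i => (k i : ℤ)) j (a : ℕ))) m ⊔
        fatLinearIdeal (Submodule.span K {v j}) (a + 1 : ℕ))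
      (obstructionIdeal (fun i => Submodule.span K {v i}) k m j a) ↔
      (L a).map (coeffMap K (n + 1) (m - a)) = U a) := by
    intro a ha
    have h1 := gradedPiece_iInf_eq_fatIdeal (q := q) (hfac (show a ≤ m by omega)) hq hkJ hJ ha htriple
    rw [show U a = _ from h1.symm,
      ← sameSubscheme_iff_map_coeffMap_eq (hLmem a) (by omega), baseLocusIdeal, obstructionIdeal]
    -- The span of p_j and other points is the cone with vertex p_j over the span of their
    -- projections.
    have hspan : ∀ T : Finset ι, Submodule.span K {v j} ⊔ ⨆ i ∈ T, Submodule.span K {v i} =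
        (⨆ i ∈ T, Submodule.span K {q i}).comap (tailMap K (n + 1)) := by
      intro T
      have : ⨆ i ∈ T, Submodule.span K {q i} =
          (⨆ i ∈ T, Submodule.span K {v i}).map (tailMap K (n + 1)) := by
        simp only [Submodule.map_iSup, Submodule.map_span, Set.image_singleton, hqdef]
      rw [this, Submodule.comap_map_eq, hvj, ← comap_tailMap_bot, sup_comm]
      rfl
    simp only [fatLinearIdeal, Int.toNat_natCast, hspan]
    simp only [hvj]
    rfl
  have hle : ∀ a < k j, (L a).map (coeffMap K (n + 1) (m - a)) ≤ U a := by
    rintro a ha _ ⟨F, hF, rfl⟩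
    obtain ⟨h1, h2⟩ := hLmem a F hF
    refine mem_gradedPiece_fatIdeal.2 ⟨coeffMap_isHomogeneous h1 (by omega), fun i => ?_⟩
    split_ifs with hi
    · simp
    · refine coeffMap_mem_linearIdeal_pow hm (by omega) (hv i) (hq i hi)
        (by have := hkJ i; omega) h1 h2 ?_
      have := (mem_gradedPiece_fatIdeal.1 hF).2 i
      rwa [Function.update_of_ne hi, Int.toNat_natCast,
        show k i = m + 1 - J i by have := hkJ i; omega] at this
  have hrank : ∀ a < k j, (Module.finrank K ((L a).map (coeffMap K (n + 1) (m - a))) : ℤ) =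
      Module.finrank K (L a) - Module.finrank K (L (a + 1)) := by
    intro a ha
    have h1 := finrank_map_coeffMap (L := L a) (m - a)
    have h2 : L (a + 1) = L a ⊓ LinearMap.ker (coeffMap K (n + 1) (m - a)) :=
      gradedPiece_update_succ hvj (by omega)
    rw [← h2] at h1
    rw [eq_sub_iff_add_eq]
    exact_mod_cast h1
  -- By duality in one variable less, independence in the top degree k j - 1 and hence below makes
  -- the projected points impose independent conditions.
  have hUrank : ∀ a < k j, (Module.finrank K (U a) : ℤ) = numForms (n + 1) a -
      ∑ i ∈ Finset.univ.erase j, numForms (n + 1) ((a : ℤ) - J i) := by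
    intro a ha
    have h1 := finrank_gradedPiece_add_finrank_powerPiece (hfac (show a ≤ m by omega)) (v := q)
      (J := J) (X := Finset.univ.erase j) (B := fun i => if i = j then 0 else (a : ℤ) + 1 - J i)
      (fun i hi => by rw [if_neg (Finset.ne_of_mem_erase hi)])
      (fun i hi => by
        have : i = j := by simpa using hi
        rw [if_pos this])
      (fun i hi _ => hq i (Finset.ne_of_mem_erase hi))
    have h2 := (hind.of_le (s' := a) (by omega)).finrank_powerPiece (fun i hi h0 =>
      hq i (Finset.ne_of_mem_erase hi) (by
        rw [show tailMap K (n + 1) (v i) = 0 from h0]; rfl))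
    have h3 : numForms (n + 1) a = ((n + 1).multichoose a : ℤ) := by simp [numForms]
    rw [h3, ← h2]
    change Module.finrank K (U a) + _ = _ at h1
    omega
  have htel : ∑ a ∈ Finset.range (k j), ((Module.finrank K (L a) : ℤ) -
      Module.finrank K (L (a + 1))) = Module.finrank K (L 0) - Module.finrank K (L (k j)) := by
    rw [Finset.sum_range_sub']
  have hsum : ∑ a ∈ Finset.range (k j), (Module.finrank K (U a) : ℤ) =
      numForms (n + 2) ((k j : ℤ) - 1) -
        ∑ i ∈ Finset.univ.erase j, numForms (n + 2) ((k j : ℤ) - 1 - J i) := by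
    rw [Finset.sum_congr rfl fun a ha => hUrank a (Finset.mem_range.1 ha), Finset.sum_sub_distrib,
      Finset.sum_comm, Finset.sum_congr rfl fun i _ => sum_range_numForms (n + 1) (k j) (J i)]
    have := sum_range_numForms (n + 1) (k j) 0
    simp only [Nat.cast_zero, sub_zero] at this
    rw [this]
  have hLk : L (k j) = gradedPiece (fatIdeal (fun i => Submodule.span K {v i})
      (fun i => (k i : ℤ))) m := by
    rw [hL]
    dsimp only
    rw [Function.update_eq_self]
  rw [← hLk, ← hsum, ← htel]
  -- Each summand is the dimension of a space of leading coefficients contained in U a. The sums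
  -- agree exactly if all these inclusions are equalities.
  have hterm : ∀ a ∈ Finset.range (k j), (Module.finrank K (L a) : ℤ) -
      Module.finrank K (L (a + 1)) ≤ Module.finrank K (U a) := by
    intro a ha
    rw [← hrank a (Finset.mem_range.1 ha)]
    exact_mod_cast Submodule.finrank_mono (hle a (Finset.mem_range.1 ha))
  rw [Finset.sum_eq_sum_iff_of_le hterm]
  refine forall_congr' fun a => ?_
  rw [Finset.mem_range]
  refine forall_congr' fun ha => ?_
  rw [hsame a ha, ← hrank a ha]
  constructor
  · intro h; rw [h]
  · intro h
    exact Submodule.eq_of_le_of_finrank_eq (hle a ha) (by exact_mod_cast h)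

end ExpectedObstructions

/-! ### Reduction modulo a linear form as projection from a point. -/

section Projection
variable {K : Type*} [Field K] {n : ℕ} {ι : Type*}

/-- The projection from the point `y` to the hyperplane of the last coordinates. -/
def centralProj (y w : Fin (n + 1) → K) : Fin n → K := fun a => y 0 * w a.succ - y a.succ * w 0

/-- The reduction modulo the linear form `linForm y`. -/
noncomputable def reduceMod (y : Fin (n + 1) → K) :
    MvPolynomial (Fin (n + 1)) K →ₐ[K] MvPolynomial (Fin n) K :=
  aeval (Fin.cons (-(C (y 0)⁻¹ * linForm (tailMap K n y))) X : Fin (n + 1) → MvPolynomial (Fin n) K)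

variable {y : Fin (n + 1) → K}

lemma reduceMod_rename (f : MvPolynomial (Fin n) K) : reduceMod y (rename Fin.succ f) = f := by
  rw [reduceMod, aeval_rename]
  have : (Fin.cons (-(C (y 0)⁻¹ * linForm (tailMap K n y))) X : Fin (n + 1) → MvPolynomial (Fin n) K)
      ∘ Fin.succ = X := by
    ext1 i; simp
  rw [this, aeval_X_left_apply]

lemma linForm_eq_cons (w : Fin (n + 1) → K) :
    linForm w = C (w 0) * X 0 + rename Fin.succ (linForm (tailMap K n w)) := by
  have : linForm w = C (w 0) * X 0 + ∑ i : Fin n, C (w i.succ) * X i.succ := Fin.sum_univ_succ _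
  rw [this, linForm, map_sum]
  simp [tailMap_apply]

lemma reduceMod_X_zero : reduceMod y (X 0) = -(C (y 0)⁻¹ * linForm (tailMap K n y)) := by
  simp [reduceMod]

lemma reduceMod_linForm (hy : y 0 ≠ 0) (w : Fin (n + 1) → K) :
    reduceMod y (linForm w) = C (y 0)⁻¹ * linForm (centralProj y w) := by
  have h : centralProj y w = y 0 • tailMap K n w + (-w 0) • tailMap K n y := by
    ext a
    simp [centralProj, tailMap_apply]; ring
  have h1 : reduceMod y (C (w 0)) = C (w 0) := by simp [reduceMod]
  rw [linForm_eq_cons, map_add, map_mul, h1, reduceMod_rename, reduceMod_X_zero, h, linForm_add,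
    linForm_smul, linForm_smul, mul_add, ← mul_assoc, ← C_mul, inv_mul_cancel₀ hy]
  simp
  ring

lemma linForm_dvd_sub_rename_reduceMod (hy : y 0 ≠ 0) (F : MvPolynomial (Fin (n + 1)) K) :
    linForm y ∣ F - rename Fin.succ (reduceMod y F) := by
  induction F using MvPolynomial.induction_on with
  | C a => simp [reduceMod]
  | add p q hp hq =>
    rw [map_add, map_add, add_sub_add_comm]
    exact hp.add hq
  | mul_X p i hp =>
    have hX : linForm y ∣ X i - rename Fin.succ (reduceMod y (X i)) := by
      refine Fin.cases ?_ (fun i => ?_) i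
      · refine ⟨C (y 0)⁻¹, ?_⟩
        rw [reduceMod_X_zero, linForm_eq_cons y, map_neg, map_mul, rename_C, add_mul,
          mul_right_comm, ← C_mul, mul_inv_cancel₀ hy]
        simp
        ring
      · have := reduceMod_rename (y := y) (X i)
        rw [rename_X] at this
        rw [this, rename_X, sub_self]
        exact dvd_zero _
    rw [map_mul, map_mul, show p * X i - rename Fin.succ (reduceMod y p) * rename Fin.succ
      (reduceMod y (X i)) = (p - rename Fin.succ (reduceMod y p)) * X i +
        rename Fin.succ (reduceMod y p) * (X i - rename Fin.succ (reduceMod y (X i))) by ring]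
    exact (hp.mul_right _).add (hX.mul_left _)

lemma reduceMod_eq_zero_iff (hy : y 0 ≠ 0) {F : MvPolynomial (Fin (n + 1)) K} :
    reduceMod y F = 0 ↔ linForm y ∣ F := by
  constructor
  · intro h
    have := linForm_dvd_sub_rename_reduceMod hy F
    rwa [h, map_zero, sub_zero] at this
  · rintro ⟨G, rfl⟩
    have : centralProj y y = 0 := by ext a; simp [centralProj, mul_comm]
    rw [map_mul, reduceMod_linForm hy, this]
    simp [linForm]

lemma reduceMod_mem_forms {a : ℤ} {F : MvPolynomial (Fin (n + 1)) K} (hF : F ∈ forms K (n + 1) a) :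
    reduceMod y F ∈ forms K n a := by
  rcases lt_or_ge a 0 with ha | ha
  · rw [eq_zero_of_mem_forms ha hF, map_zero]; exact zero_mem _
  obtain ⟨a, rfl⟩ := Int.eq_ofNat_of_zero_le ha
  rw [mem_forms_natCast] at hF ⊢
  have h := hF.aeval (n := 1)
    (Fin.cons (-(C (y 0)⁻¹ * linForm (tailMap K n y))) X : Fin (n + 1) → MvPolynomial (Fin n) K)
    (fun i => by
      refine Fin.cases ?_ (fun i => ?_) i
      · exact ((linForm_isHomogeneous _).C_mul _).neg
      · exact isHomogeneous_X _ _)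
  simpa [reduceMod] using h

lemma rename_mem_forms {a : ℤ} {f : MvPolynomial (Fin n) K} (hf : f ∈ forms K n a) :
    rename Fin.succ f ∈ forms K (n + 1) a := by
  rcases lt_or_ge a 0 with ha | ha
  · rw [eq_zero_of_mem_forms ha hf, map_zero]; exact zero_mem _
  obtain ⟨a, rfl⟩ := Int.eq_ofNat_of_zero_le ha
  rw [mem_forms_natCast] at hf ⊢
  exact hf.rename_isHomogeneous

lemma reduceMod_linForm_pow_mul (hy : y 0 ≠ 0) (w : Fin (n + 1) → K) (J : ℕ)
    (g : MvPolynomial (Fin (n + 1)) K) : reduceMod y (linForm w ^ J * g) =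
      linForm (centralProj y w) ^ J * (C ((y 0)⁻¹ ^ J) * reduceMod y g) := by
  rw [map_mul, map_pow, reduceMod_linForm hy, mul_pow, C_pow]; ring

/-- Independence modulo a linear form is independence of the projected linear forms. -/
lemma indepMod_iff_indep_centralProj (hy : y 0 ≠ 0) {v : ι → Fin (n + 1) → K} {J : ι → ℕ}
    {X : Finset ι} {s : ℤ} :
    IndepMod v J y X s ↔ Indep (fun i => centralProj y (v i)) J X s := by
  constructor
  · intro h g hg hsum i hi
    have h1 := h (fun i => C (y 0 ^ J i) * rename Fin.succ (g i)) (fun i => by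
      rw [← smul_eq_C_mul]
      exact Submodule.smul_mem _ _ (rename_mem_forms (hg i))) (by
      rw [← reduceMod_eq_zero_iff hy, map_sum, ← hsum]
      refine Finset.sum_congr rfl fun i _ => ?_
      have hC : reduceMod y (C (y 0 ^ J i)) = C (y 0 ^ J i) := by simp [reduceMod]
      rw [reduceMod_linForm_pow_mul hy, map_mul, reduceMod_rename, hC, ← mul_assoc (C _),
        ← C_mul, ← mul_pow, inv_mul_cancel₀ hy, one_pow, C_1, one_mul]) i hi
    rw [← smul_eq_C_mul, ← reduceMod_eq_zero_iff hy, map_smul, reduceMod_rename, smul_eq_zero] at h1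
    exact h1.resolve_left (pow_ne_zero _ hy)
  · intro h g hg hd i hi
    have h1 := h (fun i => C ((y 0)⁻¹ ^ J i) * reduceMod y (g i)) (fun i => by
      rw [← smul_eq_C_mul]
      exact Submodule.smul_mem _ _ (reduceMod_mem_forms (hg i))) (by
      rw [← reduceMod_eq_zero_iff hy, map_sum] at hd
      rw [← hd]
      exact Finset.sum_congr rfl fun i _ => (reduceMod_linForm_pow_mul hy _ _ _).symm) i hi
    rw [← smul_eq_C_mul, smul_eq_zero] at h1
    rw [← reduceMod_eq_zero_iff hy]
    exact h1.resolve_left (pow_ne_zero _ (inv_ne_zero hy))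

lemma Indep.smul {N : ℕ} {v : ι → Fin N → K} {J : ι → ℕ} {X : Finset ι} {s : ℤ}
    (h : Indep v J X s) {c : K} (hc : c ≠ 0) : Indep (fun i => c • v i) J X s := by
  intro g hg hsum i hi
  have h1 := h (fun i => C (c ^ J i) * g i) (fun i => by
    rw [← smul_eq_C_mul]
    exact Submodule.smul_mem _ _ (hg i)) (by
    rw [← hsum]
    refine Finset.sum_congr rfl fun i _ => ?_
    rw [linForm_smul, mul_pow, C_pow]; ring) i hi
  rw [← smul_eq_C_mul, smul_eq_zero] at h1
  exact h1.resolve_left (pow_ne_zero _ hc)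

lemma centralProj_eq_zero_of_linForm_dvd {y w : Fin (n + 1) → K} (h : linForm y ∣ linForm w) :
    centralProj y w = 0 := by
  obtain ⟨c, rfl⟩ := exists_smul_of_linForm_dvd h
  ext a
  simp [centralProj]; ring

lemma mul_mem_powerPiece {N : ℕ} {v : ι → Fin N → K} {J : ι → ℕ} {X : Finset ι} {s a t : ℤ}
    {f g : MvPolynomial (Fin N) K} (hg : g ∈ forms K N a) (hf : f ∈ powerPiece v J X s)
    (ht : a + s = t) : g * f ∈ powerPiece v J X t := by
  obtain ⟨c, hc, rfl⟩ := mem_powerPiece.1 hf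
  refine mem_powerPiece.2 ⟨fun i => g * c i, fun i => ?_, ?_⟩
  · have := mul_mem_forms hg (hc i)
    rwa [show a + (s - J i) = t - J i by omega] at this
  · rw [Finset.mul_sum]
    exact Finset.sum_congr rfl fun i _ => by ring

lemma forms_le_powerPiece_add {N : ℕ} {v : ι → Fin N → K} {J : ι → ℕ} {Y : Finset ι} {s : ℕ}
    (h : forms K N s ≤ powerPiece v J Y s) (e : ℕ) :
    forms K N (s + e : ℕ) ≤ powerPiece v J Y (s + e : ℕ) := by
  induction e with
  | zero => exact h
  | succ e ih =>
    intro F hF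
    rw [mem_forms_natCast] at hF
    rw [sum_coeff_monomial hF]
    refine Submodule.sum_mem _ fun α _ => Submodule.smul_mem _ _ ?_
    have hα := mem_finsuppAntidiag_univ.1 α.2
    obtain ⟨i, hi⟩ : ∃ i, α.1 i ≠ 0 := by
      by_contra! h0
      have : α.1 = 0 := Finsupp.ext h0
      rw [this] at hα
      simp at hα
    have h1 : Finsupp.single i 1 + (α.1 - Finsupp.single i 1) = α.1 :=
      add_tsub_cancel_of_le (Finsupp.single_le_iff.2 (Nat.one_le_iff_ne_zero.2 hi))
    have h2 : (α.1 - Finsupp.single i 1).degree = s + e := by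
      have := congrArg Finsupp.degree h1
      rw [map_add, Finsupp.degree_single, hα] at this
      omega
    have h3 : (monomial α.1 1 : MvPolynomial (Fin N) K) = X i * monomial (α.1 - Finsupp.single i 1) 1 := by
      rw [X, monomial_mul, h1, one_mul]
    rw [h3]
    refine mul_mem_powerPiece (a := 1) ?_ (ih (mem_forms_natCast.2 (isHomogeneous_monomial _ h2)))
      (by push_cast; ring)
    rw [← Nat.cast_one, mem_forms_natCast]
    exact isHomogeneous_X _ _

/-- If the projected forms span everything, then so do the forms, after adding the power of the
form of the centre of the projection. -/
lemma forms_le_powerPiece_of_centralProj [Fintype ι] [DecidableEq ι] {v : ι → Fin (n + 1) → K}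
    {J : ι → ℕ} {o : ι} (ho : v o 0 ≠ 0) {s : ℕ}
    (h : forms K n s ≤ powerPiece (fun i => centralProj (v o) (v i)) J (Finset.univ.erase o) s) :
    forms K (n + 1) (s + J o : ℕ) ≤ powerPiece v J Finset.univ (s + J o : ℕ) := by
  -- Repeated division: in degrees above s every form is, up to multiples of the other powers,
  -- divisible by the form of v o. After J o steps its J o-th power splits off.
  have key : ∀ r : ℕ, ∀ F ∈ forms K (n + 1) (s + r : ℕ), ∃ G ∈ forms K (n + 1) s,
      F - linForm (v o) ^ r * G ∈ powerPiece v J (Finset.univ.erase o) (s + r : ℕ) := by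
    intro r
    induction r with
    | zero =>
      intro F hF
      exact ⟨F, hF, by rw [pow_zero, one_mul, sub_self]; exact zero_mem _⟩
    | succ r ih =>
      intro F hF
      obtain ⟨g, hg, hgF⟩ := mem_powerPiece.1
        (forms_le_powerPiece_add h (r + 1) (reduceMod_mem_forms (y := v o) hF))
      set P := ∑ i ∈ Finset.univ.erase o, linForm (v i) ^ J i *
        (C (v o 0 ^ J i) * rename Fin.succ (g i)) with hP
      have hPmem : P ∈ powerPiece v J (Finset.univ.erase o) (s + (r + 1) : ℕ) :=
        mem_powerPiece.2 ⟨_, fun i => by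
          rw [← smul_eq_C_mul]
          exact Submodule.smul_mem _ _ (rename_mem_forms (hg i)), hP⟩
      have hd : linForm (v o) ∣ F - P := by
        rw [← reduceMod_eq_zero_iff ho, map_sub, hgF, sub_eq_zero, hP, map_sum]
        refine Finset.sum_congr rfl fun i _ => ?_
        have hC : reduceMod (v o) (C (v o 0 ^ J i)) = C (v o 0 ^ J i) := by simp [reduceMod]
        rw [reduceMod_linForm_pow_mul ho, map_mul, reduceMod_rename, hC, ← mul_assoc (C _),
          ← C_mul, ← mul_pow, inv_mul_cancel₀ ho, one_pow, C_1, one_mul]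
      obtain ⟨F', hF', hFF'⟩ := exists_forms_of_dvd (linForm_isHomogeneous (v o))
        (sub_mem hF (powerPiece_le_forms _ hPmem)) hd
      rw [show ((s + (r + 1) : ℕ) : ℤ) - (1 : ℕ) = (s + r : ℕ) by push_cast; ring] at hF'
      obtain ⟨G, hG, hFG⟩ := ih F' hF'
      refine ⟨G, hG, ?_⟩
      have h1 := mul_mem_powerPiece (linForm_mem_forms (v o)) hFG
        (t := (s + (r + 1) : ℕ)) (by push_cast; ring)
      have h2 : F - linForm (v o) ^ (r + 1) * G =
          linForm (v o) * (F' - linForm (v o) ^ r * G) + P := by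
        linear_combination hFF'
      rw [h2]
      exact add_mem h1 hPmem
  intro F hF
  obtain ⟨G, hG, hFG⟩ := key (J o) F hF
  rw [← sub_add_cancel F (linForm (v o) ^ J o * G)]
  refine add_mem (powerPiece_mono (Finset.subset_univ _) hFG) ?_
  have : linForm (v o) ^ J o * G ∈ powerMultiples v J (s + J o : ℕ) o :=
    mem_powerMultiples.2 ⟨G, by rwa [show ((s + J o : ℕ) : ℤ) - J o = s by push_cast; ring], rfl⟩
  exact (le_iSup₂_of_le (f := fun i (_ : i ∈ Finset.univ) => powerMultiples v J ((s + J o : ℕ) : ℤ) i)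
    o (Finset.mem_univ o) le_rfl) this

end Projection

/-! ### Expected obstructions at an arbitrary point, and injectivity. -/

section ExpectedObstructions
variable {K : Type*} [Field K] {n : ℕ} {ι : Type*}

lemma CoordChange.map_fatIdeal {N : ℕ} (c : CoordChange K N) (P : ι → Submodule K (Fin N → K))
    (B : ι → ℤ) :
    (fatIdeal P B).map c.σ = fatIdeal (fun i => (P i).map c.g.symm.toLinearMap) B := by
  simp only [fatIdeal, c.map_iInf, c.map_fatLinearIdeal]

lemma CoordChange.map_obstructionIdeal {N : ℕ} (c : CoordChange K N)
    (P : ι → Submodule K (Fin N → K)) (k : ι → ℕ) (m : ℕ) (j : ι) (a : ℕ) :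
    (obstructionIdeal P k m j a).map c.σ =
      obstructionIdeal (fun i => (P i).map c.g.symm.toLinearMap) k m j a := by
  simp only [obstructionIdeal, Ideal.map_sup, c.map_inf, c.map_iInf, c.map_fatLinearIdeal,
    Submodule.map_sup, Submodule.map_iSup]

variable [DecidableEq ι] [Fintype ι] {m : ℕ} {v : ι → Fin (n + 2) → K} {j : ι} {k J : ι → ℕ}

/-- At a point there are only the expected linear obstructions if and only if this point imposes
the expected number of conditions. -/
theorem sameSubscheme_obstructionIdeal_iff [Infinite K] (hm : (m.factorial : K) ≠ 0) (hv : ∀ i, v i 0 ≠ 0)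
    (hq : ∀ i, i ≠ j → centralProj (v j) (v i) 0 ≠ 0) (hkJ : ∀ i, k i + J i = m + 1)
    (hJ : ∀ i, 1 ≤ J i) (htriple : ∀ i l, i ≠ l → i ≠ j → l ≠ j → m < J i + J l + J j)
    (hind : Indep (fun i => centralProj (v j) (v i)) J (Finset.univ.erase j) ((k j : ℤ) - 1)) :
    (∀ a < k j, SameSubscheme
      (baseLocusIdeal (fatIdeal (fun i => Submodule.span K {v i})
        (Function.update (fun i => (k i : ℤ)) j (a : ℕ))) m ⊔
        fatLinearIdeal (Submodule.span K {v j}) (a + 1 : ℕ))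
      (obstructionIdeal (fun i => Submodule.span K {v i}) k m j a)) ↔
    (Module.finrank K (gradedPiece (fatIdeal (fun i => Submodule.span K {v i})
        (Function.update (fun i => (k i : ℤ)) j (0 : ℕ))) m) : ℤ) -
      Module.finrank K (gradedPiece (fatIdeal (fun i => Submodule.span K {v i})
        (fun i => (k i : ℤ))) m) =
      numForms (n + 2) ((k j : ℤ) - 1) -
        ∑ i ∈ Finset.univ.erase j, numForms (n + 2) ((k j : ℤ) - 1 - J i) := by
  set c := shearChange (v j) (hv j) with hc
  set w : ι → Fin (n + 2) → K := fun i => c.g.symm (v i) with hw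
  have hspan : ∀ i, (Submodule.span K {v i}).map c.g.symm.toLinearMap = Submodule.span K {w i} := by
    intro i
    rw [Submodule.map_span, Set.image_singleton]
    rfl
  have hw0 : ∀ i, w i 0 = (v j 0)⁻¹ * v i 0 := fun i => by
    rw [hw]
    simp only [hc, shearChange_g_symm, shearFun_zero]
    simp [shearInv]
  have hwq : ∀ i, tailMap K (n + 1) (w i) = (v j 0)⁻¹ • centralProj (v j) (v i) := by
    intro i
    ext a
    have := hv j
    rw [tailMap_apply, hw]
    simp only [hc, shearChange_g_symm, shearFun_succ]
    simp only [shearInv, Fin.cons_succ, Pi.smul_apply, smul_eq_mul, centralProj]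
    field_simp
    ring
  have hwj : w j = coordPoint K (n + 1) := by
    have : c.g (coordPoint K (n + 1)) = v j := shearFun_coordPoint (v j)
    rw [hw]
    dsimp only
    rw [LinearEquiv.symm_apply_eq, this]
  have key := sameSubscheme_obstructionIdeal_iff_of_coordPoint (v := w) (j := j) hm hwj
    (fun i => by rw [hw0]; exact mul_ne_zero (inv_ne_zero (hv j)) (hv i))
    (fun i hi => by
      rw [hwq]
      exact mul_ne_zero (inv_ne_zero (hv j)) (hq i hi)) hkJ hJ htriple (by
      simp only [hwq]
      exact hind.smul (inv_ne_zero (hv j)))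
  have hrank : ∀ B : ι → ℤ,
      Module.finrank K (gradedPiece (fatIdeal (fun i => Submodule.span K {w i}) B) m) =
        Module.finrank K (gradedPiece (fatIdeal (fun i => Submodule.span K {v i}) B) m) := by
    intro B
    rw [← c.finrank_gradedPiece_map (fatIdeal (fun i => Submodule.span K {v i}) B), c.map_fatIdeal,
      funext hspan]
  rw [hrank, hrank] at key
  simp only [← hspan] at key
  simp only [← c.map_fatIdeal, ← c.map_fatLinearIdeal, ← c.map_obstructionIdeal (fun i =>
    Submodule.span K {v i}), c.baseLocusIdeal_map, ← Ideal.map_sup, c.sameSubscheme_map] at key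
  exact key

/-- At a point there are only the expected linear obstructions if and only if multiplication by
the power of the corresponding linear form is injective modulo the other ones. -/
theorem sameSubscheme_obstructionIdeal_iff_injOn [Infinite K] (hm : (m.factorial : K) ≠ 0) (hv : ∀ i, v i 0 ≠ 0)
    (hq : ∀ i, i ≠ j → centralProj (v j) (v i) 0 ≠ 0) (hkJ : ∀ i, k i + J i = m + 1)
    (hJ : ∀ i, 1 ≤ J i) (h : GoodPowers v J m)
    (hind : IndepMod v J (v j) (Finset.univ.erase j) (m - J j)) :
    (∀ a < k j, SameSubscheme
      (baseLocusIdeal (fatIdeal (fun i => Submodule.span K {v i})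
        (Function.update (fun i => (k i : ℤ)) j (a : ℕ))) m ⊔
        fatLinearIdeal (Submodule.span K {v j}) (a + 1 : ℕ))
      (obstructionIdeal (fun i => Submodule.span K {v i}) k m j a)) ↔
    InjOn v J m (Finset.univ.erase j) j := by
  have hk : (m : ℤ) - J j = (k j : ℤ) - 1 := by have := hkJ j; omega
  have htriple : ∀ i l, i ≠ l → i ≠ j → l ≠ j → m < J i + J l + J j := fun i l h1 h2 h3 => by
    have := h.triple i l j h1 h2 h3
    exact_mod_cast this
  rw [indepMod_iff_indep_centralProj (hv j), hk] at hind
  rw [sameSubscheme_obstructionIdeal_iff hm hv hq hkJ hJ htriple hind,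
    ← (h.excess_step (Finset.notMem_erase j Finset.univ)).2,
    Finset.insert_erase (Finset.mem_univ j)]
  have h1 := finrank_gradedPiece_add_finrank_powerPiece hm (v := v) (J := J)
    (X := Finset.univ.erase j) (B := Function.update (fun i => (k i : ℤ)) j (0 : ℕ))
    (fun i hi => by
      rw [Function.update_of_ne (Finset.ne_of_mem_erase hi)]; have := hkJ i; omega)
    (fun i hi => by
      have : i = j := by simpa using hi
      rw [this, Function.update_self]; rfl)
    (fun i _ _ => hv i)
  have h2 := finrank_gradedPiece_add_finrank_powerPiece hm (v := v) (J := J)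
    (X := Finset.univ) (B := fun i => (k i : ℤ)) (fun i _ => by have := hkJ i; omega)
    (fun i hi => absurd (Finset.mem_univ i) hi) (fun i _ _ => hv i)
  have h3 := koszulEuler_insert (fun i => (J i : ℤ)) (Finset.notMem_erase j Finset.univ) (n + 2)
    (m : ℤ)
  rw [Finset.insert_erase (Finset.mem_univ j), koszulEuler_of_lt (fun i => (J i : ℤ))
    (T := Finset.univ.erase j) (fun i _ => by positivity) (n + 2) (s := m - J j)
    (fun i hi l hl hil => by
      have := h.triple i l j hil (Finset.ne_of_mem_erase hi) (Finset.ne_of_mem_erase hl)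
      omega), hk] at h3
  unfold excess
  replace h1 := congrArg (Nat.cast : ℕ → ℤ) h1
  replace h2 := congrArg (Nat.cast : ℕ → ℤ) h2
  rw [Nat.cast_add] at h1 h2
  constructor
  · intro h4; linarith
  · intro h4; linarith

/-- Independence modulo a linear form gives independence as soon as another linear form is prime to
it. Any second point supplies one, so two distinct indices are needed. -/
lemma goodPowers_of_indepMod {o : ι} {i₀ : ι} (hi₀ : i₀ ≠ o) (hv : ∀ i, v i 0 ≠ 0)
    (hq : ∀ i j, i ≠ j → centralProj (v j) (v i) 0 ≠ 0)
    (hind : ∀ j, IndepMod v J (v j) (Finset.univ.erase j) (m - J j))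
    (htriple : ∀ i l j, i ≠ l → i ≠ j → l ≠ j → m < J i + J l + J j) : GoodPowers v J m where
  ne_zero i h0 := hv i (by rw [h0]; rfl)
  triple i l j h1 h2 h3 := by exact_mod_cast htriple i l j h1 h2 h3
  indep j X hj := by
    obtain ⟨l, hl⟩ : ∃ l, l ≠ j := by
      by_cases h : o = j
      · exact ⟨i₀, h ▸ hi₀⟩
      · exact ⟨o, h⟩
    refine Indep.subset ((hind j).indep (w := v l) (fun h0 => hv j (by rw [h0]; rfl)) fun hd => ?_)
      (fun i hi => Finset.mem_erase.2 ⟨by rintro rfl; exact hj hi, Finset.mem_univ i⟩)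
    exact hq l j hl (by rw [centralProj_eq_zero_of_linForm_dvd hd]; rfl)

end ExpectedObstructions

/-! ### Generic properties in polynomial families and along lines. -/

section Genericity
variable {K : Type*} [Field K] [Infinite K] {N : ℕ} {ι : Type*}

/-- A property that holds for generic vectors holds for generic members of a polynomial family that
attains all vectors. -/
lemma Generically.comp {ι' : Type*} {N' : ℕ} {P : (ι → Fin N → K) → Prop} (h : Generically P)
    (Φ : ι → Fin N → MvPolynomial (ι' × Fin N') K)
    (hΦ : ∀ w : ι → Fin N → K, ∃ v : ι' → Fin N' → K,
      ∀ i a, eval (fun ij => v ij.1 ij.2) (Φ i a) = w i a) :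
    Generically fun v : ι' → Fin N' → K => P fun i a => eval (fun ij => v ij.1 ij.2) (Φ i a) := by
  obtain ⟨f, hf, h⟩ := h
  have heval : ∀ (f : MvPolynomial (ι × Fin N) K) (v : ι' → Fin N' → K), eval (fun ij => v ij.1 ij.2)
      (bind₁ (fun ij : ι × Fin N => Φ ij.1 ij.2) f) =
      eval (fun ij : ι × Fin N => eval (fun ij => v ij.1 ij.2) (Φ ij.1 ij.2)) f := by
    intro f v
    induction f using MvPolynomial.induction_on with
    | C a => simp
    | add p q hp hq => simp only [map_add, hp, hq]
    | mul_X p i hp => simp only [map_mul, hp, bind₁_X_right, eval_X]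
  refine ⟨bind₁ (fun ij : ι × Fin N => Φ ij.1 ij.2) f, fun h0 => ?_, fun v hv => ?_⟩
  · obtain ⟨w, hw⟩ : ∃ w, eval w f ≠ 0 := by
      by_contra! h0
      exact hf (MvPolynomial.funext fun w => by rw [h0, map_zero])
    obtain ⟨v, hv⟩ := hΦ fun i a => w (i, a)
    have := heval f v
    rw [h0, map_zero] at this
    simp only [hv] at this
    exact hw this.symm
  · rw [heval] at hv
    exact h _ hv

lemma Generically.comp_perm {P : (ι → Fin N → K) → Prop} (h : Generically P) (e : Equiv.Perm ι) :
    Generically fun v => P fun i => v (e i) := by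
  have := h.comp (fun i a => X (e i, a)) fun w => ⟨fun i => w (e.symm i), fun i a => by simp⟩
  simpa using this

/-- On a line that meets the set of generic vectors all but finitely many points are generic. -/
lemma infinite_setOf_eval_ne_zero {f : MvPolynomial (ι × Fin N) K} {v w : ι → Fin N → K}
    (h : eval (fun ij => v ij.1 ij.2) f ≠ 0) :
    {c : K | eval (fun ij => (v + c • w) ij.1 ij.2) f ≠ 0}.Infinite := by
  set p : Polynomial K := aeval (fun ij : ι × Fin N =>
    Polynomial.C (v ij.1 ij.2) + Polynomial.C (w ij.1 ij.2) * Polynomial.X) f with hp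
  have heval : ∀ c, p.eval c = eval (fun ij => (v + c • w) ij.1 ij.2) f := by
    intro c
    rw [hp]
    clear_value p
    clear hp h
    induction f using MvPolynomial.induction_on with
    | C a => simp
    | add p q hp hq => simp only [map_add, Polynomial.eval_add, hp, hq]
    | mul_X p i hp =>
      simp only [map_mul, Polynomial.eval_mul, hp, aeval_X, eval_X]
      simp only [Polynomial.eval_add, Polynomial.eval_mul, Polynomial.eval_C, Polynomial.eval_X,
        Pi.add_apply, Pi.smul_apply, smul_eq_mul]
      ring
  have hp0 : p ≠ 0 := by
    intro h0
    have := heval 0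
    rw [h0, Polynomial.eval_zero] at this
    simp only [zero_smul, add_zero] at this
    exact h this.symm
  have hfin : {c : K | p.IsRoot c}.Finite := Polynomial.finite_setOfPred_isRoot hp0
  refine hfin.infinite_compl.mono fun c hc => ?_
  rw [Set.mem_ofPred_eq, ← heval]
  exact hc

end Genericity

/-! ### Generic independence of the projections from all the points. -/

section Configurations
variable {K : Type*} [Field K] {n d : ℕ}

lemma Indep.map {ι ι' : Type*} {N : ℕ} {v : ι → Fin N → K} {J : ι → ℕ} {s : ℤ} (e : ι' ↪ ι)
    {X : Finset ι'} (h : Indep (fun i => v (e i)) (fun i => J (e i)) X s) :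
    Indep v J (X.map e) s := by
  intro g hg hsum i hi
  obtain ⟨i', hi', rfl⟩ := Finset.mem_map.1 hi
  rw [Finset.sum_map] at hsum
  exact h (fun i => g (e i)) (fun i => hg _) hsum i' hi'

lemma univ_map_castSuccEmb : Finset.univ.map (Fin.castSuccEmb (n := d)) =
    Finset.univ.erase (Fin.last d) := by
  ext i
  refine Fin.lastCases ?_ (fun i => ?_) i
  · simp [Fin.castSucc_ne_last]
  · simp [Fin.castSucc_ne_last]

lemma IndepMod.congr {ι : Type*} {N : ℕ} {v v' : ι → Fin N → K} {J : ι → ℕ} {y : Fin N → K}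
    {X : Finset ι} {s : ℤ} (h : IndepMod v J y X s) (hv : ∀ i ∈ X, v' i = v i) :
    IndepMod v' J y X s := by
  intro g hg hd
  refine h g hg ?_
  rwa [Finset.sum_congr rfl fun i hi => by rw [← hv i hi]]

variable {J : Fin (d + 1) → ℕ}

lemma generically_centralProj_ne_zero {ι : Type*} [DecidableEq ι] {i j : ι} (h : i ≠ j) (a : Fin n) :
    Generically fun v : ι → Fin (n + 1) → K => centralProj (v j) (v i) a ≠ 0 := by
  refine ⟨X (j, 0) * X (i, a.succ) - X (j, a.succ) * X (i, 0), fun h0 => ?_, fun v hv => ?_⟩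
  · have := congrArg (eval fun ij : ι × Fin (n + 1) => if ij = (j, 0) ∨ ij = (i, a.succ) then (1 : K)
      else 0) h0
    simp [h, Fin.succ_ne_zero, h.symm] at this
  · simpa [centralProj] using hv

/-- The projection of points is independent, from each of the points. -/
structure GeneralPosition {ι : Type*} [Fintype ι] [DecidableEq ι] (v : ι → Fin (n + 2) → K)
    (J : ι → ℕ) (m : ℤ) : Prop where
  coord_ne_zero : ∀ i, v i 0 ≠ 0
  centralProj_ne_zero : ∀ i j, i ≠ j → centralProj (v j) (v i) 0 ≠ 0
  indepMod : ∀ j, IndepMod v J (v j) (Finset.univ.erase j) (m - J j)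

/-- The projection is polynomial in the configuration and attains every tuple, for instance with
centre (1, 0, …, 0). -/
lemma generically_centralProj_last [Infinite K] {P : (Fin d → Fin n → K) → Prop}
    (h : Generically P) : Generically fun v : Fin (d + 1) → Fin (n + 1) → K =>
      P fun i => centralProj (v (Fin.last d)) (v i.castSucc) := by
  have := h.comp (fun (i : Fin d) (a : Fin n) =>
    (X (Fin.last d, (0 : Fin (n + 1))) * X (i.castSucc, a.succ) -
      X (Fin.last d, a.succ) * X (i.castSucc, 0) : MvPolynomial (Fin (d + 1) × Fin (n + 1)) K))
    fun w => ⟨Fin.snoc (fun i => Fin.cons 0 (w i)) (Fin.cons 1 0 : Fin (n + 1) → K), fun i a => by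
      simp⟩
  refine this.mono fun v hv => ?_
  simp only [map_sub, map_mul, eval_X] at hv
  exact hv

/-- If the projection from the last point is generically independent, then so is the projection
from every other point. -/
theorem generically_indepMod [Infinite K] (hJo : ∀ j, J (Fin.last d) ≤ J j) {m : ℤ}
    (h : Generically fun q : Fin d → Fin (n + 1) → K =>
      Indep q (fun i => J i.castSucc) Finset.univ (m - J (Fin.last d))) :
    Generically fun v : Fin (d + 1) → Fin (n + 2) → K =>
      GeneralPosition v J m := by
  set o := Fin.last d with ho
  have h0 : Generically fun v : Fin (d + 1) → Fin (n + 2) → K => ∀ i, v i 0 ≠ 0 :=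
    generically_forall fun i => generically_coord_ne_zero i 0
  have h1 : Generically fun v : Fin (d + 1) → Fin (n + 2) → K =>
      ∀ i j, i ≠ j → centralProj (v j) (v i) 0 ≠ 0 := by
    refine generically_forall fun i => generically_forall fun j => ?_
    by_cases hij : i = j
    · exact generically_of_forall fun v hv => absurd hij hv
    · exact (generically_centralProj_ne_zero hij 0).mono fun v hv _ => hv
  have h2 : Generically fun v : Fin (d + 1) → Fin (n + 2) → K => 
      (∀ i, v i 0 ≠ 0) → IndepMod v J (v o) (Finset.univ.erase o) (m - J o) := by
    refine (generically_centralProj_last h).mono fun v hv hv0 => ?_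
    rw [indepMod_iff_indep_centralProj (hv0 o), ← univ_map_castSuccEmb]
    exact Indep.map _ hv
  -- Exchanging p_o and p_j makes p_j the centre, while the exponents stay where they are; the
  -- transfer between centres then puts the exponents right.
  have h3 : Generically fun v : Fin (d + 1) → Fin (n + 2) → K => 
      ∀ j, (∀ i, v (Equiv.swap o j i) 0 ≠ 0) → IndepMod (fun i => v (Equiv.swap o j i)) J
        (v (Equiv.swap o j o)) (Finset.univ.erase o) (m - J o) :=
    generically_forall fun j => h2.comp_perm (Equiv.swap o j)
  refine ((h0.and h1).and h3).mono ?_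
  rintro v ⟨⟨h0, h1⟩, h3⟩
  refine ⟨h0, h1, fun j => ?_⟩
  have h4 := h3 j fun i => h0 _
  rw [Equiv.swap_apply_left] at h4
  by_cases hj : j = o
  · subst hj
    refine h4.congr fun i _ => ?_
    rw [Equiv.swap_self]; rfl
  · refine indepMod_of_indepMod_update (fun h => h0 j (by rw [h]; rfl)) hj (hJo j)
      (fun hd => h1 o j (Ne.symm hj) (by rw [centralProj_eq_zero_of_linForm_dvd hd]; rfl)) ?_
    refine h4.congr fun i hi => ?_
    have hio := Finset.ne_of_mem_erase hi
    by_cases hij : i = j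
    · subst hij
      rw [Function.update_self, Equiv.swap_apply_right]
    · rw [Function.update_of_ne hij, Equiv.swap_apply_of_ne_of_ne hio hij]

end Configurations

/-! ### Injectivity modulo fewer powers at generic points. -/

section Descent
variable {K : Type*} [Field K] {n d : ℕ} {J : Fin (d + 1) → ℕ} {m : ℤ}

lemma linearIndependent_pair_of_centralProj_ne_zero {y w : Fin (n + 1) → K} (hy : y 0 ≠ 0)
    {a : Fin n} (h : centralProj y w a ≠ 0) : LinearIndependent K ![y, w] := by
  rw [LinearIndependent.pair_iff]
  intro s t hst
  have h0 := congrFun hst 0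
  have ha := congrFun hst a.succ
  simp only [Pi.add_apply, Pi.smul_apply, smul_eq_mul, Pi.zero_apply] at h0 ha
  have ht : t * centralProj y w a = 0 := by
    rw [centralProj]; linear_combination y 0 * ha - y a.succ * h0
  have ht0 : t = 0 := (mul_eq_zero.1 ht).resolve_right h
  subst ht0
  rw [zero_mul, add_zero] at h0
  exact ⟨(mul_eq_zero.1 h0).resolve_right hy, rfl⟩

lemma add_smul_single_eq_update {ι V : Type*} [DecidableEq ι] [AddCommGroup V] [Module K V]
    (v : ι → V) (a : ι) (x : V) (c : K) :
    v + c • (Pi.single a x : ι → V) = Function.update v a (v a + c • x) := by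
  ext1 i
  by_cases h : i = a
  · subst h; simp
  · simp [h]

/-- Generic injectivity modulo all the other powers implies generic injectivity modulo fewer. -/
theorem generically_injOn [Infinite K] (hJ : ∀ i, 1 ≤ J i)
    (hgood : Generically fun v : Fin (d + 1) → Fin (n + 2) → K => GeneralPosition v J m)
    {j : Fin (d + 1)} (h : Generically fun v : Fin (d + 1) → Fin (n + 2) → K =>
      InjOn v J m (Finset.univ.erase j) j) (X : Finset (Fin (d + 1))) (hj : j ∉ X) :
    Generically fun v : Fin (d + 1) → Fin (n + 2) → K => InjOn v J m X j := by
  suffices H : ∀ r : ℕ, ∀ X : Finset (Fin (d + 1)), j ∉ X → X.card + r = d →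
      Generically fun v : Fin (d + 1) → Fin (n + 2) → K => InjOn v J m X j by
    have hle : X.card ≤ d := by
      have := Finset.card_le_card (Finset.subset_univ (insert j X))
      rw [Finset.card_insert_of_notMem hj, Finset.card_univ, Fintype.card_fin] at this
      omega
    exact H (d - X.card) X hj (by omega)
  intro r
  induction r with
  | zero =>
    intro X hj hX
    have hXe : X = Finset.univ.erase j := by
      refine Finset.eq_of_subset_of_card_le (fun i hi => Finset.mem_erase.2
        ⟨by rintro rfl; exact hj hi, Finset.mem_univ i⟩) ?_
      rw [Finset.card_erase_of_mem (Finset.mem_univ j), Finset.card_univ, Fintype.card_fin]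
      omega
    rwa [hXe]
  | succ r ih =>
    intro X hj hX
    obtain ⟨a, ha⟩ : ∃ a, a ∉ insert j X := by
      by_contra! h0
      have := Finset.card_le_card (fun i (_ : i ∈ Finset.univ) => h0 i)
      rw [Finset.card_insert_of_notMem hj, Finset.card_univ, Fintype.card_fin] at this
      omega
    rw [Finset.mem_insert, not_or] at ha
    obtain ⟨haj, haX⟩ := ha
    -- The polynomial f for the larger set also serves for X: if f is nonzero at v, then it is
    -- nonzero at infinitely many points of the two lines along which v a and v j are moved.
    obtain ⟨f, hf, hgen⟩ := (ih (insert a X)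
      (by rw [Finset.mem_insert, not_or]; exact ⟨Ne.symm haj, hj⟩)
      (by rw [Finset.card_insert_of_notMem haX]; omega)).and hgood
    refine ⟨f, hf, fun v hv => ?_⟩
    obtain ⟨-, h0, h1, -⟩ := hgen v hv
    refine injOn_of_injOn_insert haX (Ne.symm haj) (Nat.one_le_iff_ne_zero.1 (hJ a))
      (linearIndependent_pair_of_centralProj_ne_zero (h0 j) (h1 a j haj))
      (infinite_setOf_eval_ne_zero (w := Pi.single a (-v j)) hv)
      (infinite_setOf_eval_ne_zero (w := Pi.single j (v a)) hv) ?_ ?_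
    · intro c hc
      rw [Set.mem_ofPred_eq, add_smul_single_eq_update, smul_neg, ← sub_eq_add_neg] at hc
      exact (hgen _ hc).1
    · intro t ht
      rw [Set.mem_ofPred_eq, add_smul_single_eq_update] at ht
      have h2 := (hgen _ ht).2.indepMod j
      rw [Function.update_self] at h2
      refine (h2.subset (X := insert a X) fun i hi => ?_).congr fun i hi => ?_
      · refine Finset.mem_erase.2 ⟨?_, Finset.mem_univ i⟩
        rintro rfl
        rcases Finset.mem_insert.1 hi with h | h
        · exact haj h.symm
        · exact hj h
      · rw [Function.update_of_ne]
        rintro rfl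
        rcases Finset.mem_insert.1 hi with h | h
        · exact haj h.symm
        · exact hj h

end Descent

/-! ### The generic Hilbert function through powers of linear forms. -/

section HilbertFunction
variable {K : Type*} [Field K] {n d : ℕ}

lemma numForms_natCast (N m : ℕ) : numForms N m = (N.multichoose m : ℤ) := by simp [numForms]

lemma hilbertFunction_le {N : ℕ} (I : Ideal (MvPolynomial (Fin N) K)) (m : ℕ) :
    hilbertFunction I m ≤ N.multichoose m := by
  rw [hilbertFunction, finrank_homogeneousSubmodule]
  exact Nat.sub_le _ _

lemma hpts_le_multichoose [Infinite K] (A : Fin d → ℤ) (m : ℕ) :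
    HPTS K d A (n + 1) m ≤ (n + 1).multichoose m := by
  obtain ⟨v, hv⟩ := (generically_hilbertFunction_eq (K := K) (n := n) (m := m) A).exists
  rw [← hv]
  exact hilbertFunction_le _ _

lemma hpts_eq_of_generically [Infinite K] {A : Fin d → ℤ} {m r : ℕ}
    (h : Generically fun v : Fin d → Fin (n + 1) → K =>
      hilbertFunction (fatIdeal (fun i => Submodule.span K {v i}) A) m = r) :
    HPTS K d A (n + 1) m = r := by
  obtain ⟨v, h1, h2⟩ := (h.and (generically_hilbertFunction_eq A)).exists
  rw [← h1, ← h2]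

/-- The Hilbert function as the dimension of a space of multiples of powers of linear forms. -/
lemma hilbertFunction_eq_finrank_powerPiece {m : ℕ} (hm : (m.factorial : K) ≠ 0)
    {v : Fin d → Fin (n + 1) → K} (hv : ∀ i, v i 0 ≠ 0) {A : Fin d → ℤ} {J : Fin d → ℕ}
    (hA : ∀ i, A i = m + 1 - J i) :
    hilbertFunction (fatIdeal (fun i => Submodule.span K {v i}) A) m =
      Module.finrank K (powerPiece v J Finset.univ m) := by
  have := finrank_gradedPiece_add_finrank_powerPiece hm (v := v) (J := J) (B := A)
    (X := Finset.univ) (fun i _ => hA i) (fun i hi => absurd (Finset.mem_univ i) hi)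
    (fun i _ _ => hv i)
  rw [hilbertFunction, finrank_homogeneousSubmodule]
  omega

lemma ne_zero_of_coord_ne_zero {v : Fin (n + 1) → K} (h : v 0 ≠ 0) : v ≠ 0 := fun h0 =>
  h (by rw [h0]; rfl)

lemma hpts_le_sum_numForms [Infinite K] {s : ℕ} (hs : (s.factorial : K) ≠ 0) {A : Fin d → ℤ}
    {J : Fin d → ℕ} (hA : ∀ i, A i = s + 1 - J i) :
    (HPTS K d A (n + 1) s : ℤ) ≤ ∑ i, numForms (n + 1) (s - J i) := by
  obtain ⟨v, h1, h2⟩ := ((generically_hilbertFunction_eq (K := K) (n := n) (m := s) A).and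
    (generically_forall fun i => generically_coord_ne_zero i 0)).exists
  rw [← h1, hilbertFunction_eq_finrank_powerPiece hs h2 hA]
  exact finrank_powerPiece_le fun i _ => ne_zero_of_coord_ne_zero (h2 i)

lemma generically_indep_of_hpts_eq [Infinite K] {s : ℕ} (hs : (s.factorial : K) ≠ 0)
    {A : Fin d → ℤ} {J : Fin d → ℕ} (hA : ∀ i, A i = s + 1 - J i)
    (h : (HPTS K d A (n + 1) s : ℤ) = ∑ i, numForms (n + 1) (s - J i)) :
    Generically fun q : Fin d → Fin (n + 1) → K => Indep q J Finset.univ s := by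
  refine ((generically_hilbertFunction_eq (K := K) (n := n) (m := s) A).and
    (generically_forall fun i => generically_coord_ne_zero i 0)).mono ?_
  rintro v ⟨h1, h2⟩
  refine indep_of_finrank_powerPiece (fun i _ => ne_zero_of_coord_ne_zero (h2 i)) ?_
  rw [← h, ← h1, hilbertFunction_eq_finrank_powerPiece hs h2 hA]

end HilbertFunction

/-! ### Numerical consequences of the hypotheses. -/

section Numerics

lemma numForms_mono (N : ℕ) {s t : ℤ} (h : s ≤ t) : numForms (N + 1) s ≤ numForms (N + 1) t := by
  obtain ⟨w, rfl⟩ : ∃ w : ℕ, t = s + w := ⟨(t - s).toNat, by omega⟩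
  clear h
  induction w with
  | zero => simp
  | succ w ih =>
    refine ih.trans ?_
    rw [numForms_succ N (s + (w + 1 : ℕ)), show s + (w + 1 : ℕ) - 1 = s + w by push_cast; ring]
    have := numForms_nonneg N (s + (w + 1 : ℕ))
    omega

lemma koszulEuler_map {ι ι' : Type*} [DecidableEq ι] [DecidableEq ι'] (e : ι' ↪ ι) (u : ι → ℤ)
    (T : Finset ι') (N : ℕ) (s : ℤ) :
    koszulEuler u (T.map e) N s = koszulEuler (fun i => u (e i)) T N s := by
  induction T using Finset.induction_on generalizing s with
  | empty => rw [Finset.map_empty, koszulEuler_empty, koszulEuler_empty]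
  | insert i T hi ih =>
    rw [Finset.map_insert, koszulEuler_insert _ (by simpa using hi), koszulEuler_insert _ hi, ih, ih]

/-- Adding the last index to T' turns its alternating sum at s + J_{d+1} into the difference of the
values at s + J_{d+1} and s, which is nonpositive for a suitable T'. -/
lemma exists_frobergSum_nonpos {d N s : ℕ} {J : Fin (d + 1) → ℕ} (hJ : ∀ i, 1 ≤ J i)
    (hJo : ∀ i, J (Fin.last d) ≤ J i)
    (hpair : ∀ i l : Fin d, i ≠ l → s < J i.castSucc + J l.castSucc)
    (h : ∃ T : Finset (Fin d), frobergSum (fun i => (J i.castSucc : ℤ)) T N s ≤ 0) :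
    ∃ T : Finset (Fin (d + 1)), frobergSum (fun i => (J i : ℤ)) T (N + 1) (s + J (Fin.last d)) ≤ 0 := by
  obtain ⟨T, hT⟩ := h
  rw [frobergSum_eq_koszulEuler] at hT
  obtain ⟨T', -, h'⟩ := exists_subset_koszulEuler_le (u := fun i : Fin d => (J i.castSucc : ℤ))
    (fun i => by exact_mod_cast hJ _) (Int.natCast_nonneg s) N T (J (Fin.last d))
    (fun i _ l _ hil => by exact_mod_cast hpair i l hil) (fun i _ => by exact_mod_cast hJo _) hT
  refine ⟨insert (Fin.last d) (T'.map Fin.castSuccEmb), ?_⟩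
  rw [frobergSum_eq_koszulEuler, koszulEuler_insert _ (by simp [Fin.castSucc_ne_last]),
    koszulEuler_map, koszulEuler_map]
  simp only [Fin.coe_castSuccEmb]
  push_cast
  rw [add_sub_cancel_right]
  linarith

lemma froberg_eq_zero {d : ℕ} {A : Fin d → ℤ} {N m : ℕ}
    (h : ∃ T : Finset (Fin d), frobergSum A T N m ≤ 0) : froberg d A N m = 0 := if_pos h

lemma froberg_eq_frobergSum {d : ℕ} {A : Fin d → ℤ} {N m : ℕ}
    (h : ¬ ∃ T : Finset (Fin d), frobergSum A T N m ≤ 0) :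
    froberg d A N m = frobergSum A Finset.univ N m := if_neg h

/-- At most one of three distinct indices is the last one, so their k's add up to at most 2 k_d +
k_{d+1} ≤ 2m + 2. Counted from 0, the index d - 1 stands for k_d. -/
lemma triple_sum_lt {d m : ℕ} (hd : 1 ≤ d) {k J : Fin (d + 1) → ℕ} (hmono : Monotone k)
    (hnum : 2 * k ⟨d - 1, by omega⟩ + k (Fin.last d) ≤ 2 * m + 2) (hkJ : ∀ i, k i + J i = m + 1)
    (i l j : Fin (d + 1)) (hil : i ≠ l) (hij : i ≠ j) (hlj : l ≠ j) : m < J i + J l + J j := by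
  have h1 : ∀ x, k x ≤ k (Fin.last d) := fun x => hmono (Fin.le_last x)
  have h2 : ∀ x, x ≠ Fin.last d → k x ≤ k ⟨d - 1, by omega⟩ := fun x hx => hmono (by
    have h3 : x.val ≠ d := fun h => hx (Fin.ext h)
    rw [Fin.le_def]
    have := x.isLt
    dsimp only
    omega)
  have ei := hkJ i
  have el := hkJ l
  have ej := hkJ j
  have bi := h1 i
  have bl := h1 l
  have bj := h1 j
  by_cases hi : i = Fin.last d
  · have := h2 l (fun h => hil (hi.trans h.symm))
    have := h2 j (fun h => hij (hi.trans h.symm))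
    omega
  · have := h2 i hi
    by_cases hl : l = Fin.last d
    · have := h2 j (fun h => hlj (hl.trans h.symm))
      omega
    · have := h2 l hl
      omega

lemma frobergIarrobino_eq {d N m : ℕ} {A : Fin d → ℤ} {J : Fin d → ℕ}
    (hA : ∀ i, A i = m + 1 - J i) : frobergIarrobino d A N m =
    numForms N m - froberg d (fun i => (J i : ℤ)) N m := by
  rw [frobergIarrobino]
  congr 2
  ext i
  have := hA i
  omega

end Numerics

/-! ### The three assertions for generic points when m! is invertible. -/

section GenericConfigurations
variable {K : Type*} [Field K] {n d m : ℕ} {k J : Fin (d + 1) → ℕ}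

lemma GeneralPosition.goodPowers {v : Fin (d + 1) → Fin (n + 2) → K} (h : GeneralPosition v J m)
    (hd : 1 ≤ d) (htriple : ∀ i l j, i ≠ l → i ≠ j → l ≠ j → m < J i + J l + J j) :
    GoodPowers v J m :=
  goodPowers_of_indepMod (o := Fin.last d) (i₀ := 0) (fun h0 => by
    have := congrArg Fin.val h0
    simp at this
    omega) h.coord_ne_zero h.centralProj_ne_zero h.indepMod htriple

lemma GeneralPosition.onlyExpectedLinearObstructions_iff [Infinite K] {v : Fin (d + 1) → Fin (n + 2) → K}
    (h : GeneralPosition v J m) (hgood : GoodPowers v J m) (hm : (m.factorial : K) ≠ 0)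
    (hkJ : ∀ i, k i + J i = m + 1) (hJ : ∀ i, 1 ≤ J i) (hv : ∀ i, v i ≠ 0) :
    OnlyExpectedLinearObstructions (fun i => Projectivization.mk K (v i) (hv i)) k m ↔
      ∀ j, InjOn v J m (Finset.univ.erase j) j := by
  refine forall_congr' fun j => ?_
  rw [← sameSubscheme_obstructionIdeal_iff_injOn hm h.coord_ne_zero
    (fun i hi => h.centralProj_ne_zero i j hi) hkJ hJ hgood (h.indepMod j)]
  -- The multiplicity l of the definition corresponds to the vanishing order a = l - 1.
  have key : ∀ a : ℕ, SameSubscheme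
      (baseLocusIdeal (previousIdeal (fun i => Projectivization.mk K (v i) (hv i)) k j (a + 1)) m ⊔
        fatLinearIdeal (Projectivization.mk K (v j) (hv j)).submodule (a + 1 : ℕ))
      (expectedObstructionIdeal (fun i => Projectivization.mk K (v i) (hv i)) k m j (a + 1)) ↔
      SameSubscheme
      (baseLocusIdeal (fatIdeal (fun i => Submodule.span K {v i})
        (Function.update (fun i => (k i : ℤ)) j (a : ℕ))) m ⊔
        fatLinearIdeal (Submodule.span K {v j}) (a + 1 : ℕ))
      (obstructionIdeal (fun i => Submodule.span K {v i}) k m j a) := by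
    intro a
    have h1 : ((a + 1 : ℕ) : ℤ) - 1 = a := by push_cast; ring
    have h2 : ∀ T : Finset (Fin (d + 1)), ((a + 1 : ℕ) : ℤ) + ∑ i ∈ T, (k i : ℤ) - T.card * m - 1 =
        a + ∑ i ∈ T, (k i : ℤ) - T.card * m := fun T => by push_cast; ring
    simp only [previousIdeal, expectedObstructionIdeal, obstructionIdeal, fatPointsIdeal_mk,
      Projectivization.submodule_mk, h1, h2]
  constructor
  · intro H a ha
    exact (key a).1 (H (a + 1) (by omega) ha)
  · intro H l hl hlk
    obtain ⟨a, rfl⟩ : ∃ a, l = a + 1 := ⟨l - 1, by omega⟩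
    exact (key a).2 (H a hlk)

variable [Infinite K] (hm : (m.factorial : K) ≠ 0) (hd : 1 ≤ d) (hkJ : ∀ i, k i + J i = m + 1)
  (htriple : ∀ i l j, i ≠ l → i ≠ j → l ≠ j → m < J i + J l + J j)
  (hgen : Generically fun v : Fin (d + 1) → Fin (n + 2) → K => GeneralPosition v J m)
include hm hd hkJ htriple hgen

/-- The Hilbert function of generic points as the expected value plus the excess. -/
lemma generically_hpts_eq_sub_excess :
    Generically fun v : Fin (d + 1) → Fin (n + 2) → K => GeneralPosition v J m ∧ GoodPowers v J m ∧
      (HPTS K (d + 1) (fun i => (k i : ℤ)) (n + 2) m : ℤ) =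
        Module.finrank K (powerPiece v J Finset.univ m) := by
  refine (hgen.and (generically_hilbertFunction_eq (m := m) (fun i => (k i : ℤ)))).mono ?_
  rintro v ⟨h1, h2⟩
  refine ⟨h1, h1.goodPowers hd htriple, ?_⟩
  rw [← h2, hilbertFunction_eq_finrank_powerPiece hm h1.coord_ne_zero (J := J)
    (fun i => by have := hkJ i; omega)]

lemma hpts_le_frobergIarrobino :
    (HPTS K (d + 1) (fun i => (k i : ℤ)) (n + 2) m : ℤ) ≤
      frobergIarrobino (d + 1) (fun i => (k i : ℤ)) (n + 2) m := by
  rw [frobergIarrobino_eq (J := J) (fun i => by have := hkJ i; omega)]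
  by_cases hF : ∃ T : Finset (Fin (d + 1)), frobergSum (fun i => (J i : ℤ)) T (n + 2) m ≤ 0
  · rw [froberg_eq_zero hF, sub_zero, numForms_natCast]
    exact_mod_cast hpts_le_multichoose _ _
  · obtain ⟨v, -, h1, h2⟩ := (generically_hpts_eq_sub_excess hm hd hkJ htriple hgen).exists
    rw [froberg_eq_frobergSum hF, frobergSum_eq_koszulEuler, h2]
    have := h1.excess_nonneg Finset.univ
    unfold excess at this
    linarith

/-- Expected obstructions at all points give injectivity modulo all other powers, then by descent
modulo every X; so the excess is zero for every set of indices, which also controls the truncation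
in F. -/
lemma hpts_eq_frobergIarrobino (hJ : ∀ i, 1 ≤ J i)
    (hOE : ForGeneric fun p : Fin (d + 1) → ProjPoint K (n + 2) =>
      OnlyExpectedLinearObstructions p k m) :
    (HPTS K (d + 1) (fun i => (k i : ℤ)) (n + 2) m : ℤ) =
      frobergIarrobino (d + 1) (fun i => (k i : ℤ)) (n + 2) m := by
  have h1 : ∀ j, Generically fun v : Fin (d + 1) → Fin (n + 2) → K =>
      InjOn v J m (Finset.univ.erase j) j := by
    intro j
    refine ((forGeneric_iff.1 hOE).and hgen).mono ?_
    rintro v ⟨h1, h2⟩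
    have hv : ∀ i, v i ≠ 0 := fun i => ne_zero_of_coord_ne_zero (h2.coord_ne_zero i)
    exact (h2.onlyExpectedLinearObstructions_iff (h2.goodPowers hd htriple) hm hkJ hJ hv).1 (h1 hv) j
  have h2 : Generically fun v : Fin (d + 1) → Fin (n + 2) → K =>
      ∀ (X : Finset (Fin (d + 1))) (j), j ∉ X → InjOn v J m X j := by
    refine generically_forall fun X => generically_forall fun j => ?_
    by_cases hj : j ∈ X
    · exact generically_of_forall fun v h => absurd hj h
    · exact (generically_injOn hJ hgen (h1 j) X hj).mono fun v hv _ => hv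
  obtain ⟨v, hinj, -, hgood, hH⟩ :=
    (h2.and (generically_hpts_eq_sub_excess hm hd hkJ htriple hgen)).exists
  have h0 := hgood.excess_eq_zero hinj
  rw [frobergIarrobino_eq (J := J) (fun i => by have := hkJ i; omega), hH]
  by_cases hF : ∃ T : Finset (Fin (d + 1)), frobergSum (fun i => (J i : ℤ)) T (n + 2) m ≤ 0
  · rw [froberg_eq_zero hF, sub_zero]
    -- The excess of T is zero, so the codimension for T equals a nonpositive alternating sum:
    -- already the powers in T span all forms of degree m.
    obtain ⟨T, hT⟩ := hF
    rw [frobergSum_eq_koszulEuler] at hT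
    have h3 := h0 T
    unfold excess at h3
    have h4 : Module.finrank K (powerPiece v J T m) ≤
        Module.finrank K (powerPiece v J Finset.univ m) :=
      Submodule.finrank_mono (powerPiece_mono (Finset.subset_univ T))
    have h5 : Module.finrank K (powerPiece v J Finset.univ m) ≤
        Module.finrank K (forms K (n + 2) m) :=
      Submodule.finrank_mono (powerPiece_le_forms _)
    have h6 := finrank_forms (K := K) (N := n + 2) (m : ℤ)
    zify at h4 h5
    linarith
  · rw [froberg_eq_frobergSum hF, frobergSum_eq_koszulEuler]
    have h3 := h0 Finset.univ
    unfold excess at h3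
    linarith

/-- The strict inequality excludes the truncation of F. Equality then says that the excess of the
full set is zero, and by monotonicity multiplication is injective at every step. -/
lemma forGeneric_onlyExpectedLinearObstructions (hJ : ∀ i, 1 ≤ J i)
    (hlt : frobergIarrobino (d + 1) (fun i => (k i : ℤ)) (n + 2) m < numForms (n + 2) m)
    (heq : (HPTS K (d + 1) (fun i => (k i : ℤ)) (n + 2) m : ℤ) =
      frobergIarrobino (d + 1) (fun i => (k i : ℤ)) (n + 2) m) :
    ForGeneric fun p : Fin (d + 1) → ProjPoint K (n + 2) =>
      OnlyExpectedLinearObstructions p k m := by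
  rw [frobergIarrobino_eq (J := J) (fun i => by have := hkJ i; omega)] at hlt heq
  by_cases hF : ∃ T : Finset (Fin (d + 1)), frobergSum (fun i => (J i : ℤ)) T (n + 2) m ≤ 0
  · rw [froberg_eq_zero hF, sub_zero] at hlt
    exact absurd hlt (lt_irrefl _)
  · rw [froberg_eq_frobergSum hF, frobergSum_eq_koszulEuler] at heq
    refine forGeneric_iff.2 ((generically_hpts_eq_sub_excess hm hd hkJ htriple hgen).mono ?_)
    rintro v ⟨h1, h2, h3⟩ hv
    rw [h1.onlyExpectedLinearObstructions_iff h2 hm hkJ hJ hv]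
    have h0 : excess v J m Finset.univ = 0 := by
      unfold excess
      linarith
    exact fun j => h2.injOn_of_excess_eq_zero h0 (Finset.notMem_erase j _) (Finset.subset_univ _)

end GenericConfigurations

/-! ### Degenerate cases, in which no m-ics remain. -/

section SpecialCases
variable {K : Type*} [Field K] [Infinite K] {n d m : ℕ}

lemma hpts_eq_multichoose_of_lt {A : Fin d → ℤ} {o : Fin d} (h : (m : ℤ) < A o) :
    HPTS K d A (n + 1) m = (n + 1).multichoose m := by
  refine hpts_eq_of_generically ((generically_coord_ne_zero o 0).mono fun v hv => ?_)
  have h0 : gradedPiece (fatIdeal (fun i => Submodule.span K {v i}) A) m = ⊥ := by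
    rw [eq_bot_iff]
    intro F hF
    obtain ⟨h1, h2⟩ := mem_gradedPiece_fatIdeal.1 hF
    have h3 := (mem_linearIdeal_span_pow_iff hv h1).1 (h2 o)
    rw [Submodule.mem_bot]
    have h4 : shear (v o) F = 0 := by
      have h5 := shear_isHomogeneous (v o) h1
      ext β
      rw [coeff_zero]
      by_cases hβ : β.degree = m
      · exact h3 ⟨β, mem_finsuppAntidiag_univ.2 hβ⟩ (by dsimp only; omega)
      · exact h5.coeff_eq_zero hβ
    exact (map_eq_zero_iff (shear (v o)) (shearChange (v o) hv).σ.injective).1 h4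
  rw [hilbertFunction, h0, finrank_bot, Nat.sub_zero, finrank_homogeneousSubmodule]

lemma exists_frobergSum_nonpos_of_nonpos {A : Fin d → ℤ} {o : Fin d} (h : A o ≤ 0) :
    ∃ T : Finset (Fin d), frobergSum A T (n + 1) m ≤ 0 := by
  refine ⟨insert o ∅, ?_⟩
  rw [frobergSum_eq_koszulEuler, koszulEuler_insert _ (Finset.notMem_empty o), koszulEuler_empty,
    koszulEuler_empty]
  have := numForms_mono n (show (m : ℤ) ≤ m - A o by omega)
  omega

lemma powerPiece_comp_le {ι ι' : Type*} {N : ℕ} {v : ι → Fin N → K} {J : ι → ℕ} {s : ℤ}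
    (e : ι' ↪ ι) (X : Finset ι') :
    powerPiece (fun i => v (e i)) (fun i => J (e i)) X s ≤ powerPiece v J (X.map e) s :=
  iSup₂_le fun i hi => le_iSup₂_of_le (f := fun i (_ : i ∈ X.map e) => powerMultiples v J s i)
    (e i) (Finset.mem_map_of_mem e hi) le_rfl

/-- If there are no forms through the generic projected points, then there are no forms through
the generic points. -/
lemma hpts_eq_multichoose_of_hpts_eq {s : ℕ} {J : Fin (d + 1) → ℕ} (hm : (m.factorial : K) ≠ 0)
    (hs : (s.factorial : K) ≠ 0) (hsm : s + J (Fin.last d) = m) {A : Fin (d + 1) → ℤ}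
    {C : Fin d → ℤ} (hA : ∀ i, A i = m + 1 - J i) (hC : ∀ i, C i = s + 1 - J i.castSucc)
    (h : HPTS K d C (n + 1) s = (n + 1).multichoose s) :
    HPTS K (d + 1) A (n + 2) m = (n + 2).multichoose m := by
  have h1 : Generically fun q : Fin d → Fin (n + 1) → K =>
      forms K (n + 1) s ≤ powerPiece q (fun i => J i.castSucc) Finset.univ s := by
    refine ((generically_hilbertFunction_eq (K := K) (n := n) (m := s) C).and
      (generically_forall fun i => generically_coord_ne_zero i 0)).mono ?_
    rintro q ⟨h1, h2⟩
    rw [h, hilbertFunction_eq_finrank_powerPiece hs h2 hC] at h1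
    refine (Submodule.eq_of_le_of_finrank_eq (powerPiece_le_forms _) ?_).ge
    rw [h1, forms_natCast, finrank_homogeneousSubmodule]
  refine hpts_eq_of_generically (((generically_centralProj_last h1).and
    (generically_forall fun i => generically_coord_ne_zero i 0)).mono ?_)
  rintro v ⟨h2, h3⟩
  rw [hilbertFunction_eq_finrank_powerPiece hm h3 hA]
  have h4 : forms K (n + 2) (s + J (Fin.last d) : ℕ) ≤
      powerPiece v J Finset.univ (s + J (Fin.last d) : ℕ) := by
    refine forms_le_powerPiece_of_centralProj (h3 _) (h2.trans ?_)
    rw [← univ_map_castSuccEmb]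
    exact powerPiece_comp_le (v := fun i => centralProj (v (Fin.last d)) (v i)) (J := J)
      Fin.castSuccEmb Finset.univ
  rw [hsm] at h4
  rw [(powerPiece_le_forms _).antisymm h4, forms_natCast, finrank_homogeneousSubmodule]

end SpecialCases

/-! ### Proof of the theorem. -/

lemma factorial_cast_ne_zero {K : Type*} [Field K] {m b : ℕ}
    (h : ringChar K = 0 ∨ m < ringChar K) (hb : b ≤ m) : (b.factorial : K) ≠ 0 := by
  intro h0
  rw [ringChar.spec] at h0
  rcases h with h | h
  · rw [h, zero_dvd_iff] at h0
    exact Nat.factorial_ne_zero b h0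
  · rcases CharP.char_is_prime_or_zero K (ringChar K) with hp | hp
    · have := (hp.dvd_factorial).1 h0
      omega
    · omega

lemma frobergIarrobino_eq_sum_numForms {d N s : ℕ} {C : Fin d → ℤ} {J : Fin d → ℕ}
    (hC : ∀ i, C i = s + 1 - J i) (hpair : ∀ i l, i ≠ l → s < J i + J l)
    (h : ¬ ∃ T : Finset (Fin d), frobergSum (fun i => (J i : ℤ)) T N s ≤ 0) :
    frobergIarrobino d C N s = ∑ i, numForms N (s - J i) := by
  rw [frobergIarrobino_eq hC, froberg_eq_frobergSum h, frobergSum_eq_koszulEuler,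
    koszulEuler_of_lt (fun i => (J i : ℤ)) (fun i _ => by positivity) N
      (fun i _ l _ hil => by exact_mod_cast hpair i l hil)]
  ring

theorem corollary8p7 {K : Type*} [Field K] [Infinite K] (n m d : ℕ) (hn : 1 ≤ n) (hd : 1 ≤ d)
    (k : Fin (d + 1) → ℕ) (hmono : Monotone k)
    (hnum : 2 * k ⟨d - 1, by omega⟩ + k (Fin.last d) ≤ 2 * m + 2)
    (C : Fin d → ℤ)
    (hC : ∀ i, C i = (k i.castSucc : ℤ) - ((m : ℤ) + 1 - (k (Fin.last d) : ℤ)))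
    (hHG : (HPTS K d C n (k (Fin.last d) - 1) : ℤ) =
      frobergIarrobino d C n (k (Fin.last d) - 1)) :
    (HPTS K (d + 1) (fun i => (k i : ℤ)) (n + 1) m : ℤ) ≤
        frobergIarrobino (d + 1) (fun i => (k i : ℤ)) (n + 1) m ∧
      ((ringChar K = 0 ∨ m < ringChar K) →
        ((ForGeneric fun p : Fin (d + 1) → ProjPoint K (n + 1) =>
            OnlyExpectedLinearObstructions p k m) →
          (HPTS K (d + 1) (fun i => (k i : ℤ)) (n + 1) m : ℤ) =
            frobergIarrobino (d + 1) (fun i => (k i : ℤ)) (n + 1) m) ∧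
        (frobergIarrobino (d + 1) (fun i => (k i : ℤ)) (n + 1) m < ((n + m).choose n : ℤ) →
          (HPTS K (d + 1) (fun i => (k i : ℤ)) (n + 1) m : ℤ) =
            frobergIarrobino (d + 1) (fun i => (k i : ℤ)) (n + 1) m →
          ForGeneric fun p : Fin (d + 1) → ProjPoint K (n + 1) =>
            OnlyExpectedLinearObstructions p k m)) := by
  obtain ⟨n, rfl⟩ : ∃ n', n = n' + 1 := ⟨n - 1, by omega⟩
  have hdim : (((n + 1 + m).choose (n + 1) : ℕ) : ℤ) = numForms (n + 2) m := by
    rw [numForms_natCast, Nat.multichoose_eq, ← Nat.choose_symm_of_eq_add (a := m) (b := n + 1)]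
    · congr 2; omega
    · omega
  rw [hdim]
  -- In the degenerate case G is dim S_m: the inequality is trivial, equality holds in good
  -- characteristic, and the premise of the converse fails. All degenerate data below are excluded
  -- by reference to this case.
  by_cases hfull : froberg (d + 1) (fun i => (m : ℤ) + 1 - k i) (n + 2) m = 0 ∧
      ((ringChar K = 0 ∨ m < ringChar K) → HPTS K (d + 1) (fun i => (k i : ℤ)) (n + 2) m =
        (n + 2).multichoose m)
  · obtain ⟨h0, h1⟩ := hfull
    have hG : frobergIarrobino (d + 1) (fun i => (k i : ℤ)) (n + 2) m = numForms (n + 2) m := by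
      rw [frobergIarrobino, h0, sub_zero]
    rw [hG]
    refine ⟨?_, fun hchar => ⟨fun _ => ?_, fun hlt _ => absurd hlt (lt_irrefl _)⟩⟩
    · rw [numForms_natCast]
      exact_mod_cast hpts_le_multichoose _ _
    · rw [h1 hchar, numForms_natCast]
  have hko : k (Fin.last d) ≤ m := by
    by_contra! hko
    exact hfull ⟨froberg_eq_zero (exists_frobergSum_nonpos_of_nonpos (o := Fin.last d) (by omega)),
      fun _ => hpts_eq_multichoose_of_lt (o := Fin.last d) (by exact_mod_cast hko)⟩
  have hle : ∀ i, k i ≤ k (Fin.last d) := fun i => hmono (Fin.le_last i)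
  obtain ⟨J, hkJ⟩ : ∃ J : Fin (d + 1) → ℕ, ∀ i, k i + J i = m + 1 :=
    ⟨fun i => m + 1 - k i, fun i => by have := hle i; dsimp only; omega⟩
  have hkJo := hkJ (Fin.last d)
  have hJ : ∀ i, 1 ≤ J i := fun i => by have := hkJ i; have := hle i; omega
  have hJo : ∀ i, J (Fin.last d) ≤ J i := fun i => by
    have := hkJ i; have := hle i; omega
  have htriple := triple_sum_lt hd hmono hnum hkJ
  have hfun : (fun i => (m : ℤ) + 1 - k i) = fun i => (J i : ℤ) := by
    ext i; have := hkJ i; omega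
  obtain ⟨hindQ, hindK⟩ : (Generically fun q : Fin d → Fin (n + 1) → ℚ =>
        Indep q (fun i => J i.castSucc) Finset.univ ((m : ℤ) - J (Fin.last d))) ∧
      ((ringChar K = 0 ∨ m < ringChar K) → Generically fun q : Fin d → Fin (n + 1) → K =>
        Indep q (fun i => J i.castSucc) Finset.univ ((m : ℤ) - J (Fin.last d))) := by
    rcases Nat.eq_zero_or_pos (k (Fin.last d)) with hk0 | hk0
    -- For k_{d+1} = 0 the degree m - J_{d+1} is -1 and independence is void. The truncated degree
    -- k_{d+1} - 1 in the hypothesis does not matter here.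
    · exact ⟨generically_of_forall fun q g hg _ i _ => eq_zero_of_mem_forms (by omega) (hg i),
        fun _ => generically_of_forall fun q g hg _ i _ => eq_zero_of_mem_forms (by omega) (hg i)⟩
    obtain ⟨s, hs⟩ : ∃ s, k (Fin.last d) = s + 1 := ⟨k (Fin.last d) - 1, by omega⟩
    have hsm : s + J (Fin.last d) = m := by omega
    have hCs : ∀ i, C i = s + 1 - J i.castSucc := fun i => by
      have := hkJ i.castSucc
      rw [hC i]
      omega
    have hpair : ∀ i l : Fin d, i ≠ l → s < J i.castSucc + J l.castSucc := fun i l hil => by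
      have := htriple i.castSucc l.castSucc (Fin.last d) (fun h => hil (Fin.castSucc_injective d h))
        (Fin.castSucc_ne_last i) (Fin.castSucc_ne_last l)
      omega
    have hsub : k (Fin.last d) - 1 = s := by omega
    rw [hsub] at hHG
    by_cases hF : ∃ T : Finset (Fin d), frobergSum (fun i => (J i.castSucc : ℤ)) T (n + 1) s ≤ 0
    · refine absurd ⟨?_, fun hchar => ?_⟩ hfull
      · have := exists_frobergSum_nonpos hJ hJo hpair hF
        rw [hsm] at this
        rw [hfun, froberg_eq_zero this]
      · refine hpts_eq_multichoose_of_hpts_eq (factorial_cast_ne_zero hchar le_rfl)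
          (factorial_cast_ne_zero hchar (by omega)) hsm (J := J)
          (fun i => by have := hkJ i; omega) hCs ?_
        rw [frobergIarrobino_eq hCs, froberg_eq_zero hF, sub_zero, numForms_natCast] at hHG
        exact_mod_cast hHG
    · rw [frobergIarrobino_eq_sum_numForms hCs hpair hF] at hHG
      have hsub' : (m : ℤ) - J (Fin.last d) = s := by omega
      rw [hsub']
      refine ⟨?_, fun hchar => generically_indep_of_hpts_eq
        (factorial_cast_ne_zero hchar (by omega)) hCs hHG⟩
      -- The hypothesis over K passes to ℚ in every characteristic: its value is the largest
      -- possible over ℚ, and the Hilbert function over ℚ is at least the one over K.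
      have hsQ : (s.factorial : ℚ) ≠ 0 := by exact_mod_cast s.factorial_ne_zero
      refine generically_indep_of_hpts_eq hsQ hCs
        ((hpts_le_sum_numForms hsQ hCs).antisymm ?_)
      rw [← hHG]
      exact_mod_cast hpts_le_hpts_rat C
  have hmQ : (m.factorial : ℚ) ≠ 0 := by exact_mod_cast m.factorial_ne_zero
  refine ⟨le_trans (by exact_mod_cast hpts_le_hpts_rat _)
    (hpts_le_frobergIarrobino hmQ hd hkJ htriple (generically_indepMod hJo hindQ)), fun hchar => ?_⟩
  have hm := factorial_cast_ne_zero hchar le_rfl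
  have hgen := generically_indepMod hJo (hindK hchar)
  exact ⟨hpts_eq_frobergIarrobino hm hd hkJ htriple hgen hJ,
    forGeneric_onlyExpectedLinearObstructions hm hd hkJ htriple hgen hJ⟩
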